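/- Let $H$ be the finite graph consisting of two disjoint copies of $K_{15}$, with vertex sets $\{x_1,\dots,x_{15}\}$ and $\{y_1,\dots,y_{15}\}$, together with the three edges $x_1y_1$, $x_2y_2$, $x_3y_3$. For every positive integer $q$ there is a finite graph $G_q$ such that $H$ is not a $3$-fat minor of $G_q$, but every (possibly infinite) graph $\widehat G$ to which $G_q$ is $q$-quasi-isometric contains $H$ as a $2$-fat minor and also as a minor. In particular, $G_q$ is not $q$-quasi-isometric to any graph with no $2$-fat $H$ minor, nor to any graph with no $H$ minor. Here graphs are simple, $\mathrm{dist}_G$ is the graph distance on $V(G)$ (infinite between different components), and the distance between two vertex sets is the minimum distance between their elements. For a positive integer $K$, $H$ is a *$K$-fat minor* of $G$ if there are non-empty sets $B_v\subseteq V(G)$ $(v\in V(H))$ and $P_e\subseteq V(G)$ $(e\in E(H))$, each inducing a connected subgraph of $G$, such that $B_v\cap P_e\neq\emptyset$ whenever $v$ is an end of $e$, and any two members of this family with distinct indices that are not of the form $B_v,P_e$ with $v$ an end of $e$ are at distance at least $K$ in $G$. The graph $H$ is a *minor* of $G$ if there are pairwise disjoint non-empty sets $B_v\subseteq V(G)$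 $(v\in V(H))$, each inducing a connected subgraph of $G$, such that $G$ has an edge between $B_u$ and $B_v$ whenever $uv\in E(H)$. The graph $G$ is *$q$-quasi-isometric* to $\widehat G$ if there is a map $\phi\colon V(G)\to V(\widehat G)$ such that $$q^{-1}\,\mathrm{dist}_G(x,y)-q\;\le\;\mathrm{dist}_{\widehat G}(\phi(x),\phi(y))\;\le\; q\,\mathrm{dist}_G(x,y)+q\qquad\text{for all }x,y\in V(G),$$ and every vertex $\widehat v$ of $\widehat G$ satisfies $\mathrm{dist}_{\widehat G}(\widehat v,\phi(v))\le q$ for some $v\in V(G)$. -/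

import Mathlib

open scoped ENNReal

namespace FatMinor

/-- The distance between two vertex sets of a graph: the least length of a path between them
(`⊤` if there is none). -/
noncomputable def setDist {V : Type*} (G : SimpleGraph V) (X Y : Set V) : ℕ∞ :=
  ⨅ x ∈ X, ⨅ y ∈ Y, G.edist x y

/-- A `K`-fat minor model of `H` in `G`: connected branch sets `B v` for the vertices and
connected sets `P e` for the edges of `H`, such that `B v` meets `P e` whenever `v` is an end
of `e`, and all other pairs of distinct members of the family are at distance at least `K`. -/
structure IsFatMinorModel {α V : Type*} (K : ℕ) (H : SimpleGraph α) (G : SimpleGraph V)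
    (B : α → Set V) (P : H.edgeSet → Set V) : Prop where
  connected_branch : ∀ v, (G.induce (B v)).Connected
  connected_edge : ∀ e, (G.induce (P e)).Connected
  meet : ∀ v (e : H.edgeSet), v ∈ (e : Sym2 α) → (B v ∩ P e).Nonempty
  branch_branch : ∀ u v, u ≠ v → (K : ℕ∞) ≤ setDist G (B u) (B v)
  edge_edge : ∀ e f, e ≠ f → (K : ℕ∞) ≤ setDist G (P e) (P f)
  branch_edge : ∀ v (e : H.edgeSet), v ∉ (e : Sym2 α) → (K : ℕ∞) ≤ setDist G (B v) (P e)

/-- `H` is a `K`-fat minor of `G`. -/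
def IsFatMinor {α V : Type*} (K : ℕ) (H : SimpleGraph α) (G : SimpleGraph V) : Prop :=
  ∃ (B : α → Set V) (P : H.edgeSet → Set V), IsFatMinorModel K H G B P

/-- `H` is a minor of `G`: there are pairwise disjoint connected branch sets, one for each vertex
of `H`, with an edge of `G` between any two branch sets of adjacent vertices of `H`. -/
def IsMinor {α V : Type*} (H : SimpleGraph α) (G : SimpleGraph V) : Prop :=
  ∃ B : α → Set V,
    (∀ v, (G.induce (B v)).Connected) ∧
    (∀ u v, u ≠ v → Disjoint (B u) (B v)) ∧
    (∀ u v, H.Adj u v → ∃ x ∈ B u, ∃ y ∈ B v, G.Adj x y)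

/-- `φ` is a `q`-quasi-isometry of the graph `G` into the graph `G'`, for the graph distances
(with value `∞` between different components). The subtraction is the truncated one, which
makes no difference since the right-hand side is nonnegative. -/
structure IsQuasiIsometry {V W : Type*} (q : ℕ) (G : SimpleGraph V) (G' : SimpleGraph W)
    (φ : V → W) : Prop where
  lower : ∀ x y, (q : ℝ≥0∞)⁻¹ * (G.edist x y : ℝ≥0∞) - q ≤ (G'.edist (φ x) (φ y) : ℝ≥0∞)
  upper : ∀ x y, (G'.edist (φ x) (φ y) : ℝ≥0∞) ≤ q * (G.edist x y : ℝ≥0∞) + q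
  dense : ∀ w, ∃ v, (G'.edist w (φ v) : ℝ≥0∞) ≤ q

/-- `G` is `q`-quasi-isometric to `G'`. -/
def IsQuasiIsometric {V W : Type*} (q : ℕ) (G : SimpleGraph V) (G' : SimpleGraph W) : Prop :=
  ∃ φ : V → W, IsQuasiIsometry q G G' φ

/-- Two disjoint copies of `K₁₅`, on `x₀, …, x₁₄` (left) and `y₀, …, y₁₄` (right), together with
the three edges `x₀y₀`, `x₁y₁`, `x₂y₂`. -/
def linkedK15 : SimpleGraph (Fin 15 ⊕ Fin 15) where
  Adj
    | .inl i, .inl j => i ≠ j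
    | .inr i, .inr j => i ≠ j
    | .inl i, .inr j => i = j ∧ (i : ℕ) < 3
    | .inr i, .inl j => i = j ∧ (i : ℕ) < 3
  symm := ⟨by
    rintro (i | i) (j | j) h
    · exact Ne.symm h
    · obtain ⟨rfl, h⟩ := h; exact ⟨rfl, h⟩
    · obtain ⟨rfl, h⟩ := h; exact ⟨rfl, h⟩
    · exact Ne.symm h⟩
  loopless := ⟨by rintro (i | i) h <;> exact h rfl⟩

end FatMinor

/-! The graph `fatGraph` is a strip between two subdivided copies of $K_{15}$. The strip is a binary
tree with an extra node `t 0` above its root, together with a row of nodes `y i`. Column `i`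
consists of the leaf `x i` and of `y i`; consecutive columns are joined by every possible long edge
except the one between the two leaves. Each clique is attached at three places: the two nodes of its
end column, and `t 0`. Tree edges are short, all other edges are long.

Why there is no 3-fat model. A $K_{15}$ model cannot be split by 13 vertices, whereas the strip
falls apart recursively along smaller separators. Hence all branch sets of a $K_{15}$ contain
original vertices of one and the same clique (`exists_clique_side`). The two halves of `linkedK15`
therefore occupy different cliques, and the three cross edges yield three connections between the
cliques, pairwise at distance at least 3. One of them contains `t 0`, and the other two cross the
strip. By `coloring`, one of these two contains the root, a neighbour of `t 0`: contradiction. The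
lemma `coloring` is proved by induction on the height. If neither set contains the top node, both
pass between the two middle columns. As leaves are not joined there, the sets exchange leaf and `y`,
so the two middle leaves belong to different sets. By induction the two children of the top node
then belong to different sets as well, but they are at distance 2.

Why every quasi-isometric graph has a 2-fat model. Thicken the image of the tree, delete a large
ball around the image of `t 0`, and label each leaf by its component in the rest. For every
labelling of the leaves there are two label-disjoint connections across the strip (`exists_state`):
one waits in its component while the other advances along the row `y`, and they change roles at the
last column in which that label occurs. A third connection runs through `t 0`. Distinct components
are not adjacent, and long edges stay far from each other except near their ends. So label-disjoint
families of long edges turn into connected sets at distance at least 2 (`share_of_edist_le_one`). A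
fat minor is also a minor (`IsFatMinor.isMinor`). -/

namespace FatMinor

/-! ### Connectedness expressed by cuts -/

section CutConnected

variable {α β : Type*} {r : α → α → Prop}

/-- A set `R` is cut-connected for the relation `r` if any way of splitting `R` into two nonempty
parts is crossed by `r`. -/
def CutConnected (r : α → α → Prop) (R : Set α) : Prop :=
  ∀ X : Set α, ∀ u ∈ R, u ∈ X → ∀ w ∈ R, w ∉ X → ∃ u' ∈ R, u' ∈ X ∧ ∃ w' ∈ R, w' ∉ X ∧ r u' w'

/-- By symmetry of `r` a cut may be replaced by its complement, so only cuts with `c` on the far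
side matter. -/
theorem cutConnected_of_center (hr : ∀ ⦃a b⦄, r a b → r b a) {R : Set α} (c : α)
    (h : ∀ X : Set α, c ∉ X → ∀ w ∈ R, w ∈ X → ∃ u' ∈ R, u' ∈ X ∧ ∃ w' ∈ R, w' ∉ X ∧ r u' w') :
    CutConnected r R := by
  intro X u hu huX w hw hwX
  by_cases hc : c ∈ X
  · obtain ⟨u', hu', h1, w', hw', h2, h3⟩ := h Xᶜ (by simpa using hc) w hw hwX
    exact ⟨w', hw', by simpa using h2, u', hu', h1, hr h3⟩
  · exact h X hc u hu huX

/-- Either the cut splits some `F i`, or it induces a cut of the index set. In the latter case an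
`r'`-step leads from some `F k` inside `X` to an `F l` not inside `X`, and their common point shows
that `F l` is split. -/
theorem CutConnected.iUnion {r' : β → β → Prop} {I : Set β} (hI : CutConnected r' I)
    {F : β → Set α} (hF : ∀ i ∈ I, CutConnected r (F i))
    (hr : ∀ i ∈ I, ∀ j ∈ I, r' i j → (F i ∩ F j).Nonempty) :
    CutConnected r (⋃ i ∈ I, F i) := by
  intro X u hu huX w hw hwX
  simp only [Set.mem_iUnion, exists_prop] at hu hw
  obtain ⟨i, hi, hu⟩ := hu
  obtain ⟨j, hj, hw⟩ := hw
  have key : ∀ l ∈ I, ∀ p ∈ F l, p ∈ X → ∀ p' ∈ F l, p' ∉ X →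
      ∃ u' ∈ ⋃ i ∈ I, F i, u' ∈ X ∧ ∃ w' ∈ ⋃ i ∈ I, F i, w' ∉ X ∧ r u' w' := by
    intro l hl p hp hpX p' hp' hpX'
    obtain ⟨u', h1, h2, w', h3, h4, h5⟩ := hF l hl X p hp hpX p' hp' hpX'
    exact ⟨u', Set.mem_biUnion hl h1, h2, w', Set.mem_biUnion hl h3, h4, h5⟩
  by_cases hiX : F i ⊆ X
  · obtain ⟨k, hk, hkX, l, hl, hlX, hkl⟩ := hI {k | F k ⊆ X} i hi hiX j hj (fun h => hwX (h hw))
    obtain ⟨p, hp1, hp2⟩ := hr k hk l hl hkl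
    obtain ⟨p', hp', hpX'⟩ := Set.not_subset.1 hlX
    exact key l hl p hp2 (hkX hp1) p' hp' hpX'
  · obtain ⟨p', hp', hpX'⟩ := Set.not_subset.1 hiX
    exact key i hi u hu huX p' hp' hpX'

theorem CutConnected.union {R S : Set α} (hR : CutConnected r R) (hS : CutConnected r S)
    (h : (R ∩ S).Nonempty) : CutConnected r (R ∪ S) := by
  have h1 : R ∪ S = ⋃ b ∈ (Set.univ : Set Bool), (if b then R else S) := by
    ext x; simp [or_comm]
  rw [h1]
  refine CutConnected.iUnion (r' := fun _ _ => True) ?_ ?_ ?_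
  · intro X u _ hu w _ hw
    exact ⟨u, trivial, hu, w, trivial, hw, trivial⟩
  · rintro (_ | _) -
    · simpa using hS
    · simpa using hR
  · rintro (_ | _) - (_ | _) - -
    · simpa using h.mono Set.inter_subset_right
    · simpa [Set.inter_comm] using h
    · simpa using h
    · simpa using h.mono Set.inter_subset_left

/-- The form in which connectedness is used against separators: a region that cannot be left within
`R` contains all of `R` or nothing of it. -/
theorem CutConnected.subset_or_disjoint {R X : Set α} (hR : CutConnected r R)
    (hX : ∀ u ∈ R, u ∈ X → ∀ w ∈ R, r u w → w ∈ X) : R ⊆ X ∨ ∀ u ∈ R, u ∉ X := by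
  by_contra! h
  obtain ⟨h1, u, hu, huX⟩ := h
  obtain ⟨w, hw, hwX⟩ := Set.not_subset.1 h1
  obtain ⟨u', h1, h2, w', h3, h4, h5⟩ := hR X u hu huX w hw hwX
  exact h4 (hX u' h1 h2 w' h3 h5)

theorem connected_induce_iff {V : Type*} {G : SimpleGraph V} {R : Set V} :
    (G.induce R).Connected ↔ R.Nonempty ∧ CutConnected G.Adj R := by
  constructor
  · intro h
    refine ⟨Set.nonempty_coe_sort.1 h.nonempty, ?_⟩
    intro X u hu huX w hw hwX
    obtain ⟨p⟩ := h.preconnected ⟨u, hu⟩ ⟨w, hw⟩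
    have key : ∀ (a b : R), (G.induce R).Walk a b → a.1 ∈ X → b.1 ∉ X →
        ∃ u' ∈ R, u' ∈ X ∧ ∃ w' ∈ R, w' ∉ X ∧ G.Adj u' w' := by
      intro a b p
      induction p with
      | nil => intro h1 h2; exact absurd h1 h2
      | @cons a c b hac p ih =>
        intro h1 h2
        by_cases hc : c.1 ∈ X
        · exact ih hc h2
        · exact ⟨a.1, a.2, h1, c.1, c.2, hc, hac⟩
    exact key _ _ p huX hwX
  · rintro ⟨⟨x, hx⟩, h⟩
    rw [SimpleGraph.connected_iff_exists_forall_reachable]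
    refine ⟨⟨x, hx⟩, ?_⟩
    rintro ⟨w, hw⟩
    by_contra hn
    obtain ⟨u', hu', h1, w', hw', h2, h3⟩ :=
      h {z | ∃ hz : z ∈ R, (G.induce R).Reachable ⟨x, hx⟩ ⟨z, hz⟩} x hx ⟨hx, .rfl⟩ w hw
        (fun ⟨_, h⟩ => hn h)
    obtain ⟨hz, h1⟩ := h1
    exact h2 ⟨hw', h1.trans (SimpleGraph.Adj.reachable (G := G.induce R)
      (u := ⟨u', hz⟩) (v := ⟨w', hw'⟩) h3)⟩

/-- The points that can be reached from `x` by `r`-steps into `X`. -/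
def compOf (r : α → α → Prop) (X : Set α) (x : α) : Set α :=
  {y | Relation.ReflTransGen (fun a b => r a b ∧ b ∈ X) x y}

theorem mem_compOf_self (X : Set α) (x : α) : x ∈ compOf r X x := Relation.ReflTransGen.refl

theorem compOf_closed {X : Set α} {x u w : α} (hu : u ∈ compOf r X x) (h : r u w) (hw : w ∈ X) :
    w ∈ compOf r X x := Relation.ReflTransGen.tail hu ⟨h, hw⟩

theorem compOf_subset {X : Set α} {x : α} (hx : x ∈ X) : compOf r X x ⊆ X := by
  intro y hy
  induction hy with
  | refl => exact hx
  | tail _ h _ => exact h.2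

theorem cutConnected_compOf (hr : ∀ ⦃a b⦄, r a b → r b a) (X : Set α) (x : α) :
    CutConnected r (compOf r X x) := by
  refine cutConnected_of_center hr x ?_
  intro Y hxY w hw hwY
  have hw' : Relation.ReflTransGen (fun a b => r a b ∧ b ∈ X) x w := hw
  induction hw' with
  | refl => exact absurd hwY hxY
  | @tail b c hb h ih =>
    by_cases hbY : b ∈ Y
    · exact ih hb hbY
    · exact ⟨c, hw, hwY, b, hb, hbY, hr h.1⟩

/-- A cut-connected set inside `X` that meets the component of `x` lies in it. -/
theorem CutConnected.subset_compOf {R X : Set α} {x : α} (hR : CutConnected r R) (hRX : R ⊆ X)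
    {y : α} (hyR : y ∈ R) (hy : y ∈ compOf r X x) : R ⊆ compOf r X x := by
  rcases hR.subset_or_disjoint (X := compOf r X x)
    (fun u _ hu w hw h => compOf_closed hu h (hRX hw)) with h | h
  · exact h
  · exact absurd hy (h y hyR)

theorem compOf_eq (hr : ∀ ⦃a b⦄, r a b → r b a) {X : Set α} {x y : α} (hx : x ∈ X)
    (hy : y ∈ compOf r X x) : compOf r X y = compOf r X x := by
  have hyX := compOf_subset hx hy
  have h1 : compOf r X y ⊆ compOf r X x :=
    (cutConnected_compOf hr X y).subset_compOf (compOf_subset hyX) (mem_compOf_self X y) hy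
  have h2 : compOf r X x ⊆ compOf r X y :=
    (cutConnected_compOf hr X x).subset_compOf (compOf_subset hx) hy (mem_compOf_self X y)
  exact h1.antisymm h2

end CutConnected

/-! ### Distance estimates -/

section Distance

variable {V : Type*} {G : SimpleGraph V}

theorem le_setDist_iff {X Y : Set V} {d : ℕ∞} :
    d ≤ setDist G X Y ↔ ∀ x ∈ X, ∀ y ∈ Y, d ≤ G.edist x y := by
  simp [setDist, le_iInf_iff]

/-- Lower bounds for distances in the construction are obtained from such potentials. -/
theorem lipschitz_le_edist {f : V → ℕ} (hf : ∀ u v, G.Adj u v → f u ≤ f v + 1) (u v : V) :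
    (f u : ℕ∞) ≤ f v + G.edist u v := by
  by_cases h : G.Reachable u v
  · obtain ⟨p, hp⟩ := h.exists_walk_length_eq_edist
    rw [← hp]
    have : ∀ u v (p : G.Walk u v), f u ≤ f v + p.length := by
      intro u v p
      induction p with
      | nil => simp
      | cons h p ih => have := hf _ _ h; simp only [SimpleGraph.Walk.length_cons]; omega
    exact_mod_cast this u v p
  · rw [SimpleGraph.edist_eq_top_of_not_reachable h]; simp

theorem cutConnected_ball (c : V) (m : ℕ) : CutConnected G.Adj {w | G.edist w c ≤ m} := by
  refine cutConnected_of_center (fun _ _ h => h.symm) c ?_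
  intro X hc w hw hwX
  have key : ∀ w d (p : G.Walk w d), d = c → p.length ≤ m → w ∈ X →
      ∃ u' ∈ {w | G.edist w c ≤ m}, u' ∈ X ∧ ∃ w' ∈ {w | G.edist w c ≤ m}, w' ∉ X ∧ G.Adj u' w' := by
    intro w d p hd
    induction p with
    | nil => intro _ h; exact absurd (hd ▸ h) hc
    | @cons u v d h p ih =>
      intro hl hu
      simp only [SimpleGraph.Walk.length_cons] at hl
      by_cases hv : v ∈ X
      · exact ih hd (by omega) hv
      · subst hd
        refine ⟨u, ?_, hu, v, ?_, hv, h⟩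
        · exact ((SimpleGraph.Walk.cons h p).edist_le).trans (by exact_mod_cast hl)
        · exact p.edist_le.trans (by exact_mod_cast (by omega))
  have hw' : G.edist w c ≤ m := hw
  have hr : G.Reachable w c := by
    by_contra h
    rw [SimpleGraph.edist_eq_top_of_not_reachable h] at hw'
    simp at hw'
  obtain ⟨p, hp⟩ := hr.exists_walk_length_eq_edist
  rw [← hp] at hw'
  exact key w c p rfl (by exact_mod_cast hw') hwX

theorem two_le_edist {x y : V} (h1 : x ≠ y) (h2 : ¬ G.Adj x y) : (2 : ℕ∞) ≤ G.edist x y := by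
  by_contra! h
  have h' : G.edist x y ≤ 1 := Order.le_of_lt_add_one (by simpa [one_add_one_eq_two] using h)
  rcases Order.le_one_iff.1 h' with h | h
  · exact h1 (SimpleGraph.edist_eq_zero_iff.1 h)
  · exact h2 (SimpleGraph.edist_eq_one_iff_adj.1 h)

theorem disjoint_of_le_setDist {X Y : Set V} {K : ℕ} (hK : 1 ≤ K)
    (h : (K : ℕ∞) ≤ setDist G X Y) : Disjoint X Y := by
  rw [Set.disjoint_left]
  intro z hx hy
  have := le_setDist_iff.1 h z hx z hy
  simp at this
  omega

end Distance

/-! ### Fat minors are minors -/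

section FatMinor

variable {α V : Type*} {H : SimpleGraph α} {G : SimpleGraph V} {K : ℕ}

/-- A fat minor is a minor: each set `P e` is split between the two branch sets it joins. -/
theorem IsFatMinor.isMinor (hK : 1 ≤ K) (h : IsFatMinor K H G) : IsMinor H G := by
  obtain ⟨B, P, h⟩ := h
  have hB : ∀ v, (B v).Nonempty ∧ CutConnected G.Adj (B v) :=
    fun v => connected_induce_iff.1 (h.connected_branch v)
  have hP : ∀ e, (P e).Nonempty ∧ CutConnected G.Adj (P e) :=
    fun e => connected_induce_iff.1 (h.connected_edge e)
  have dBB : ∀ u v, u ≠ v → Disjoint (B u) (B v) :=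
    fun u v huv => disjoint_of_le_setDist hK (h.branch_branch u v huv)
  have dPP : ∀ e f, e ≠ f → Disjoint (P e) (P f) :=
    fun e f hef => disjoint_of_le_setDist hK (h.edge_edge e f hef)
  have dBP : ∀ v (e : H.edgeSet), v ∉ (e : Sym2 α) → Disjoint (B v) (P e) :=
    fun v e hve => disjoint_of_le_setDist hK (h.branch_edge v e hve)
  have hends : ∀ e : H.edgeSet, ∃ u v, (e : Sym2 α) = s(u, v) := by
    rintro ⟨e, he⟩
    induction e with | _ u v => exact ⟨u, v, rfl⟩
  choose o t hot using hends
  have hne : ∀ e, o e ≠ t e := by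
    intro e
    have := e.2
    rw [hot e] at this
    exact H.ne_of_adj this
  have ho : ∀ e, (B (o e) ∩ P e).Nonempty := fun e => h.meet _ e (by rw [hot e]; simp)
  have ht : ∀ e, (B (t e) ∩ P e).Nonempty := fun e => h.meet _ e (by rw [hot e]; simp)
  choose x hxB hxP using ho
  have hx : ∀ e, x e ∈ P e \ B (t e) :=
    fun e => ⟨hxP e, fun hh => Set.disjoint_left.1 (dBB _ _ (hne e)) (hxB e) hh⟩
  -- The part of `P e` reached from the chosen end `o e` before entering `B (t e)`. It is added to
  -- `B (o e)`; a step that leaves it inside `P e` can only land in `B (t e)`, which gives the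
  -- required edge.
  let D : H.edgeSet → Set V := fun e => compOf G.Adj (P e \ B (t e)) (x e)
  have hD : ∀ e, D e ⊆ P e \ B (t e) := fun e => compOf_subset (hx e)
  let B' : α → Set V := fun v => {z | z ∈ B v ∨ ∃ e, o e = v ∧ z ∈ D e}
  have hB' : ∀ v z, z ∈ B' v ↔ z ∈ B v ∨ ∃ e, o e = v ∧ z ∈ D e := fun v z => Iff.rfl
  have symG : ∀ ⦃a b⦄, G.Adj a b → G.Adj b a := fun _ _ h => h.symm
  refine ⟨B', fun v => ?_, fun u v huv => ?_, fun u v huv => ?_⟩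
  · rw [connected_induce_iff]
    obtain ⟨z, hz⟩ := (hB v).1
    refine ⟨⟨z, (hB' v z).2 (Or.inl hz)⟩, ?_⟩
    refine cutConnected_of_center symG z ?_
    intro X hzX w hw hwX
    have key : ∀ S : Set V, S ⊆ B' v → CutConnected G.Adj S → z ∈ S → w ∈ S →
        ∃ u' ∈ B' v, u' ∈ X ∧ ∃ w' ∈ B' v, w' ∉ X ∧ G.Adj u' w' := by
      intro S hS hSc hzS hwS
      obtain ⟨u', h1, h2, w', h3, h4, h5⟩ := hSc X w hwS hwX z hzS hzX
      exact ⟨u', hS h1, h2, w', hS h3, h4, h5⟩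
    rcases (hB' v w).1 hw with h1 | ⟨e, rfl, h1⟩
    · exact key (B v) (fun y hy => (hB' v y).2 (Or.inl hy)) (hB v).2 hz h1
    · refine key (B (o e) ∪ D e) ?_ ?_ (Or.inl hz) (Or.inr h1)
      · rintro y (hy | hy)
        exacts [(hB' _ y).2 (Or.inl hy), (hB' _ y).2 (Or.inr ⟨e, rfl, hy⟩)]
      · exact (hB _).2.union (cutConnected_compOf symG _ _) ⟨x e, hxB e, mem_compOf_self _ _⟩
  · have key : ∀ u v, u ≠ v → ∀ z ∈ B u, ∀ e, o e = v → z ∉ D e := by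
      intro u v huv z hz e he hzD
      obtain ⟨h1, h2⟩ := hD e hzD
      by_cases hu : u = t e
      · exact h2 (hu ▸ hz)
      · refine Set.disjoint_left.1 (dBP u e ?_) hz h1
        rw [hot e, Sym2.mem_iff]
        rintro (h | h)
        exacts [huv (h.trans he), hu h]
    rw [Set.disjoint_left]
    intro z hu hv
    rcases (hB' u z).1 hu with h1 | ⟨e, he, h1⟩ <;> rcases (hB' v z).1 hv with h2 | ⟨f, hf, h2⟩
    · exact Set.disjoint_left.1 (dBB u v huv) h1 h2
    · exact key u v huv z h1 f hf h2
    · exact key v u huv.symm z h2 e he h1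
    · refine Set.disjoint_left.1 (dPP e f ?_) (hD e h1).1 (hD f h2).1
      rintro rfl
      exact huv (he.symm.trans hf)
  · let e : H.edgeSet := ⟨s(u, v), huv⟩
    have key : ∃ y ∈ B' (o e), ∃ w ∈ B' (t e), G.Adj y w := by
      obtain ⟨w, hwB, hwP⟩ := ht e
      obtain ⟨y, hy, hyD, w', hw', hwD, hyw⟩ := (hP e).2 (D e) (x e) (hxP e)
        (mem_compOf_self _ _) w hwP (fun h => (hD e h).2 hwB)
      refine ⟨y, (hB' _ y).2 (Or.inr ⟨e, rfl, hyD⟩), w', (hB' _ _).2 (Or.inl ?_), hyw⟩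
      by_contra hn
      exact hwD (compOf_closed hyD hyw ⟨hw', hn⟩)
    have := hot e
    rcases Sym2.eq_iff.1 this with ⟨h1, h2⟩ | ⟨h1, h2⟩
    · rw [← h1, ← h2] at key; exact key
    · rw [← h1, ← h2] at key
      obtain ⟨y, hy, w, hw, hyw⟩ := key
      exact ⟨w, hw, y, hy, hyw.symm⟩

end FatMinor

end FatMinor
namespace FatMinor

/-! ### Graphs with long edges -/

section Subdivision

variable {N E : Type*} (T : SimpleGraph N) (src tgt : E → N) (L : ℕ)

/-- The graph obtained from the graph `T` on `N` by adding, for every `e : E`, a path with `L`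
interior vertices from `src e` to `tgt e`. -/
def addPaths : SimpleGraph (N ⊕ E × Fin L) where
  Adj
    | .inl u, .inl v => T.Adj u v
    | .inl u, .inr (e, i) => (u = src e ∧ (i : ℕ) = 0) ∨ (u = tgt e ∧ (i : ℕ) + 1 = L)
    | .inr (e, i), .inl u => (u = src e ∧ (i : ℕ) = 0) ∨ (u = tgt e ∧ (i : ℕ) + 1 = L)
    | .inr (e, i), .inr (f, j) => e = f ∧ ((i : ℕ) + 1 = j ∨ (j : ℕ) + 1 = i)
  symm := ⟨by
    rintro (u | ⟨e, i⟩) (v | ⟨f, j⟩) h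
    · exact h.symm
    · exact h
    · exact h
    · exact ⟨h.1.symm, h.2.symm⟩⟩
  loopless := ⟨by
    rintro (u | ⟨e, i⟩) h
    · exact T.loopless.irrefl _ h
    · have := h.2; omega⟩

/-- Adjacency of nodes when every added path is contracted to an edge. -/
def BaseAdj (u v : N) : Prop :=
  T.Adj u v ∨ ∃ e, (src e = u ∧ tgt e = v) ∨ (src e = v ∧ tgt e = u)

variable {T src tgt L}

theorem BaseAdj.symm {u v : N} (h : BaseAdj T src tgt u v) : BaseAdj T src tgt v u := by
  rcases h with h | ⟨e, h | h⟩
  exacts [Or.inl h.symm, Or.inr ⟨e, Or.inr h⟩, Or.inr ⟨e, Or.inl h⟩]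

/-- The nodes in a connected set of `addPaths` are connected along `BaseAdj`. -/
theorem CutConnected.nodes {R : Set (N ⊕ E × Fin L)}
    (hR : CutConnected (addPaths T src tgt L).Adj R) :
    CutConnected (BaseAdj T src tgt) (Sum.inl ⁻¹' R) := by
  intro X u hu huX w hw hwX
  by_contra! hn
  -- The interior of a path is put on the side of `X` as soon as one of its ends lies in `R ∩ X`. A
  -- crossing of this cut in `R` must then be a crossing of `X` along `BaseAdj`.
  let X' : Set (N ⊕ E × Fin L) := {z | match z with
    | .inl v => v ∈ X
    | .inr (e, _) => (Sum.inl (src e) ∈ R ∧ src e ∈ X) ∨ (Sum.inl (tgt e) ∈ R ∧ tgt e ∈ X)}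
  obtain ⟨u', hu', h1, w', hw', h2, h3⟩ := hR X' (.inl u) hu huX (.inl w) hw hwX
  rcases u' with u' | ⟨e, i⟩ <;> rcases w' with w' | ⟨f, j⟩
  · exact hn u' hu' h1 w' hw' h2 (Or.inl h3)
  · apply h2
    rcases h3 with ⟨rfl, -⟩ | ⟨rfl, -⟩
    exacts [Or.inl ⟨hu', h1⟩, Or.inr ⟨hu', h1⟩]
  · have h1' : (Sum.inl (src e) ∈ R ∧ src e ∈ X) ∨ (Sum.inl (tgt e) ∈ R ∧ tgt e ∈ X) := h1
    rcases h3 with ⟨rfl, -⟩ | ⟨rfl, -⟩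
    · rcases h1' with h | h
      · exact h2 h.2
      · exact hn _ h.1 h.2 _ hw' h2 (Or.inr ⟨e, Or.inr ⟨rfl, rfl⟩⟩)
    · rcases h1' with h | h
      · exact hn _ h.1 h.2 _ hw' h2 (Or.inr ⟨e, Or.inl ⟨rfl, rfl⟩⟩)
      · exact h2 h.2
  · obtain ⟨rfl, -⟩ := h3
    exact h2 h1

/-- The vertices of the added path `e`, with its ends. -/
def closedPath (src tgt : E → N) (L : ℕ) (e : E) : Set (N ⊕ E × Fin L) :=
  {z | z = .inl (src e) ∨ z = .inl (tgt e) ∨ ∃ i, z = .inr (e, i)}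

theorem cutConnected_closedPath (hL : 0 < L) (e : E) :
    CutConnected (addPaths T src tgt L).Adj (closedPath src tgt L e) := by
  have symG : ∀ ⦃a b⦄, (addPaths T src tgt L).Adj a b → (addPaths T src tgt L).Adj b a :=
    fun _ _ h => h.symm
  refine cutConnected_of_center symG (.inl (src e)) ?_
  intro X hX
  have key : ∀ k (hk : k < L), .inr (e, ⟨k, hk⟩) ∈ X →
      ∃ u' ∈ closedPath src tgt L e, u' ∈ X ∧
        ∃ w' ∈ closedPath src tgt L e, w' ∉ X ∧ (addPaths T src tgt L).Adj u' w' := by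
    intro k
    induction k with
    | zero =>
      intro hk h
      exact ⟨_, Or.inr (Or.inr ⟨_, rfl⟩), h, _, Or.inl rfl, hX, Or.inl ⟨rfl, rfl⟩⟩
    | succ k ih =>
      intro hk h
      by_cases hX' : .inr (e, ⟨k, by omega⟩) ∈ X
      · exact ih _ hX'
      · exact ⟨_, Or.inr (Or.inr ⟨_, rfl⟩), h, _, Or.inr (Or.inr ⟨_, rfl⟩), hX', rfl, Or.inr rfl⟩
  intro w hw hwX
  rcases hw with rfl | rfl | ⟨i, rfl⟩
  · exact absurd hwX hX
  · by_cases hX' : .inr (e, ⟨L - 1, by omega⟩) ∈ X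
    · exact key _ _ hX'
    · exact ⟨_, Or.inr (Or.inl rfl), hwX, _, Or.inr (Or.inr ⟨_, rfl⟩), hX',
        Or.inr ⟨rfl, by simp; omega⟩⟩
  · exact key i.1 i.2 hwX

open Classical in
/-- Extension of a function on nodes to the added paths, with value `0` on the paths in `S`. -/
noncomputable def extend (src tgt : E → N) (L : ℕ) (S : Set E) (g : N → ℕ) : N ⊕ E × Fin L → ℕ
  | .inl u => g u
  | .inr (e, i) => if e ∈ S then 0 else min (g (src e) + (i + 1)) (g (tgt e) + (L - i))

/-- The bound `g u ≤ L` ensures that the value at one end of a path exceeds by at most one the value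
reached from the other end along the path. -/
theorem extend_lipschitz {S : Set E} {g : N → ℕ} (hg : ∀ u, g u ≤ L)
    (hT : ∀ u v, T.Adj u v → g u ≤ g v + 1)
    (hS : ∀ e ∈ S, g (src e) = 0 ∧ g (tgt e) = 0) (z z' : N ⊕ E × Fin L)
    (h : (addPaths T src tgt L).Adj z z') :
    extend src tgt L S g z ≤ extend src tgt L S g z' + 1 := by
  rcases z with u | ⟨e, i⟩ <;> rcases z' with v | ⟨f, j⟩
  · exact hT u v h
  · have h1 := hg (src f)
    have h2 := hg (tgt f)
    have h3 := hg u
    simp only [extend]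
    split_ifs with hf
    · have := hS f hf
      rcases h with ⟨rfl, -⟩ | ⟨rfl, -⟩ <;> omega
    · rcases h with ⟨rfl, h⟩ | ⟨rfl, h⟩ <;> omega
  · have h1 := hg (src e)
    have h2 := hg (tgt e)
    simp only [extend]
    split_ifs with hf
    · omega
    · rcases h with ⟨rfl, h⟩ | ⟨rfl, h⟩ <;> omega
  · obtain ⟨rfl, h⟩ := h
    simp only [extend]
    split_ifs
    · omega
    · omega

end Subdivision

/-! ### Models of a complete graph and small separators -/

section CliqueModel

variable {α : Type*} {r : α → α → Prop}

/-- Fifteen disjoint branch sets `B i`, together with sets `P i j` joining them in pairs, all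
these sets being disjoint except for the incident ones. -/
structure IsCliqueModel (r : α → α → Prop) (B : Fin 15 → Set α) (P : Fin 15 → Fin 15 → Set α) :
    Prop where
  nonempty : ∀ i, (B i).Nonempty
  branch_conn : ∀ i, CutConnected r (B i)
  join_conn : ∀ i j, i ≠ j → CutConnected r (B i ∪ P i j ∪ B j)
  branch_branch : ∀ i j, i ≠ j → Disjoint (B i) (B j)
  branch_join : ∀ i j k, i ≠ j → k ≠ i → k ≠ j → Disjoint (B k) (P i j)
  join_join : ∀ i j k l, i ≠ j → k ≠ l → s(i, j) ≠ s(k, l) → Disjoint (P i j) (P k l)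

/-- No branch set lies in `X`. -/
def Small (B : Fin 15 → Set α) (X : Set α) : Prop := ∀ i, ¬ B i ⊆ X

variable {B : Fin 15 → Set α} {P : Fin 15 → Fin 15 → Set α}

/-- Pigeonhole: each element of `Z` lies in at most one of the fifteen disjoint branch sets. -/
theorem IsCliqueModel.exists_avoid (M : IsCliqueModel r B P) (Z : Finset α) (hZ : Z.card < 15) :
    ∃ i, ∀ z ∈ B i, z ∉ Z := by
  by_contra! h
  choose f hf hfZ using h
  have hinj : Function.Injective f := by
    intro i j hij
    by_contra hne
    exact Set.disjoint_left.1 (M.branch_branch i j hne) (hf i) (hij ▸ hf j)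
  have := Finset.card_le_card_of_injOn (s := Finset.univ) f (fun i _ => hfZ i) hinj.injOn
  simp at this
  omega

/-- At most thirteen vertices do not separate two branch sets. -/
theorem IsCliqueModel.not_separated (M : IsCliqueModel r B P) {X : Set α} (Z : Finset α)
    (hZ : Z.card ≤ 13) (hX : ∀ u ∈ X, ∀ w, r u w → w ∈ X ∨ w ∈ Z) {i j : Fin 15}
    (hi : B i ⊆ X) (hj : ∀ z ∈ B j, z ∉ X ∧ z ∉ Z) : False := by
  obtain ⟨xi, hxi⟩ := M.nonempty i
  obtain ⟨xj, hxj⟩ := M.nonempty j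
  have hij : i ≠ j := by
    rintro rfl
    exact (hj xi hxi).1 (hi hxi)
  -- Fourteen disjoint connectors from `B i` to `B j`, one for each index other than `j`: the direct
  -- one, stored at index `i`, and one through each further branch set. Each must meet `Z`.
  let C : Fin 15 → Set α := fun k => if k = i then P i j else P i k ∪ B k ∪ P k j
  have hC : ∀ k, k ≠ j → ∃ z ∈ C k, z ∈ Z := by
    intro k hkj
    by_cases hki : k = i
    · obtain ⟨u, hu, huX, w, hw, hwX, huw⟩ := M.join_conn i j hij X xi (by simp [hxi]) (hi hxi) xj
        (by simp [hxj]) (hj xj hxj).1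
      have hwZ := (hX u huX w huw).resolve_left hwX
      refine ⟨w, ?_, hwZ⟩
      rcases hw with (hw | hw) | hw
      · exact absurd (hi hw) hwX
      · simpa [C, hki] using hw
      · exact absurd hwZ (hj w hw).2
    · obtain ⟨xk, hxk⟩ := M.nonempty k
      obtain ⟨u, hu, huX, w, hw, hwX, huw⟩ :=
        ((M.join_conn i k (Ne.symm hki)).union (M.join_conn k j hkj)
          ⟨xk, by simp [hxk]⟩) X xi (by simp [hxi]) (hi hxi) xj (by simp [hxj]) (hj xj hxj).1
      have hwZ := (hX u huX w huw).resolve_left hwX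
      refine ⟨w, ?_, hwZ⟩
      simp only [C, hki, if_false]
      rcases hw with ((hw | hw) | hw) | ((hw | hw) | hw)
      · exact absurd (hi hw) hwX
      · exact Or.inl (Or.inl hw)
      · exact Or.inl (Or.inr hw)
      · exact Or.inl (Or.inr hw)
      · exact Or.inr hw
      · exact absurd hwZ (hj w hw).2
  have hdisj : ∀ k l, k ≠ j → l ≠ j → k ≠ l → Disjoint (C k) (C l) := by
    have hsym : ∀ k l, k ≠ j → l ≠ j → k ≠ l → l ≠ i → Disjoint (C k) (C l) := by
      intro k l hk hl hkl hli
      by_cases hki : k = i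
      · subst hki
        simp only [C, if_true, hli, if_false, Set.disjoint_union_right]
        refine ⟨⟨M.join_join _ _ _ _ hij hkl ?_, (M.branch_join _ _ _ hij hli hl).symm⟩,
          M.join_join _ _ _ _ hij hl ?_⟩
        · simp; tauto
        · simp; tauto
      · simp only [C, hki, hli, if_false, Set.disjoint_union_right, Set.disjoint_union_left]
        have hik := Ne.symm hki
        have hil := Ne.symm hli
        refine ⟨⟨⟨⟨M.join_join _ _ _ _ hik hil ?_, M.branch_join _ _ _ hil hki hkl⟩,
          M.join_join _ _ _ _ hk hil ?_⟩,
          ⟨(M.branch_join _ _ _ hik hli hkl.symm).symm, M.branch_branch _ _ hkl⟩,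
          (M.branch_join _ _ _ hk hkl.symm hl).symm⟩,
          ⟨M.join_join _ _ _ _ hik hl ?_, M.branch_join _ _ _ hl hkl hk⟩,
          M.join_join _ _ _ _ hk hl ?_⟩ <;> simp <;> tauto
    intro k l hk hl hkl
    by_cases hli : l = i
    · exact (hsym l k hl hk hkl.symm (fun h => hkl (h.trans hli.symm))).symm
    · exact hsym k l hk hl hkl hli
  have : ∀ k : Fin 15, ∃ z, k ≠ j → z ∈ C k ∧ z ∈ Z := by
    intro k
    by_cases hk : k = j
    · exact ⟨xi, fun h => absurd hk h⟩
    · obtain ⟨z, h⟩ := hC k hk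
      exact ⟨z, fun _ => h⟩
  choose f hf using this
  have hcard := Finset.card_le_card_of_injOn (s := Finset.univ.erase j) (t := Z) f
    (fun k hk => (hf k (Finset.ne_of_mem_erase hk)).2) (by
      intro k hk l hl hkl
      by_contra hne
      have hk' := Finset.ne_of_mem_erase hk
      have hl' := Finset.ne_of_mem_erase hl
      exact Set.disjoint_left.1 (hdisj k l hk' hl' hne) (hf k hk').1 (hkl ▸ (hf l hl').1))
  simp at hcard
  omega

/-- If a region `X` cut off by few vertices falls apart into small regions when few vertices are
removed, then it is small. -/
theorem IsCliqueModel.small_of_cut (M : IsCliqueModel r B P) {X X₁ X₂ : Set α} (Z₀ Z : Finset α)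
    (hZ₀ : Z₀ ⊆ Z) (hZ : Z.card ≤ 13) (hX : ∀ u ∈ X, ∀ w, r u w → w ∈ X ∨ w ∈ Z₀)
    (hcov : ∀ u ∈ X, u ∈ Z ∨ u ∈ X₁ ∨ u ∈ X₂) (h₁₂ : ∀ u ∈ X₁, ∀ w ∈ X₂, ¬ r u w)
    (h₁ : Small B X₁) (h₂ : Small B X₂) : Small B X := by
  intro i hi
  obtain ⟨j, hj⟩ := M.exists_avoid Z (by omega)
  have hjX : B j ⊆ X := by
    rcases (M.branch_conn j).subset_or_disjoint (X := X) (fun u _ huX w hw huw =>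
      (hX u huX w huw).resolve_right (fun h => hj w hw (hZ₀ h))) with h | h
    · exact h
    · exact (M.not_separated Z₀ ((Finset.card_le_card hZ₀).trans hZ) hX hi
        (fun z hz => ⟨h z hz, fun hh => hj z hz (hZ₀ hh)⟩)).elim
  have hjc : ∀ u ∈ B j, u ∈ X₁ ∨ u ∈ X₂ := fun u hu => (hcov u (hjX hu)).resolve_left (hj u hu)
  rcases (M.branch_conn j).subset_or_disjoint (X := X₁) (fun u _ hu1 w hw huw =>
      (hjc w hw).resolve_right (fun h => h₁₂ u hu1 w h huw)) with h | h
  · exact h₁ j h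
  · exact h₂ j (fun u hu => (hjc u hu).resolve_left (h u hu))

theorem IsCliqueModel.small_empty (M : IsCliqueModel r B P) : Small B ∅ := by
  intro i hi
  obtain ⟨x, hx⟩ := M.nonempty i
  exact hi hx

end CliqueModel

/-! ### From clique models in the subdivision to clique models on nodes -/

section Project

variable {N E : Type*} {T : SimpleGraph N} {src tgt : E → N} {L : ℕ}
  {B : Fin 15 → Set (N ⊕ E × Fin L)} {P : Fin 15 → Fin 15 → Set (N ⊕ E × Fin L)}

/-- An initial segment of a path is cut off by two vertices, and deleting its last vertex leaves a
shorter one. With `m = L` this shows that no branch set is hidden inside a long edge, so every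
branch set contains a node. -/
theorem IsCliqueModel.small_initial (M : IsCliqueModel (addPaths T src tgt L).Adj B P) (e : E) (m : ℕ)
    (hm : m ≤ L) : Small B {z | ∃ i : Fin L, z = .inr (e, i) ∧ (i : ℕ) < m} := by
  classical
  induction m with
  | zero => simpa using M.small_empty
  | succ m ih =>
    -- The vertex that follows the segment on the path, which is the target when the segment is the
    -- whole interior.
    let z' : N ⊕ E × Fin L := if h : m + 1 < L then .inr (e, ⟨m + 1, h⟩) else .inl (tgt e)
    refine M.small_of_cut (X₁ := {z | ∃ i : Fin L, z = .inr (e, i) ∧ (i : ℕ) < m}) (X₂ := ∅)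
      {.inl (src e), z'} {.inl (src e), z', .inr (e, ⟨m, by omega⟩)} ?_ ?_ ?_ ?_ ?_
      (ih (by omega)) M.small_empty
    · intro z; simp; tauto
    · exact (Finset.card_le_three).trans (by norm_num)
    · rintro _ ⟨i, rfl, hi⟩ (w | ⟨f, j⟩) h
      · right
        rcases h with ⟨rfl, -⟩ | ⟨rfl, h⟩
        · simp
        · have : ¬ (m + 1 < L) := by omega
          simp [z', this]
      · obtain ⟨rfl, h⟩ := h
        by_cases hj : (j : ℕ) < m + 1
        · exact Or.inl ⟨j, rfl, hj⟩
        · right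
          have hj' : (j : ℕ) = m + 1 := by omega
          have : m + 1 < L := by omega
          simp [z', this, Fin.ext_iff, hj']
    · rintro _ ⟨i, rfl, hi⟩
      rcases Nat.lt_or_ge (i : ℕ) m with h | h
      · exact Or.inr (Or.inl ⟨i, rfl, h⟩)
      · left
        have : (i : ℕ) = m := by omega
        simp [Fin.ext_iff, this]
    · rintro u - w ⟨⟩

/-- A clique model in `addPaths` gives a clique model on the nodes. -/
theorem IsCliqueModel.nodes (M : IsCliqueModel (addPaths T src tgt L).Adj B P) :
    IsCliqueModel (BaseAdj T src tgt) (fun i => Sum.inl ⁻¹' B i) (fun i j => Sum.inl ⁻¹' P i j) where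
  nonempty i := by
    by_contra hn
    have hno : ∀ u, Sum.inl u ∉ B i := fun u hu => hn ⟨u, hu⟩
    obtain ⟨x | ⟨e, k⟩, hx⟩ := M.nonempty i
    · exact hno x hx
    · refine M.small_initial e L le_rfl i ?_
      have hcl : ∀ u ∈ B i, u ∈ {z | ∃ i : Fin L, z = .inr (e, i) ∧ (i : ℕ) < L} → ∀ w ∈ B i,
          (addPaths T src tgt L).Adj u w → w ∈ {z | ∃ i : Fin L, z = .inr (e, i) ∧ (i : ℕ) < L} := by
        rintro _ _ ⟨l, rfl, -⟩ (w | ⟨f, j⟩) hw h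
        · exact absurd hw (hno w)
        · obtain ⟨rfl, -⟩ := h
          exact ⟨j, rfl, j.2⟩
      rcases (M.branch_conn i).subset_or_disjoint hcl with h | h
      · exact h
      · exact absurd ⟨k, rfl, k.2⟩ (h _ hx)
  branch_conn i := (M.branch_conn i).nodes
  join_conn i j hij := (M.join_conn i j hij).nodes
  branch_branch i j hij := (M.branch_branch i j hij).preimage _
  branch_join i j k h1 h2 h3 := (M.branch_join i j k h1 h2 h3).preimage _
  join_join i j k l h1 h2 h3 := (M.join_join i j k l h1 h2 h3).preimage _

end Project

end FatMinor
-- The construction and its subtrees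
namespace FatMinor

/-- The nodes of the construction: the nodes `t k` of a binary tree of depth `n` (where `t 1` is the
root, `t 0` an additional node above it, and `t (k / 2)` the parent of `t k`), a row of nodes `y i`,
and for both cliques `s` the vertices `a s i` and the nodes `m s i j` on their edges. -/
inductive Node (n : ℕ)
  | t (k : Fin (2 ^ (n + 1)))
  | y (i : Fin (2 ^ n))
  | a (s : Bool) (i : Fin 15)
  | m (s : Bool) (i j : Fin 15)

/-- The long edges of the construction. -/
inductive LongEdge (n : ℕ)
  | yy (i : Fin (2 ^ n - 1))
  | xy (i : Fin (2 ^ n - 1))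
  | yx (i : Fin (2 ^ n - 1))
  | star (s : Bool) (i j : Fin 15)
  | mid (s : Bool) (i j : Fin 15)
  | link (s : Bool) (c : Fin 3)

variable {n : ℕ}

/-- The leaf of the tree in column `i`. -/
def Node.x (i : Fin (2 ^ n)) : Node n := .t ⟨2 ^ n + i, by rw [pow_succ]; omega⟩

/-- The columns `i` and `i + 1`. -/
def colL (i : Fin (2 ^ n - 1)) : Fin (2 ^ n) := ⟨i, by omega⟩

/-- The columns `i` and `i + 1`. -/
def colR (i : Fin (2 ^ n - 1)) : Fin (2 ^ n) := ⟨i + 1, by omega⟩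

/-- The column where clique `s` is attached. -/
def endCol (s : Bool) : Fin (2 ^ n) :=
  if s then ⟨2 ^ n - 1, Nat.sub_lt (by positivity) one_pos⟩ else ⟨0, by positivity⟩

/-- The node to which vertex `c` of clique `s` is attached. -/
def terminal (s : Bool) (c : Fin 3) : Node n :=
  if c = 0 then .x (endCol s) else if c = 1 then .y (endCol s) else .t ⟨0, by positivity⟩

def LongEdge.src : LongEdge n → Node n
  | .yy i => .y (colL i)
  | .xy i => .x (colL i)
  | .yx i => .y (colL i)
  | .star s i _ => .a s i
  | .mid s i j => .m s i j
  | .link s c => .a s (Fin.castLE (by norm_num) c)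

def LongEdge.tgt : LongEdge n → Node n
  | .yy i => .y (colR i)
  | .xy i => .y (colR i)
  | .yx i => .x (colR i)
  | .star s i j => .m s i j
  | .mid s i j => .m s j i
  | .link s c => terminal s c

/-- The binary tree. -/
def tree (n : ℕ) : SimpleGraph (Node n) where
  Adj
    | .t u, .t v => u ≠ v ∧ ((u : ℕ) = v / 2 ∨ (v : ℕ) = u / 2)
    | _, _ => False
  symm := ⟨by
    rintro (u | u | ⟨_, u⟩ | ⟨_, u, u'⟩) (v | v | ⟨_, v⟩ | ⟨_, v, v'⟩) h <;> try exact h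
    exact ⟨h.1.symm, h.2.symm⟩⟩
  loopless := ⟨by
    rintro (u | u | ⟨_, u⟩ | ⟨_, u, u'⟩) h <;> try exact h
    exact h.1 rfl⟩

/-- Adjacency of nodes by tree edges and long edges. -/
def adj (u v : Node n) : Prop := BaseAdj (tree n) LongEdge.src LongEdge.tgt u v

theorem adj_symm ⦃u v : Node n⦄ (h : adj u v) : adj v u := BaseAdj.symm h

/-- The graph of the main theorem. -/
def fatGraph (n L : ℕ) : SimpleGraph (Node n ⊕ LongEdge n × Fin L) :=
  addPaths (tree n) LongEdge.src LongEdge.tgt L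

/-- An upper bound for `adj`, listing the kinds of edges. -/
def adjSpec : Node n → Node n → Prop
  | .t u, .t v => (u : ℕ) = v / 2 ∨ (v : ℕ) = u / 2
  | .t k, .y i => 2 ^ n ≤ (k : ℕ) ∧ (2 ^ n + (i : ℕ) = k + 1 ∨ 2 ^ n + i + 1 = (k : ℕ))
  | .y i, .t k => 2 ^ n ≤ (k : ℕ) ∧ (2 ^ n + (i : ℕ) = k + 1 ∨ 2 ^ n + i + 1 = (k : ℕ))
  | .y i, .y j => (i : ℕ) + 1 = j ∨ (j : ℕ) + 1 = i
  | .a s i, .t k => ((i : ℕ) = 2 ∧ (k : ℕ) = 0) ∨ ((i : ℕ) = 0 ∧ s = false ∧ (k : ℕ) = 2 ^ n) ∨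
      ((i : ℕ) = 0 ∧ s = true ∧ (k : ℕ) + 1 = 2 ^ (n + 1))
  | .t k, .a s i => ((i : ℕ) = 2 ∧ (k : ℕ) = 0) ∨ ((i : ℕ) = 0 ∧ s = false ∧ (k : ℕ) = 2 ^ n) ∨
      ((i : ℕ) = 0 ∧ s = true ∧ (k : ℕ) + 1 = 2 ^ (n + 1))
  | .a s i, .y j => (i : ℕ) = 1 ∧ ((s = false ∧ (j : ℕ) = 0) ∨ (s = true ∧ (j : ℕ) + 1 = 2 ^ n))
  | .y j, .a s i => (i : ℕ) = 1 ∧ ((s = false ∧ (j : ℕ) = 0) ∨ (s = true ∧ (j : ℕ) + 1 = 2 ^ n))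
  | .a s i, .m s' i' _ => s = s' ∧ i = i'
  | .m s' i' _, .a s i => s = s' ∧ i = i'
  | .m s i j, .m s' i' j' => s = s' ∧ i = j' ∧ j = i'
  | _, _ => False

theorem adjSpec_symm (u v : Node n) (h : adjSpec u v) : adjSpec v u := by
  rcases u with u | u | ⟨_, u⟩ | ⟨_, u, u'⟩ <;> rcases v with v | v | ⟨_, v⟩ | ⟨_, v, v'⟩ <;>
    simp only [adjSpec] at h ⊢ <;> tauto

theorem adjSpec_longEdge (e : LongEdge n) : adjSpec e.src e.tgt := by
  rcases e with i | i | i | ⟨s, i, j⟩ | ⟨s, i, j⟩ | ⟨s, c⟩ <;>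
    simp only [LongEdge.src, LongEdge.tgt, adjSpec, Node.x, colL, colR, and_self]
  · left; trivial
  · omega
  · omega
  · have : 2 ^ (n + 1) = 2 * 2 ^ n := by ring
    have h0 : 0 < 2 ^ n := by positivity
    fin_cases c <;> cases s <;> simp [terminal, endCol, Node.x] <;> omega

theorem adjSpec_of_adj {u v : Node n} (h : adj u v) : adjSpec u v := by
  rcases h with h | ⟨e, ⟨rfl, rfl⟩ | ⟨rfl, rfl⟩⟩
  · rcases u with u | u | ⟨_, u⟩ | ⟨_, u, u'⟩ <;> rcases v with v | v | ⟨_, v⟩ | ⟨_, v, v'⟩ <;>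
      first | exact h.elim | exact h.2
  · exact adjSpec_longEdge e
  · exact adjSpec_symm _ _ (adjSpec_longEdge e)

/-- The two nodes in column `c - 2 ^ n`. -/
def Col (c : ℕ) : Set (Node n) := {u | match u with
  | .t j => (j : ℕ) = c
  | .y i => 2 ^ n + (i : ℕ) = c
  | _ => False}

/-- The nodes of the subtree of height `h` below `t k`, with the nodes `y` in its columns. -/
def W (h k : ℕ) : Set (Node n) := {u | match u with
  | .t j => ∃ d ≤ h, (j : ℕ) / 2 ^ d = k
  | .y i => (2 ^ n + (i : ℕ)) / 2 ^ h = k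
  | _ => False}

/-- `t k` is a node of height `h`. -/
def HasHeight (n h k : ℕ) : Prop := 2 ^ n ≤ k * 2 ^ h ∧ (k + 1) * 2 ^ h ≤ 2 ^ (n + 1)

theorem HasHeight.pos {h k : ℕ} (hk : HasHeight n h k) : 0 < k := by
  rcases Nat.eq_zero_or_pos k with rfl | h0
  · have := hk.1
    have h0 : 0 < 2 ^ n := by positivity
    omega
  · exact h0

theorem HasHeight.left {h k : ℕ} (hk : HasHeight n (h + 1) k) : HasHeight n h (2 * k) := by
  obtain ⟨h1, h2⟩ := hk
  rw [pow_succ] at h1 h2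
  constructor <;> nlinarith [Nat.zero_le (2 ^ h)]

theorem HasHeight.right {h k : ℕ} (hk : HasHeight n (h + 1) k) : HasHeight n h (2 * k + 1) := by
  obtain ⟨h1, h2⟩ := hk
  rw [pow_succ] at h1 h2
  constructor <;> nlinarith [Nat.zero_le (2 ^ h)]

theorem hasHeight_root : HasHeight n n 1 := by
  constructor
  · simp
  · rw [pow_succ]; omega

theorem div_pow_eq_iff {j d k : ℕ} : j / 2 ^ d = k ↔ k * 2 ^ d ≤ j ∧ j < (k + 1) * 2 ^ d := by
  rw [Nat.div_eq_iff (by positivity)]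
  have : 0 < 2 ^ d := by positivity
  rw [add_mul, one_mul]
  omega

/-- Leaves in `W h k`. -/
theorem mem_W_leaf {h k : ℕ} (hk : HasHeight n h k) {j : Fin (2 ^ (n + 1))} (hj : 2 ^ n ≤ (j : ℕ)) :
    Node.t j ∈ W h k ↔ k * 2 ^ h ≤ j ∧ (j : ℕ) < (k + 1) * 2 ^ h := by
  rw [← div_pow_eq_iff]
  constructor
  · rintro ⟨d, hd, hdk⟩
    rcases hd.lt_or_eq with hlt | rfl
    · exfalso
      obtain ⟨-, h2⟩ := div_pow_eq_iff.1 hdk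
      have h3 : 2 ^ (d + 1) ≤ 2 ^ h := Nat.pow_le_pow_right (by norm_num) hlt
      have h4 := hk.2
      rw [pow_succ] at h3 h4
      have h5 : (k + 1) * (2 ^ d * 2) ≤ (k + 1) * 2 ^ h := Nat.mul_le_mul_left _ h3
      rw [← mul_assoc] at h5
      omega
    · exact hdk
  · intro h1
    exact ⟨h, le_rfl, h1⟩

theorem mem_W_y {h k : ℕ} {i : Fin (2 ^ n)} :
    Node.y i ∈ W h k ↔ k * 2 ^ h ≤ 2 ^ n + i ∧ 2 ^ n + (i : ℕ) < (k + 1) * 2 ^ h := by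
  rw [← div_pow_eq_iff]; rfl

theorem W_parent {h k : ℕ} {j j' : Fin (2 ^ (n + 1))} (hj : Node.t j ∈ W h k) (hne : (j : ℕ) ≠ k)
    (hj' : (j' : ℕ) = j / 2) : Node.t j' ∈ W h k := by
  obtain ⟨d, hd, hdk⟩ := hj
  rcases d with _ | d
  · simp at hdk; omega
  · refine ⟨d, by omega, ?_⟩
    rw [hj', Nat.div_div_eq_div_mul, mul_comm, ← pow_succ]
    exact hdk

theorem W_child {h k : ℕ} (hk : HasHeight n h k) {j j' : Fin (2 ^ (n + 1))} (hj : Node.t j ∈ W h k)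
    (hj' : (j : ℕ) = j' / 2) : Node.t j' ∈ W h k := by
  obtain ⟨d, hd, hdk⟩ := hj
  rcases hd.lt_or_eq with hlt | rfl
  · refine ⟨d + 1, hlt, ?_⟩
    rw [show 2 ^ (d + 1) = 2 * 2 ^ d by ring, ← Nat.div_div_eq_div_mul, ← hj']
    exact hdk
  · exfalso
    have := (div_pow_eq_iff.1 hdk).1
    have := hk.1
    have := j'.2
    have hn2 : 2 ^ (n + 1) = 2 * 2 ^ n := by ring
    omega

/-- The edges that leave `W h k`. -/
theorem W_exit {h k : ℕ} (hk : HasHeight n h k) {u w : Node n} (hu : u ∈ W h k) (hw : w ∉ W h k)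
    (huw : adj u w) :
    ((∃ i j, u = .t i ∧ w = .t j ∧ (i : ℕ) = k ∧ (j : ℕ) = k / 2) ∨
      (u ∈ Col (k * 2 ^ h) ∧ ((∃ c, 2 ^ n ≤ c ∧ c + 1 = k * 2 ^ h ∧ w ∈ Col c) ∨ ∃ i, w = .a false i)) ∨
      (u ∈ Col ((k + 1) * 2 ^ h - 1) ∧ (w ∈ Col ((k + 1) * 2 ^ h) ∨ ∃ i, w = .a true i))) := by
  have hs := adjSpec_of_adj huw
  obtain ⟨hk1, hk2⟩ := id hk
  have hpos : 0 < 2 ^ n := by positivity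
  have hk0 := hk.pos
  have hn2 : 2 ^ (n + 1) = 2 * 2 ^ n := by ring
  rcases u with u | u | ⟨_, u⟩ | ⟨_, u, u'⟩ <;> rcases w with w | w | ⟨s, w⟩ | ⟨_, w, w'⟩ <;>
    first | exact hu.elim | exact hs.elim | skip
  · left
    refine ⟨u, w, rfl, rfl, ?_⟩
    by_cases huk : (u : ℕ) = k
    · refine ⟨huk, ?_⟩
      rcases hs with hs | hs
      · exact absurd (W_child hk hu hs) hw
      · omega
    · rcases hs with hs | hs
      · exact absurd (W_child hk hu hs) hw
      · exact absurd (W_parent hu huk hs) hw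
  · right
    simp only [adjSpec] at hs
    rw [mem_W_y] at hw
    rw [mem_W_leaf hk (by omega)] at hu
    rcases hs with ⟨hs0, hs | hs⟩
    · right
      exact ⟨by simp only [Col, Set.mem_ofPred_eq]; omega,
        Or.inl (by simp only [Col, Set.mem_ofPred_eq]; omega)⟩
    · left
      exact ⟨by simp only [Col, Set.mem_ofPred_eq]; omega,
        Or.inl ⟨2 ^ n + w, by omega, by omega, by simp only [Col, Set.mem_ofPred_eq]⟩⟩
  · right
    simp only [adjSpec] at hs
    rcases hs with ⟨-, hs⟩ | ⟨-, rfl, hs⟩ | ⟨-, rfl, hs⟩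
    · obtain ⟨d, -, hd⟩ := hu
      rw [hs] at hd
      simp at hd
      omega
    · rw [mem_W_leaf hk (by omega)] at hu
      left
      exact ⟨by simp only [Col, Set.mem_ofPred_eq]; omega, Or.inr ⟨w, rfl⟩⟩
    · rw [mem_W_leaf hk (by omega)] at hu
      right
      exact ⟨by simp only [Col, Set.mem_ofPred_eq]; omega, Or.inr ⟨w, rfl⟩⟩
  · right
    simp only [adjSpec] at hs
    rw [mem_W_y] at hu
    rw [mem_W_leaf hk (by omega)] at hw
    rcases hs with ⟨hs0, hs | hs⟩
    · left
      exact ⟨by simp only [Col, Set.mem_ofPred_eq]; omega,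
        Or.inl ⟨w, by omega, by omega, by simp only [Col, Set.mem_ofPred_eq]⟩⟩
    · right
      exact ⟨by simp only [Col, Set.mem_ofPred_eq]; omega,
        Or.inl (by simp only [Col, Set.mem_ofPred_eq]; omega)⟩
  · right
    simp only [adjSpec] at hs
    rw [mem_W_y] at hu hw
    rcases hs with hs | hs
    · right
      exact ⟨by simp only [Col, Set.mem_ofPred_eq]; omega,
        Or.inl (by simp only [Col, Set.mem_ofPred_eq]; omega)⟩
    · left
      exact ⟨by simp only [Col, Set.mem_ofPred_eq]; omega,
        Or.inl ⟨2 ^ n + w, by omega, by omega, by simp only [Col, Set.mem_ofPred_eq]⟩⟩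
  · right
    simp only [adjSpec] at hs
    rw [mem_W_y] at hu
    rcases hs with ⟨-, ⟨rfl, hs⟩ | ⟨rfl, hs⟩⟩
    · left
      exact ⟨by simp only [Col, Set.mem_ofPred_eq]; omega, Or.inr ⟨w, rfl⟩⟩
    · right
      exact ⟨by simp only [Col, Set.mem_ofPred_eq]; omega, Or.inr ⟨w, rfl⟩⟩

end FatMinor
-- Two far connected sets crossing a subtree
namespace FatMinor

variable {n : ℕ}

/-- `t k` lies in `R`. -/
def HasT (R : Set (Node n)) (k : ℕ) : Prop := ∃ j : Fin (2 ^ (n + 1)), (j : ℕ) = k ∧ Node.t j ∈ R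

/-- `R` and `B` are disjoint and have no two tree nodes at distance at most `2` in the tree. -/
def Far (R B : Set (Node n)) : Prop :=
  (∀ u ∈ R, u ∉ B) ∧ ∀ i j, HasT R i → HasT B j → i ≠ j / 2 ∧ j ≠ i / 2 ∧ i / 2 ≠ j / 2

theorem Far.symm {R B : Set (Node n)} (h : Far R B) : Far B R :=
  ⟨fun u hu hu' => h.1 u hu' hu, fun i j hi hj =>
    ⟨(h.2 j i hj hi).2.1, (h.2 j i hj hi).1, (h.2 j i hj hi).2.2.symm⟩⟩

theorem HasT.mono {R R' : Set (Node n)} {k : ℕ} (h : HasT R k) (hR : R ⊆ R') : HasT R' k := by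
  obtain ⟨j, h1, h2⟩ := h
  exact ⟨j, h1, hR h2⟩

theorem Far.mono {R B R' B' : Set (Node n)} (h : Far R B) (hR : R' ⊆ R) (hB : B' ⊆ B) :
    Far R' B' :=
  ⟨fun u hu hu' => h.1 u (hR hu) (hB hu'), fun i j hi hj => h.2 i j (hi.mono hR) (hj.mono hB)⟩

/-- `R` meets column `c`. -/
def Meets (R : Set (Node n)) (c : ℕ) : Prop := ∃ u ∈ R, u ∈ Col c

/-- Two far connected sets `R`, `B` in the part `V` of the graph with top node `t k`; `R` contains
the top node, both meet the outer column `o` of the part `U` of `V` below the child `t k'` of `t k`,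
and `B` leaves `U`. If the part `U` satisfies the two coloring lemmas, then `R` contains the leaf
in column `o`. -/
theorem outer_leaf_mem {U V R B : Set (Node n)} {k k' o i : ℕ}
    (hk : k' / 2 = k) (hkU : ¬ HasT U k) (hoU : Col o ⊆ U)
    (hexit : ∀ u ∈ U, ∀ w ∈ V, w ∉ U → adj u w →
      (∃ j j', u = .t j ∧ w = .t j' ∧ (j : ℕ) = k' ∧ (j' : ℕ) = k) ∨ u ∈ Col i)
    (hI : ∀ R B : Set (Node n), R ⊆ U → B ⊆ U → CutConnected adj R → CutConnected adj B → Far R B →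
      Meets R o → Meets B o → Meets R i → Meets B i →
      (HasT R k' ∧ HasT R o) ∨ (HasT B k' ∧ HasT B o))
    (hT : ∀ R B : Set (Node n), R ⊆ U → B ⊆ U → CutConnected adj R → CutConnected adj B → Far R B →
      HasT R k' → Meets R o → Meets B o → Meets B i → HasT R o)
    (hRV : R ⊆ V) (hBV : B ⊆ V) (hR : CutConnected adj R) (hB : CutConnected adj B)
    (hRB : Far R B) (hRk : HasT R k) (hRo : Meets R o) (hBo : Meets B o)
    (hBU : ¬ B ⊆ U) : HasT R o := by
  obtain ⟨ρ, hρR, hρ⟩ := hRo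
  obtain ⟨β, hβB, hβ⟩ := hBo
  have hC : compOf adj (R ∩ U) ρ ⊆ R ∩ U := compOf_subset ⟨hρR, hoU hρ⟩
  have hC' : compOf adj (B ∩ U) β ⊆ B ∩ U := compOf_subset ⟨hβB, hoU hβ⟩
  obtain ⟨j, hj, hjR⟩ := hRk
  have hBk : ¬ HasT B k := fun ⟨j', hj', hjB⟩ => hRB.1 (.t j') (by
    rwa [show j' = j from Fin.ext (hj'.trans hj.symm)]) hjB
  -- Inside `U`, the component of `R` at the outer column must leave `U`, as `t k` is outside. The
  -- component of `B` must leave too, but not through `t k`, which belongs to `R`; so it leaves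
  -- through the inner column.
  have exitR : HasT (compOf adj (R ∩ U) ρ) k' ∨ Meets (compOf adj (R ∩ U) ρ) i := by
    obtain ⟨u, hu, huC, w, hw, hwC, huw⟩ := hR (compOf adj (R ∩ U) ρ) ρ hρR (mem_compOf_self _ _)
      (.t j) hjR (fun h => hkU ⟨j, hj, (hC h).2⟩)
    have hwU : w ∉ U := fun h => hwC (compOf_closed huC huw ⟨hw, h⟩)
    rcases hexit u (hC huC).2 w (hRV hw) hwU huw with ⟨i, -, rfl, -, hi, -⟩ | h
    · exact Or.inl ⟨i, hi, huC⟩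
    · exact Or.inr ⟨u, huC, h⟩
  have exitB : Meets (compOf adj (B ∩ U) β) i := by
    obtain ⟨z, hzB, hzU⟩ := Set.not_subset.1 hBU
    obtain ⟨u, hu, huC, w, hw, hwC, huw⟩ := hB (compOf adj (B ∩ U) β) β hβB (mem_compOf_self _ _)
      z hzB (fun h => hzU (hC' h).2)
    have hwU : w ∉ U := fun h => hwC (compOf_closed huC huw ⟨hw, h⟩)
    rcases hexit u (hC' huC).2 w (hBV hw) hwU huw with ⟨-, i, -, rfl, -, hi⟩ | h
    · exact absurd ⟨i, hi, hw⟩ hBk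
    · exact ⟨u, huC, h⟩
  have hfar := hRB.mono (fun u hu => (hC hu).1) (fun u hu => (hC' hu).1)
  have hCR : compOf adj (R ∩ U) ρ ⊆ R := fun u hu => (hC hu).1
  have hCU : compOf adj (R ∩ U) ρ ⊆ U := fun u hu => (hC hu).2
  have hCU' : compOf adj (B ∩ U) β ⊆ U := fun u hu => (hC' hu).2
  have c1 := cutConnected_compOf adj_symm (R ∩ U) ρ
  have c2 := cutConnected_compOf adj_symm (B ∩ U) β
  have m1 : Meets (compOf adj (R ∩ U) ρ) o := ⟨ρ, mem_compOf_self _ _, hρ⟩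
  have m2 : Meets (compOf adj (B ∩ U) β) o := ⟨β, mem_compOf_self _ _, hβ⟩
  rcases exitR with h | h
  · exact (hT _ _ hCU hCU' c1 c2 hfar h m1 m2 exitB).mono hCR
  · rcases hI _ _ hCU hCU' c1 c2 hfar m1 m2 h exitB with h | h
    · exact h.2.mono hCR
    -- The case in which `B` contains the child `t k'`: its parent `t k` is in `R`, so the two sets
    -- would not be far.
    · have := hRB.2 k k' ⟨j, hj, hjR⟩ (h.1.mono (fun u hu => (hC' hu).1))
      omega

/-- As `p` is the only point through which `R` leaves `S`, every piece of `R ∩ S` has to reach `p`.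
-/
theorem CutConnected.inter_side {α : Type*} {r : α → α → Prop} (hr : ∀ ⦃a b⦄, r a b → r b a)
    {R S : Set α} (hR : CutConnected r R) {p : α} (hpR : p ∈ R)
    (hp : ∀ u ∈ R, u ∈ S → ∀ w ∈ R, w ∉ S → r u w → u = p) : CutConnected r (R ∩ S) := by
  refine cutConnected_of_center hr p ?_
  rintro X hpX w ⟨hwR, hwS⟩ hwX
  obtain ⟨u, hu, ⟨huX, huS⟩, w', hw', hwX', h⟩ := hR (X ∩ S) w hwR ⟨hwX, hwS⟩ p hpR
    (fun h => hpX h.1)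
  by_cases hwS' : w' ∈ S
  · exact ⟨u, ⟨hu, huS⟩, huX, w', ⟨hw', hwS'⟩, fun h => hwX' ⟨h, hwS'⟩, h⟩
  · exact absurd huX (hp u hu huS w' hw' hwS' h ▸ hpX)

theorem Col_subset_W {h k c : ℕ} (hk : HasHeight n h k) (h1 : k * 2 ^ h ≤ c)
    (h2 : c < (k + 1) * 2 ^ h) : (Col c : Set (Node n)) ⊆ W h k := by
  have := hk.1
  rintro (u | u | ⟨_, u⟩ | ⟨_, u, u'⟩) hu
  · have hu' : (u : ℕ) = c := hu
    rw [mem_W_leaf hk (by omega)]; omega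
  · have hu' : 2 ^ n + (u : ℕ) = c := hu
    rw [mem_W_y]; omega
  · exact hu.elim
  · exact hu.elim

theorem Col_disjoint_W {h k c : ℕ} (hk : HasHeight n h k) (hc : 2 ^ n ≤ c)
    (h1 : c < k * 2 ^ h ∨ (k + 1) * 2 ^ h ≤ c) {u : Node n} (hu : u ∈ Col c) : u ∉ W h k := by
  rcases u with u | u | ⟨_, u⟩ | ⟨_, u, u'⟩
  · have hu' : (u : ℕ) = c := hu
    rw [mem_W_leaf hk (by omega)]; omega
  · have hu' : 2 ^ n + (u : ℕ) = c := hu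
    rw [mem_W_y]; omega
  · exact hu.elim
  · exact hu.elim

theorem W_succ {h k : ℕ} {u : Node n} (hu : u ∈ W (h + 1) k) :
    (∃ j : Fin (2 ^ (n + 1)), (j : ℕ) = k ∧ u = .t j) ∨ u ∈ W h (2 * k) ∨ u ∈ W h (2 * k + 1) := by
  rcases u with u | u | ⟨_, u⟩ | ⟨_, u, u'⟩
  · obtain ⟨d, hd, hdk⟩ := hu
    rcases d with _ | d
    · exact Or.inl ⟨u, by simpa using hdk, rfl⟩
    · right
      rw [pow_succ 2 d, ← Nat.div_div_eq_div_mul] at hdk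
      rcases Nat.mod_two_eq_zero_or_one ((u : ℕ) / 2 ^ d) with h0 | h0
      · exact Or.inl ⟨d, by omega, by omega⟩
      · exact Or.inr ⟨d, by omega, by omega⟩
  · right
    have hu' : (2 ^ n + (u : ℕ)) / 2 ^ (h + 1) = k := hu
    rw [pow_succ, ← Nat.div_div_eq_div_mul] at hu'
    rcases Nat.mod_two_eq_zero_or_one ((2 ^ n + (u : ℕ)) / 2 ^ h) with h0 | h0
    · exact Or.inl (show (2 ^ n + (u : ℕ)) / 2 ^ h = 2 * k by omega)
    · exact Or.inr (show (2 ^ n + (u : ℕ)) / 2 ^ h = 2 * k + 1 by omega)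
  · exact hu.elim
  · exact hu.elim

theorem not_hasT_W {h k k' : ℕ} (hk : k < k') : ¬ HasT (W h k' : Set (Node n)) k := by
  rintro ⟨j, hj, d, hd, hdk⟩
  have := Nat.div_le_self (j : ℕ) (2 ^ d)
  omega

theorem W_exit_left {h k : ℕ} (hk : HasHeight n (h + 1) k) {u w : Node n} (hu : u ∈ W h (2 * k))
    (hw : w ∈ W (h + 1) k) (hw' : w ∉ W h (2 * k)) (huw : adj u w) :
    (∃ j j', u = .t j ∧ w = .t j' ∧ (j : ℕ) = 2 * k ∧ (j' : ℕ) = k) ∨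
      u ∈ Col ((2 * k + 1) * 2 ^ h - 1) := by
  rcases W_exit hk.left hu hw' huw with ⟨i, j, h1, h2, h3, h4⟩ | ⟨-, ⟨c, hc, hc', hw2⟩ | ⟨i, rfl⟩⟩ |
    ⟨h1, -⟩
  · exact Or.inl ⟨i, j, h1, h2, h3, by omega⟩
  · refine absurd hw (Col_disjoint_W hk hc (Or.inl ?_) hw2)
    rw [pow_succ, ← mul_assoc, mul_right_comm, mul_comm k 2]; omega
  · exact hw.elim
  · exact Or.inr h1

theorem W_exit_right {h k : ℕ} (hk : HasHeight n (h + 1) k) {u w : Node n}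
    (hu : u ∈ W h (2 * k + 1)) (hw : w ∈ W (h + 1) k) (hw' : w ∉ W h (2 * k + 1)) (huw : adj u w) :
    (∃ j j', u = .t j ∧ w = .t j' ∧ (j : ℕ) = 2 * k + 1 ∧ (j' : ℕ) = k) ∨
      u ∈ Col ((2 * k + 1) * 2 ^ h) := by
  rcases W_exit hk.right hu hw' huw with ⟨i, j, h1, h2, h3, h4⟩ | ⟨h1, -⟩ | ⟨-, h2 | ⟨i, rfl⟩⟩
  · exact Or.inl ⟨i, j, h1, h2, h3, by omega⟩
  · exact Or.inr h1
  · have e : (2 * k + 1 + 1) * 2 ^ h = (k + 1) * 2 ^ (h + 1) := by ring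
    rw [e] at h2
    refine absurd hw (Col_disjoint_W hk ?_ (Or.inr le_rfl) h2)
    have := hk.1
    rw [add_mul]
    omega
  · exact hw.elim

/-- A tree path between sibling subtrees passes through their parent, so a direct step can only use
a long edge between the two middle columns. -/
theorem W_gap {h k : ℕ} (hk : HasHeight n (h + 1) k) {u w : Node n} (hu : u ∈ W h (2 * k))
    (hw : w ∈ W h (2 * k + 1)) (hw' : w ∉ W h (2 * k)) (huw : adj u w) :
    u ∈ Col ((2 * k + 1) * 2 ^ h - 1) ∧ w ∈ Col ((2 * k + 1) * 2 ^ h) := by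
  rcases W_exit hk.left hu hw' huw with ⟨i, j, h1, rfl, h3, h4⟩ | ⟨-, ⟨c, hc, hc', hw2⟩ | ⟨i, rfl⟩⟩ |
    ⟨h1, h2 | ⟨i, rfl⟩⟩
  · exact absurd ⟨j, rfl, hw⟩ (not_hasT_W (by have := hk.pos; omega))
  · refine absurd hw (Col_disjoint_W hk.right hc (Or.inl ?_) hw2)
    rw [add_mul]; omega
  · exact hw.elim
  · exact ⟨h1, h2⟩
  · exact hw.elim

theorem Col_pair {c : ℕ} {u v z : Node n} (hu : u ∈ Col c) (hv : v ∈ Col c) (huv : u ≠ v)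
    (hz : z ∈ Col c) : z = u ∨ z = v := by
  rcases u with u | u | ⟨_, u⟩ | ⟨_, u, u'⟩ <;> rcases v with v | v | ⟨_, v⟩ | ⟨_, v, v'⟩ <;>
    rcases z with z | z | ⟨_, z⟩ | ⟨_, z, z'⟩ <;>
    first | exact hu.elim | exact hv.elim | exact hz.elim | skip
  all_goals
    simp only [Col, Set.mem_ofPred_eq] at hu hv hz
    simp only [ne_eq, Node.t.injEq, Node.y.injEq, reduceCtorEq, Fin.ext_iff, not_false_eq_true,
      false_or, or_false] at huv ⊢
    omega

theorem hasT_or_of_pair {R B : Set (Node n)} {c : ℕ} {u v : Node n} (hu : u ∈ Col c) (hv : v ∈ Col c)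
    (huv : u ≠ v) (huR : u ∈ R) (hvB : v ∈ B) :
    ((∃ j, u = .t j ∧ (j : ℕ) = c) ∧ ∃ i, v = .y i) ∨ ((∃ i, u = .y i) ∧ ∃ j, v = .t j ∧ (j : ℕ) = c) := by
  rcases u with u | u | ⟨_, u⟩ | ⟨_, u, u'⟩ <;> rcases v with v | v | ⟨_, v⟩ | ⟨_, v, v'⟩ <;>
    first | exact hu.elim | exact hv.elim | skip
  · have h1 : (u : ℕ) = c := hu
    have h2 : (v : ℕ) = c := hv
    exact absurd (congrArg Node.t (Fin.ext (h1.trans h2.symm))) huv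
  · exact Or.inl ⟨⟨u, rfl, hu⟩, v, rfl⟩
  · exact Or.inr ⟨⟨u, rfl⟩, v, rfl, hv⟩
  · have h1 : 2 ^ n + (u : ℕ) = c := hu
    have h2 : 2 ^ n + (v : ℕ) = c := hv
    exact absurd (congrArg Node.y (Fin.ext (by omega))) huv

/-- Two far connected sets `R` and `B` in `W h k` that both meet the first and the last column:
one of them contains the top node and the leaves in the first and the last column. The second and
third part concern the case where `R` contains the top node but is only required to meet the first
(or the last) column. -/
theorem coloring {h : ℕ} : ∀ {k : ℕ}, HasHeight n h k → ∀ a b, a = k * 2 ^ h →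
    b + 1 = (k + 1) * 2 ^ h → ∀ R B : Set (Node n), R ⊆ W h k → B ⊆ W h k →
    CutConnected adj R → CutConnected adj B → Far R B →
    (Meets R a → Meets B a → Meets R b → Meets B b →
      (HasT R k ∧ HasT R a ∧ HasT R b) ∨ (HasT B k ∧ HasT B a ∧ HasT B b)) ∧
    (HasT R k → Meets R a → Meets B a → Meets B b → HasT R a) ∧
    (HasT R k → Meets R b → Meets B a → Meets B b → HasT R b) := by
  induction h with
  | zero =>
    intro k hk a b ha hb R B hR hB hRc hBc hfar
    have ha' : a = k := by simpa using ha
    have hb' : b = k := by simp at hb; omega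
    subst ha' hb'
    refine ⟨?_, fun h _ _ _ => h, fun h _ _ _ => h⟩
    rintro ⟨u, huR, hu⟩ ⟨v, hvB, hv⟩ - -
    have huv : u ≠ v := fun h => hfar.1 u huR (h ▸ hvB)
    rcases hasT_or_of_pair hu hv huv huR hvB with ⟨⟨j, rfl, hj⟩, -⟩ | ⟨-, j, rfl, hj⟩
    · exact Or.inl ⟨⟨j, hj, huR⟩, ⟨j, hj, huR⟩, ⟨j, hj, huR⟩⟩
    · exact Or.inr ⟨⟨j, hj, hvB⟩, ⟨j, hj, hvB⟩, ⟨j, hj, hvB⟩⟩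
  | succ h ih =>
    intro k hk a b ha hb
    have hpos : 0 < 2 ^ h := by positivity
    have hk0 := hk.pos
    -- The middle columns are `c`, the last one of the left half, and `c + 1`, the first one of the
    -- right half.
    obtain ⟨c, hc⟩ : ∃ c, c + 1 = (2 * k + 1) * 2 ^ h := by
      refine ⟨(2 * k + 1) * 2 ^ h - 1, Nat.sub_add_cancel (Nat.mul_pos (by omega) hpos)⟩
    have hc' : (2 * k + 1) * 2 ^ h - 1 = c := by omega
    have ha2 : a = 2 * k * 2 ^ h := by rw [ha]; ring
    have hb2 : b + 1 = (2 * k + 1 + 1) * 2 ^ h := by rw [hb]; ring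
    have hl := hk.left.1
    have e1 : (2 * k + 1) * 2 ^ h = 2 * k * 2 ^ h + 2 ^ h := by ring
    have e2 : (2 * k + 1 + 1) * 2 ^ h = 2 * k * 2 ^ h + 2 ^ h + 2 ^ h := by ring
    have ihL := ih hk.left a c ha2 hc
    have ihR := ih hk.right (c + 1) b hc hb2
    have colbL : ∀ u ∈ (Col b : Set (Node n)), u ∉ W h (2 * k) := fun u hu =>
      Col_disjoint_W hk.left (by omega) (Or.inr (by omega)) hu
    have colaR : ∀ u ∈ (Col a : Set (Node n)), u ∉ W h (2 * k + 1) := fun u hu =>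
      Col_disjoint_W hk.right (by omega) (Or.inl (by omega)) hu
    have TL : ∀ R B : Set (Node n), R ⊆ W (h + 1) k → B ⊆ W (h + 1) k →
        CutConnected adj R → CutConnected adj B → Far R B →
        HasT R k → Meets R a → Meets B a → Meets B b → HasT R a := by
      intro R B hR hB hRc hBc hfar hRk hRa hBa ⟨z, hzB, hz⟩
      refine outer_leaf_mem (U := W h (2 * k)) (V := W (h + 1) k) (k' := 2 * k) (i := c)
        (by omega) (not_hasT_W (by omega)) (Col_subset_W hk.left (by omega) (by omega))
        (fun u hu w hw hw' huw => hc' ▸ W_exit_left hk hu hw hw' huw) ?_ ?_ hR hB hRc hBc hfar hRk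
        hRa hBa (fun hsub => colbL z hz (hsub hzB))
      · intro R B h1 h2 h3 h4 h5 h6 h7 h8 h9
        rcases (ihL R B h1 h2 h3 h4 h5).1 h6 h7 h8 h9 with h | h
        exacts [Or.inl ⟨h.1, h.2.1⟩, Or.inr ⟨h.1, h.2.1⟩]
      · intro R B h1 h2 h3 h4 h5
        exact (ihL R B h1 h2 h3 h4 h5).2.1
    have TR : ∀ R B : Set (Node n), R ⊆ W (h + 1) k → B ⊆ W (h + 1) k →
        CutConnected adj R → CutConnected adj B → Far R B →
        HasT R k → Meets R b → Meets B a → Meets B b → HasT R b := by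
      intro R B hR hB hRc hBc hfar hRk hRb ⟨z, hzB, hz⟩ hBb
      refine outer_leaf_mem (U := W h (2 * k + 1)) (V := W (h + 1) k) (k' := 2 * k + 1) (i := c + 1)
        (by omega) (not_hasT_W (by omega)) (Col_subset_W hk.right (by omega) (by omega))
        (fun u hu w hw hw' huw => hc ▸ W_exit_right hk hu hw hw' huw) ?_ ?_ hR hB hRc hBc hfar hRk
        hRb hBb (fun hsub => colaR z hz (hsub hzB))
      · intro R B h1 h2 h3 h4 h5 h6 h7 h8 h9
        rcases (ihR R B h1 h2 h3 h4 h5).1 h8 h9 h6 h7 with h | h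
        exacts [Or.inl ⟨h.1, h.2.2⟩, Or.inr ⟨h.1, h.2.2⟩]
      · intro R B h1 h2 h3 h4 h5 h6 h7 h8 h9
        exact (ihR R B h1 h2 h3 h4 h5).2.2 h6 h7 h9 h8
    intro R B hR hB hRc hBc hfar
    refine ⟨fun hRa hBa hRb hBb => ?_, TL R B hR hB hRc hBc hfar, TR R B hR hB hRc hBc hfar⟩
    by_cases hRk : HasT R k
    · exact Or.inl ⟨hRk, TL R B hR hB hRc hBc hfar hRk hRa hBa hBb,
        TR R B hR hB hRc hBc hfar hRk hRb hBa hBb⟩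
    by_cases hBk : HasT B k
    · exact Or.inr ⟨hBk, TL B R hB hR hBc hRc hfar.symm hBk hBa hRa hRb,
        TR B R hB hR hBc hRc hfar.symm hBk hBb hRa hRb⟩
    -- Neither set contains the top node, so both have to cross from column `c` to column `c + 1`.
    exfalso
    have cross : ∀ R : Set (Node n), R ⊆ W (h + 1) k → CutConnected adj R → ¬ HasT R k →
        Meets R a → Meets R b → ∃ u ∈ R, u ∈ Col c ∧ ∃ w ∈ R, w ∈ Col (c + 1) ∧ adj u w := by
      rintro R hR hRc hRk ⟨z, hzR, hz⟩ ⟨z', hzR', hz'⟩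
      obtain ⟨u, hu, huL, w, hw, hwL, huw⟩ := hRc (W h (2 * k)) z hzR
        (Col_subset_W hk.left (by omega) (by omega) hz) z' hzR' (colbL z' hz')
      have hwR : w ∈ W h (2 * k + 1) := by
        rcases W_succ (hR hw) with ⟨j, hj, rfl⟩ | h1 | h1
        · exact absurd ⟨j, hj, hw⟩ hRk
        · exact absurd h1 hwL
        · exact h1
      obtain ⟨h1, h2⟩ := W_gap hk huL hwR hwL huw
      rw [hc'] at h1
      rw [← hc] at h2
      exact ⟨u, hu, h1, w, hw, h2, huw⟩
    obtain ⟨u, huR, hu, w, hwR, hw, huw⟩ := cross R hR hRc hRk hRa hRb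
    obtain ⟨u', huB, hu', w', hwB, hw', huw'⟩ := cross B hB hBc hBk hBa hBb
    have hne : u ≠ u' := fun e => hfar.1 u huR (e ▸ huB)
    have hne' : w ≠ w' := fun e => hfar.1 w hwR (e ▸ hwB)
    -- Column `c` has two nodes and one of them belongs to the other set, so a set without the top
    -- node can leave the left half at a single node. Its trace on the left half is therefore
    -- connected and the induction hypothesis applies.
    have sideL : ∀ R B : Set (Node n), R ⊆ W (h + 1) k → CutConnected adj R → ¬ HasT R k → Far R B →
        ∀ u u', u ∈ R → u ∈ Col c → u' ∈ B → u' ∈ Col c → CutConnected adj (R ∩ W h (2 * k)) := by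
      intro R B hR hRc hRk hfar u u' huR hu huB hu'
      refine hRc.inter_side adj_symm huR ?_
      intro p hp hpL q hq hqL hpq
      rcases W_exit_left hk hpL (hR hq) hqL hpq with ⟨-, j, -, rfl, -, hj⟩ | h1
      · exact absurd ⟨j, hj, hq⟩ hRk
      · rw [hc'] at h1
        rcases Col_pair hu hu' (fun e => hfar.1 u huR (e ▸ huB)) h1 with h1 | h1
        · exact h1
        · exact absurd huB (h1 ▸ hfar.1 p hp)
    have sideR : ∀ R B : Set (Node n), R ⊆ W (h + 1) k → CutConnected adj R → ¬ HasT R k → Far R B →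
        ∀ u u', u ∈ R → u ∈ Col (c + 1) → u' ∈ B → u' ∈ Col (c + 1) →
        CutConnected adj (R ∩ W h (2 * k + 1)) := by
      intro R B hR hRc hRk hfar u u' huR hu huB hu'
      refine hRc.inter_side adj_symm huR ?_
      intro p hp hpL q hq hqL hpq
      rcases W_exit_right hk hpL (hR hq) hqL hpq with ⟨-, j, -, rfl, -, hj⟩ | h1
      · exact absurd ⟨j, hj, hq⟩ hRk
      · rw [← hc] at h1
        rcases Col_pair hu hu' (fun e => hfar.1 u huR (e ▸ huB)) h1 with h1 | h1
        · exact h1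
        · exact absurd huB (h1 ▸ hfar.1 p hp)
    have meetL : ∀ (S : Set (Node n)) d, a ≤ d → d ≤ c → Meets S d → Meets (S ∩ W h (2 * k)) d := by
      rintro S d h1 h2 ⟨z, hz, hzd⟩
      exact ⟨z, ⟨hz, Col_subset_W hk.left (by omega) (by omega) hzd⟩, hzd⟩
    have meetR : ∀ (S : Set (Node n)) d, c + 1 ≤ d → d ≤ b → Meets S d →
        Meets (S ∩ W h (2 * k + 1)) d := by
      rintro S d h1 h2 ⟨z, hz, hzd⟩
      exact ⟨z, ⟨hz, Col_subset_W hk.right (by omega) (by omega) hzd⟩, hzd⟩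
    have IL := (ihL (R ∩ W h (2 * k)) (B ∩ W h (2 * k)) Set.inter_subset_right
      Set.inter_subset_right (sideL R B hR hRc hRk hfar u u' huR hu huB hu')
      (sideL B R hB hBc hBk hfar.symm u' u huB hu' huR hu)
      (hfar.mono Set.inter_subset_left Set.inter_subset_left)).1
      (meetL R a le_rfl (by omega) hRa) (meetL B a le_rfl (by omega) hBa)
      (meetL R c (by omega) le_rfl ⟨u, huR, hu⟩) (meetL B c (by omega) le_rfl ⟨u', huB, hu'⟩)
    have IR := (ihR (R ∩ W h (2 * k + 1)) (B ∩ W h (2 * k + 1)) Set.inter_subset_right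
      Set.inter_subset_right (sideR R B hR hRc hRk hfar w w' hwR hw hwB hw')
      (sideR B R hB hBc hBk hfar.symm w' w hwB hw' hwR hw)
      (hfar.mono Set.inter_subset_left Set.inter_subset_left)).1
      (meetR R (c + 1) le_rfl (by omega) ⟨w, hwR, hw⟩)
      (meetR B (c + 1) le_rfl (by omega) ⟨w', hwB, hw'⟩)
      (meetR R b (by omega) le_rfl hRb) (meetR B b (by omega) le_rfl hBb)
    -- Here the missing long edges between leaves enter; two consecutive leaves are not parent and
    -- child either.
    have hTT : ∀ (i j : Fin (2 ^ (n + 1))), (i : ℕ) = c → (j : ℕ) = c + 1 →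
        ¬ adj (Node.t i) (Node.t j) := by
      intro i j hi hj hij
      have := adjSpec_of_adj hij
      simp only [adjSpec] at this
      have := hk.left.1
      have h2 : 2 * k * 2 ^ h ≥ 2 * k := Nat.le_mul_of_pos_right _ hpos
      omega
    have disj : ∀ d, HasT R d → HasT B d → False := by
      rintro d ⟨j, hj, hjR⟩ ⟨j', hj', hjB⟩
      exact hfar.1 _ hjR (by rwa [show j = j' from Fin.ext (hj.trans hj'.symm)])
    have key : (HasT R c ∧ HasT B (c + 1)) ∨ (HasT B c ∧ HasT R (c + 1)) := by
      rcases hasT_or_of_pair hu hu' hne huR huB with ⟨⟨j, rfl, hj⟩, -⟩ | ⟨-, j, rfl, hj⟩ <;>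
        rcases hasT_or_of_pair hw hw' hne' hwR hwB with ⟨⟨i, rfl, hi⟩, -⟩ | ⟨-, i, rfl, hi⟩
      · exact absurd huw (hTT j i hj hi)
      · exact Or.inl ⟨⟨j, hj, huR⟩, i, hi, hwB⟩
      · exact Or.inr ⟨⟨j, hj, huB⟩, i, hi, hwR⟩
      · exact absurd huw' (hTT j i hj hi)
    have mo : ∀ {S S' : Set (Node n)} {d}, HasT (S ∩ S') d → HasT S d :=
      fun h => h.mono Set.inter_subset_left
    -- In each half, the set with the top node of that half also has its middle leaf. As the middle
    -- leaves belong to different sets, so do the siblings `t (2 * k)` and `t (2 * k + 1)`, which is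
    -- excluded by `Far`.
    rcases key with ⟨h1, h2⟩ | ⟨h1, h2⟩
    · have hL : HasT R (2 * k) := by
        rcases IL with h | h
        · exact mo h.1
        · exact (disj c h1 (mo h.2.2)).elim
      have hR' : HasT B (2 * k + 1) := by
        rcases IR with h | h
        · exact (disj (c + 1) (mo h.2.1) h2).elim
        · exact mo h.1
      have := hfar.2 _ _ hL hR'
      omega
    · have hL : HasT B (2 * k) := by
        rcases IL with h | h
        · exact (disj c (mo h.2.2) h1).elim
        · exact mo h.1
      have hR' : HasT R (2 * k + 1) := by
        rcases IR with h | h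
        · exact mo h.1
        · exact (disj (c + 1) h2 (mo h.2.1)).elim
      have := hfar.2 _ _ hR' hL
      omega

end FatMinor
-- Locating the clique models
namespace FatMinor

variable {n : ℕ}

instance : Finite (Node n) := by
  let f : Node n → Fin (2 ^ (n + 1)) ⊕ Fin (2 ^ n) ⊕ (Bool × Fin 15) ⊕ (Bool × Fin 15 × Fin 15)
    | .t k => .inl k
    | .y i => .inr (.inl i)
    | .a s i => .inr (.inr (.inl (s, i)))
    | .m s i j => .inr (.inr (.inr (s, i, j)))
  refine Finite.of_injective f ?_
  rintro (u | u | ⟨_, u⟩ | ⟨_, u, u'⟩) (v | v | ⟨_, v⟩ | ⟨_, v, v'⟩) h <;> simp_all [f]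

instance : Finite (LongEdge n) := by
  let f : LongEdge n → (Fin (2 ^ n - 1) ⊕ Fin (2 ^ n - 1) ⊕ Fin (2 ^ n - 1)) ⊕
      ((Bool × Fin 15 × Fin 15) ⊕ (Bool × Fin 15 × Fin 15)) ⊕ (Bool × Fin 3)
    | .yy i => .inl (.inl i)
    | .xy i => .inl (.inr (.inl i))
    | .yx i => .inl (.inr (.inr i))
    | .star s i j => .inr (.inl (.inl (s, i, j)))
    | .mid s i j => .inr (.inl (.inr (s, i, j)))
    | .link s c => .inr (.inr (s, c))
  refine Finite.of_injective f ?_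
  rintro (u | u | u | ⟨_, u, u'⟩ | ⟨_, u, u'⟩ | ⟨_, u⟩)
    (v | v | v | ⟨_, v, v'⟩ | ⟨_, v, v'⟩ | ⟨_, v⟩) h <;> simp_all [f]

/-- The set `Col c` as a finset. -/
noncomputable def colFinset (c : ℕ) : Finset (Node n) := (Set.toFinite (Col c)).toFinset

theorem mem_colFinset {c : ℕ} {u : Node n} : u ∈ colFinset c ↔ u ∈ Col c := by simp [colFinset]

theorem card_colFinset (c : ℕ) : (colFinset c : Finset (Node n)).card ≤ 2 := by
  by_contra! h
  obtain ⟨u, hu, v, hv, w, hw, huv, huw, hvw⟩ := Finset.two_lt_card.1 h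
  rw [mem_colFinset] at hu hv hw
  rcases Col_pair hu hv huv hw with h | h
  exacts [huw h.symm, hvw h.symm]

/-- The set `{t k}` as a finset, empty if there is no such node. -/
noncomputable def topFinset (k : ℕ) : Finset (Node n) :=
  (Set.toFinite {u | ∃ j : Fin (2 ^ (n + 1)), (j : ℕ) = k ∧ u = .t j}).toFinset

theorem mem_topFinset {k : ℕ} {u : Node n} :
    u ∈ topFinset k ↔ ∃ j : Fin (2 ^ (n + 1)), (j : ℕ) = k ∧ u = .t j := by simp [topFinset]

theorem card_topFinset (k : ℕ) : (topFinset k : Finset (Node n)).card ≤ 1 := by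
  rw [Finset.card_le_one]
  intro u hu v hv
  rw [mem_topFinset] at hu hv
  obtain ⟨i, hi, rfl⟩ := hu
  obtain ⟨j, hj, rfl⟩ := hv
  rw [Fin.ext (hi.trans hj.symm)]

/-- The nodes of `W h k` without its top node and its first and last column. -/
def innerW (h k : ℕ) : Set (Node n) :=
  {u | u ∈ W h k ∧ u ∉ topFinset k ∧ u ∉ Col (k * 2 ^ h) ∧ u ∉ Col ((k + 1) * 2 ^ h - 1)}

theorem adj_mem_W_of_mem_innerW {h k : ℕ} (hk : HasHeight n h k) {u w : Node n}
    (hu : u ∈ innerW h k) (huw : adj u w) : w ∈ W h k := by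
  by_contra hw
  rcases W_exit hk hu.1 hw huw with ⟨i, j, rfl, -, hi, -⟩ | ⟨h1, -⟩ | ⟨h1, -⟩
  · exact hu.2.1 (mem_topFinset.2 ⟨i, hi, rfl⟩)
  · exact hu.2.2.1 h1
  · exact hu.2.2.2 h1

open Classical in
-- The subtree is enclosed by its top node and its outer columns. Removing also the tops of its two
-- halves and the two middle columns leaves the interiors of the halves, with no edge between them.
theorem small_innerW {B : Fin 15 → Set (Node n)} {P : Fin 15 → Fin 15 → Set (Node n)}
    (M : IsCliqueModel adj B P) {h : ℕ} : ∀ {k : ℕ}, HasHeight n h k → Small B (innerW h k) := by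
  induction h with
  | zero =>
    intro k hk i hi
    obtain ⟨u, hu⟩ := M.nonempty i
    obtain ⟨h1, h2, h3, -⟩ := hi hu
    rcases u with u | u | ⟨_, u⟩ | ⟨_, u, u'⟩
    · obtain ⟨d, hd, hdk⟩ := h1
      obtain rfl : d = 0 := by omega
      exact h2 (mem_topFinset.2 ⟨u, by simpa using hdk, rfl⟩)
    · have h1' : (2 ^ n + (u : ℕ)) / 2 ^ 0 = k := h1
      apply h3
      simp only [Col, Set.mem_ofPred_eq]
      simpa using h1'
    · exact h1.elim
    · exact h1.elim
  | succ h ih =>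
    intro k hk
    have hl : 2 * k * 2 ^ h = k * 2 ^ (h + 1) := by ring
    have hr : (2 * k + 1 + 1) * 2 ^ h - 1 = (k + 1) * 2 ^ (h + 1) - 1 := by
      congr 1; ring
    refine M.small_of_cut (X₁ := innerW h (2 * k)) (X₂ := innerW h (2 * k + 1))
      (topFinset k ∪ colFinset (k * 2 ^ (h + 1)) ∪ colFinset ((k + 1) * 2 ^ (h + 1) - 1))
      ((topFinset k ∪ colFinset (k * 2 ^ (h + 1)) ∪ colFinset ((k + 1) * 2 ^ (h + 1) - 1)) ∪
        (topFinset (2 * k) ∪ topFinset (2 * k + 1) ∪ colFinset ((2 * k + 1) * 2 ^ h - 1) ∪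
          colFinset ((2 * k + 1) * 2 ^ h))) Finset.subset_union_left ?_ ?_ ?_ ?_
      (ih hk.left) (ih hk.right)
    -- The enclosing separator has at most 1 + 2 + 2 nodes and the splitting adds at most 1 + 1 + 2
    -- + 2, so 11 in all.
    · have t := fun k => card_topFinset (n := n) k
      have c := fun k => card_colFinset (n := n) k
      have := t k
      have := t (2 * k)
      have := t (2 * k + 1)
      have := c (k * 2 ^ (h + 1))
      have := c ((k + 1) * 2 ^ (h + 1) - 1)
      have := c ((2 * k + 1) * 2 ^ h - 1)
      have := c ((2 * k + 1) * 2 ^ h)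
      refine (Finset.card_union_le _ _).trans ?_
      refine (add_le_add ((Finset.card_union_le _ _).trans (add_le_add_left
        (Finset.card_union_le _ _) _)) ((Finset.card_union_le _ _).trans (add_le_add_left
        ((Finset.card_union_le _ _).trans (add_le_add_left
        (Finset.card_union_le _ _) _)) _))).trans ?_
      omega
    · intro u hu w huw
      have hw := adj_mem_W_of_mem_innerW hk hu huw
      simp only [Finset.mem_union, mem_colFinset, innerW, Set.mem_ofPred_eq]
      tauto
    · intro u hu
      obtain ⟨h1, h2, h3, h4⟩ := hu
      simp only [Finset.mem_union, mem_colFinset, innerW, Set.mem_ofPred_eq, hl, hr]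
      rcases W_succ h1 with ⟨j, hj, rfl⟩ | h1 | h1
      · exact absurd (mem_topFinset.2 ⟨j, hj, rfl⟩) h2
      · tauto
      · tauto
    · intro u hu w hw huw
      have h1 := adj_mem_W_of_mem_innerW hk.left hu huw
      have h2 := adj_mem_W_of_mem_innerW hk.right hw (adj_symm huw)
      by_cases hw' : w ∈ W h (2 * k)
      · by_cases hww : ∃ j, w = .t j
        · obtain ⟨j, rfl⟩ := hww
          obtain ⟨d, hd, hdk⟩ := hw'
          obtain ⟨d', hd', hdk'⟩ := hw.1
          -- A tree node below both siblings would make them equal or one an ancestor of the other.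
          rcases Nat.lt_trichotomy d d' with h' | rfl | h'
          · obtain ⟨e, rfl⟩ := Nat.exists_eq_add_of_lt h'
            rw [show d + e + 1 = d + (e + 1) by ring, pow_add 2 d (e + 1),
              ← Nat.div_div_eq_div_mul, hdk] at hdk'
            have := Nat.div_le_self (2 * k) (2 ^ (e + 1))
            omega
          · omega
          · obtain ⟨e, rfl⟩ := Nat.exists_eq_add_of_lt h'
            rw [show d' + e + 1 = d' + (e + 1) by ring, pow_add 2 d' (e + 1),
              ← Nat.div_div_eq_div_mul, hdk', pow_succ', ← Nat.div_div_eq_div_mul] at hdk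
            have := Nat.div_le_self ((2 * k + 1) / 2) (2 ^ e)
            have := hk.pos
            omega
        · rcases w with w | w | ⟨_, w⟩ | ⟨_, w, w'⟩
          · exact hww ⟨w, rfl⟩
          · have e1 : (2 ^ n + (w : ℕ)) / 2 ^ h = 2 * k := hw'
            have e2 : (2 ^ n + (w : ℕ)) / 2 ^ h = 2 * k + 1 := hw.1
            omega
          · exact hw'.elim
          · exact hw'.elim
      · exact hw' h1

/-- The nodes of the tree and the nodes `y`. -/
def middle : Set (Node n) := {u | (∃ j, u = .t j) ∨ ∃ i, u = .y i}

/-- The nodes of clique `s` that are not attached to the middle. -/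
def cliqueInner (s : Bool) : Set (Node n) :=
  {u | (∃ i : Fin 15, 3 ≤ (i : ℕ) ∧ u = .a s i) ∨ ∃ i j, u = .m s i j}

open Classical in
/-- The attached nodes of clique `s`. -/
noncomputable def attached (s : Bool) : Finset (Node n) :=
  Finset.univ.image fun c : Fin 3 => .a s (Fin.castLE (by norm_num) c)

theorem mem_attached {s : Bool} {u : Node n} :
    u ∈ attached s ↔ ∃ i : Fin 15, (i : ℕ) < 3 ∧ u = .a s i := by
  simp only [attached, Finset.mem_image, Finset.mem_univ, true_and]
  constructor
  · rintro ⟨c, rfl⟩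
    exact ⟨_, c.2, rfl⟩
  · rintro ⟨i, hi, rfl⟩
    exact ⟨⟨i, hi⟩, rfl⟩

theorem card_attached (s : Bool) : (attached s : Finset (Node n)).card ≤ 3 := by
  classical
  exact Finset.card_image_le.trans (by simp)

theorem mem_W_root {j : Fin (2 ^ (n + 1))} (hj : (j : ℕ) ≠ 0) : Node.t j ∈ W n 1 := by
  refine ⟨Nat.log 2 j, ?_, ?_⟩
  · exact Nat.lt_succ_iff.1 (Nat.log_lt_of_lt_pow hj j.2)
  · rw [div_pow_eq_iff]
    have h1 := Nat.pow_log_le_self 2 hj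
    have h2 := Nat.lt_pow_succ_log_self (b := 2) (by norm_num) j
    rw [Nat.succ_eq_add_one, pow_succ 2 (Nat.log 2 j)] at h2
    omega

theorem y_mem_W_root (i : Fin (2 ^ n)) : Node.y i ∈ W n 1 := by
  rw [mem_W_y]; omega

open Classical in
theorem small_middle {B : Fin 15 → Set (Node n)} {P : Fin 15 → Fin 15 → Set (Node n)}
    (M : IsCliqueModel adj B P) : Small B middle := by
  refine M.small_of_cut (X₁ := innerW n 1) (X₂ := ∅)
    (attached false ∪ attached true)
    ((attached false ∪ attached true) ∪ (topFinset 0 ∪ topFinset 1 ∪ colFinset (1 * 2 ^ n) ∪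
      colFinset ((1 + 1) * 2 ^ n - 1))) Finset.subset_union_left ?_ ?_ ?_ ?_
    (small_innerW M hasHeight_root) M.small_empty
  -- At most 3 + 3 attached nodes, `t 0`, the root and two columns: 12 nodes.
  · have := card_topFinset (n := n) 0
    have := card_topFinset (n := n) 1
    have := card_colFinset (n := n) (1 * 2 ^ n)
    have := card_colFinset (n := n) ((1 + 1) * 2 ^ n - 1)
    have := card_attached (n := n) false
    have := card_attached (n := n) true
    refine (Finset.card_union_le _ _).trans ?_
    refine (add_le_add (Finset.card_union_le _ _) ((Finset.card_union_le _ _).trans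
      (add_le_add_left ((Finset.card_union_le _ _).trans (add_le_add_left
      (Finset.card_union_le _ _) _)) _))).trans ?_
    omega
  · intro u hu w huw
    have hs := adjSpec_of_adj huw
    simp only [Finset.mem_union, mem_attached]
    rcases hu with ⟨j, rfl⟩ | ⟨j, rfl⟩ <;> rcases w with w | w | ⟨s, w⟩ | ⟨_, w, w'⟩
    · exact Or.inl (Or.inl ⟨w, rfl⟩)
    · exact Or.inl (Or.inr ⟨w, rfl⟩)
    · right
      have hw : (w : ℕ) < 3 := by simp only [adjSpec] at hs; omega
      cases s
      exacts [Or.inl ⟨w, hw, rfl⟩, Or.inr ⟨w, hw, rfl⟩]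
    · exact hs.elim
    · exact Or.inl (Or.inl ⟨w, rfl⟩)
    · exact Or.inl (Or.inr ⟨w, rfl⟩)
    · right
      have hw : (w : ℕ) < 3 := by simp only [adjSpec] at hs; omega
      cases s
      exacts [Or.inl ⟨w, hw, rfl⟩, Or.inr ⟨w, hw, rfl⟩]
    · exact hs.elim
  · intro u hu
    simp only [Finset.mem_union, mem_colFinset, innerW, Set.mem_ofPred_eq]
    have : u ∈ topFinset 0 ∨ u ∈ W n 1 := by
      rcases hu with ⟨j, rfl⟩ | ⟨j, rfl⟩
      · by_cases hj : (j : ℕ) = 0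
        · exact Or.inl (mem_topFinset.2 ⟨j, hj, rfl⟩)
        · exact Or.inr (mem_W_root hj)
      · exact Or.inr (y_mem_W_root j)
    tauto
  · rintro u - w ⟨⟩

open Classical in
/-- In a clique model on the nodes, all branch sets contain a vertex of the same clique `s`. -/
theorem exists_clique_side {B : Fin 15 → Set (Node n)} {P : Fin 15 → Fin 15 → Set (Node n)}
    (M : IsCliqueModel adj B P) : ∃ s, ∀ j, ∃ i, Node.a s i ∈ B j := by
  have hexit : ∀ s, ∀ u ∈ (cliqueInner s : Set (Node n)), ∀ w, adj u w →
      w ∈ cliqueInner s ∨ w ∈ attached s := by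
    intro s u hu w huw
    have hs := adjSpec_of_adj huw
    rw [mem_attached]
    rcases hu with ⟨i, hi, rfl⟩ | ⟨i, j, rfl⟩ <;> rcases w with w | w | ⟨s', w⟩ | ⟨s', w, w'⟩ <;>
      simp only [adjSpec] at hs
    · omega
    · omega
    · exact Or.inl (Or.inr ⟨w, w', by rw [hs.1]⟩)
    · obtain ⟨rfl, rfl⟩ := hs
      rcases Nat.lt_or_ge (w : ℕ) 3 with h | h
      · exact Or.inr ⟨w, h, rfl⟩
      · exact Or.inl (Or.inl ⟨w, h, rfl⟩)
    · exact Or.inl (Or.inr ⟨w, w', by rw [hs.1]⟩)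
  -- A branch set without attached nodes lies in the middle or inside one clique. The middle is
  -- small, so this branch set determines the side `s`.
  obtain ⟨j₀, hj₀⟩ := M.exists_avoid (attached false ∪ attached true) (by
    have := card_attached (n := n) false
    have := card_attached (n := n) true
    exact (Finset.card_union_le _ _).trans_lt (by omega))
  have hj₀' : ∀ s, ∀ z ∈ B j₀, z ∉ attached s := by
    intro s z hz h
    refine hj₀ z hz (Finset.mem_union.2 ?_)
    cases s
    exacts [Or.inl h, Or.inr h]
  have hs : ∃ s, B j₀ ⊆ cliqueInner s := by
    by_contra! hn
    have hns : ∀ s, ∀ u ∈ B j₀, u ∉ cliqueInner s := fun s =>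
      ((M.branch_conn j₀).subset_or_disjoint (fun u _ hu w hw huw =>
        (hexit s u hu w huw).resolve_right (hj₀' s w hw))).resolve_left (hn s)
    refine small_middle M j₀ ?_
    intro u hu
    rcases u with u | u | ⟨s, u⟩ | ⟨s, u, u'⟩
    · exact Or.inl ⟨u, rfl⟩
    · exact Or.inr ⟨u, rfl⟩
    · rcases Nat.lt_or_ge (u : ℕ) 3 with h | h
      · exact absurd (mem_attached.2 ⟨u, h, rfl⟩) (hj₀' s _ hu)
      · exact absurd (Or.inl ⟨u, h, rfl⟩) (hns s _ hu)
    · exact absurd (Or.inr ⟨u, u', rfl⟩) (hns s _ hu)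
  obtain ⟨s, hs⟩ := hs
  refine ⟨s, fun j => ?_⟩
  by_contra! hn
  have hja : ∀ z ∈ B j, z ∉ attached s := by
    intro z hz h
    obtain ⟨i, -, rfl⟩ := mem_attached.1 h
    exact hn i hz
  -- A branch set without any `a s i` is either confined to the two subdividing nodes of one clique
  -- edge, a small set, or separated from `B j₀` by three attached nodes.
  rcases (M.branch_conn j).subset_or_disjoint (X := cliqueInner s) (fun u _ hu w hw huw =>
    (hexit s u hu w huw).resolve_right (hja w hw)) with h | h
  · have hm : ∀ u ∈ B j, ∃ i k, u = .m s i k := by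
      intro u hu
      rcases h hu with ⟨i, -, rfl⟩ | h
      · exact absurd hu (hn i)
      · exact h
    obtain ⟨u, hu⟩ := M.nonempty j
    obtain ⟨i, k, rfl⟩ := hm u hu
    have hsmall : Small B {Node.m s i k, Node.m s k i} := by
      refine M.small_of_cut (X₁ := ∅) (X₂ := ∅) {.a s i, .a s k}
        {.a s i, .a s k, .m s i k, .m s k i} ?_ (Finset.card_le_four.trans (by norm_num)) ?_ ?_ ?_
        M.small_empty M.small_empty
      · intro z; simp; tauto
      · intro z hz w hzw
        have hsp := adjSpec_of_adj hzw
        rcases hz with rfl | rfl <;> rcases w with w | w | ⟨s', w⟩ | ⟨s', w, w'⟩ <;>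
          simp only [adjSpec] at hsp <;> simp <;> tauto
      · intro z hz
        rcases hz with rfl | rfl <;> simp
      · rintro u - w ⟨⟩
    refine hsmall j ?_
    have hcl : ∀ z ∈ B j, z ∈ ({Node.m s i k, Node.m s k i} : Set (Node n)) → ∀ w ∈ B j, adj z w →
        w ∈ ({Node.m s i k, Node.m s k i} : Set (Node n)) := by
      intro z hz hzX w hw hzw
      obtain ⟨i', k', rfl⟩ := hm w hw
      have hsp := adjSpec_of_adj hzw
      rcases hzX with rfl | rfl <;> simp only [adjSpec] at hsp <;> simp <;> tauto
    rcases (M.branch_conn j).subset_or_disjoint hcl with h | h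
    · exact h
    · exact absurd (Or.inl rfl) (h _ hu)
  · exact M.not_separated (attached s) ((card_attached s).trans (by norm_num)) (hexit s) hs
      (fun z hz => ⟨h z hz, hja z hz⟩)

end FatMinor
-- Excluding a 3-fat model
namespace FatMinor

variable {n : ℕ}

/-- The nodes of clique `s`. -/
def cliqueNodes (s : Bool) : Set (Node n) := {u | (∃ i, u = .a s i) ∨ ∃ i j, u = .m s i j}

/-- There are no three pairwise far connected sets joining the two cliques. -/
theorem no_three_connections {Q : Fin 3 → Set (Node n)} (hQ : ∀ c, CutConnected adj (Q c))
    (hfar : ∀ c d, c ≠ d → Far (Q c) (Q d)) (hmeet : ∀ c s, ∃ i, Node.a s i ∈ Q c) : False := by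
  have hpos : 0 < 2 ^ n := by positivity
  have hn2 : 2 ^ (n + 1) = 2 * 2 ^ n := by ring
  have hside : ∀ s (u w : Node n), u ∈ cliqueNodes s → w ∉ cliqueNodes s → adj u w →
      w ∈ topFinset 0 ∨ w ∈ Col (if s then 2 ^ (n + 1) - 1 else 2 ^ n) := by
    intro s u w hu hw huw
    have hs := adjSpec_of_adj huw
    rcases hu with ⟨i, rfl⟩ | ⟨i, j, rfl⟩ <;> rcases w with w | w | ⟨s', w⟩ | ⟨s', w, w'⟩ <;>
      simp only [adjSpec] at hs
    · rcases hs with ⟨-, h⟩ | ⟨-, rfl, h⟩ | ⟨-, rfl, h⟩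
      · exact Or.inl (mem_topFinset.2 ⟨w, h, rfl⟩)
      · right; simpa [Col] using h
      · right; simp only [Col, Set.mem_ofPred_eq, if_true]; omega
    · rcases hs with ⟨-, ⟨rfl, h⟩ | ⟨rfl, h⟩⟩
      · right; simpa [Col] using h
      · right; simp only [Col, Set.mem_ofPred_eq, if_true]; omega
    · exact absurd (Or.inr ⟨w, w', by rw [hs.1]⟩) hw
    · exact absurd (Or.inl ⟨w, by rw [hs.1]⟩) hw
    · exact absurd (Or.inr ⟨w, w', by rw [hs.1]⟩) hw
  have hother : ∀ s i, Node.a (!s) i ∉ (cliqueNodes s : Set (Node n)) := by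
    rintro s i (⟨j, h⟩ | ⟨j, k, h⟩)
    · simp at h
    · cases h
  have hterm : ∀ c (s : Bool), HasT (Q c) 0 ∨ Meets (Q c) (if s then 2 ^ (n + 1) - 1 else 2 ^ n) := by
    intro c s
    obtain ⟨i, hi⟩ := hmeet c s
    obtain ⟨j, hj⟩ := hmeet c (!s)
    obtain ⟨u, hu, huX, w, hw, hwX, huw⟩ := hQ c (cliqueNodes s) _ hi (Or.inl ⟨i, rfl⟩) _ hj
      (hother s j)
    rcases hside s u w huX hwX huw with h | h
    · obtain ⟨k, hk, rfl⟩ := mem_topFinset.1 h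
      exact Or.inl ⟨k, hk, hw⟩
    · exact Or.inr ⟨w, hw, h⟩
  have hne : ∀ c d, c ≠ d → ∀ u ∈ Q c, ∀ w ∈ Q d, u ≠ w := by
    rintro c d hcd u hu w hw rfl
    exact (hfar c d hcd).1 u hu hw
  -- Without `t 0` three disjoint sets would all have to enter through the two nodes of one column.
  have h0 : ∃ c, HasT (Q c) 0 := by
    by_contra! hn
    have h := fun c => (hterm c false).resolve_left (hn c)
    obtain ⟨u, hu, hu'⟩ := h 0
    obtain ⟨v, hv, hv'⟩ := h 1
    obtain ⟨w, hw, hw'⟩ := h 2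
    rcases Col_pair hu' hv' (hne 0 1 (by decide) u hu v hv) hw' with h | h
    · exact hne 0 2 (by decide) u hu w hw h.symm
    · exact hne 1 2 (by decide) v hv w hw h.symm
  obtain ⟨c₀, hc₀⟩ := h0
  obtain ⟨c₁, c₂, h10, h20, h12⟩ : ∃ c₁ c₂, c₁ ≠ c₀ ∧ c₂ ≠ c₀ ∧ c₁ ≠ c₂ := by
    clear hc₀; revert c₀; decide
  have hno : ∀ c, c ≠ c₀ → ∀ w ∈ Q c, w ∉ topFinset 0 := by
    intro c hc w hw h
    obtain ⟨j, hj, rfl⟩ := mem_topFinset.1 h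
    obtain ⟨j', hj', h'⟩ := hc₀
    rw [show j' = j from Fin.ext (hj'.trans hj.symm)] at h'
    exact hne c c₀ hc _ hw _ h' rfl
  have hmeets : ∀ c, c ≠ c₀ → ∀ s : Bool, Meets (Q c) (if s then 2 ^ (n + 1) - 1 else 2 ^ n) := by
    intro c hc s
    rcases hterm c s with ⟨j, hj, hjQ⟩ | h
    · exact absurd (mem_topFinset.2 ⟨j, hj, rfl⟩) (hno c hc _ hjQ)
    · exact h
  have hsub : (Col (2 ^ n) : Set (Node n)) ⊆ W n 1 := Col_subset_W hasHeight_root (by omega) (by omega)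
  have key : ∀ c d, c ≠ c₀ → d ≠ c₀ → c ≠ d → ∃ R ⊆ Q c, R ⊆ W n 1 ∧ CutConnected adj R ∧
      Meets R (2 ^ n) ∧ Meets R (2 ^ (n + 1) - 1) := by
    intro c d hc hd hcd
    obtain ⟨ρ, hρQ, hρ⟩ := hmeets c hc false
    obtain ⟨β, hβQ, hβ⟩ := hmeets d hd false
    simp only [Bool.false_eq_true, if_false] at hρ hβ
    have hR : compOf adj (Q c ∩ W n 1) ρ ⊆ Q c ∩ W n 1 := compOf_subset ⟨hρQ, hsub hρ⟩
    refine ⟨compOf adj (Q c ∩ W n 1) ρ, fun u hu => (hR hu).1, fun u hu => (hR hu).2,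
      cutConnected_compOf adj_symm _ _, ⟨ρ, mem_compOf_self _ _, hρ⟩, ?_⟩
    obtain ⟨j, hj⟩ := hmeet c true
    -- The first clique is added to the cut so that a return into it does not count as an exit. The
    -- other node of the first column belongs to `Q d` and `t 0` to `Q c₀`, so the only exit left is
    -- the last column.
    obtain ⟨u, hu, huX, w, hw, hwX, huw⟩ := hQ c (compOf adj (Q c ∩ W n 1) ρ ∪ cliqueNodes false)
      ρ hρQ (Or.inl (mem_compOf_self _ _)) _ hj (by
        rintro (h | h)
        · exact (hR h).2.elim
        · exact hother false j h)
    rcases huX with huX | huX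
    · have hwW : w ∉ W n 1 := fun h => hwX (Or.inl (compOf_closed huX huw ⟨hw, h⟩))
      rcases W_exit hasHeight_root (hR huX).2 hwW huw with ⟨i, j, rfl, rfl, hi, hj⟩ |
        ⟨-, ⟨c, hc1, hc2, -⟩ | ⟨i, rfl⟩⟩ | ⟨h1, -⟩
      · exact absurd (mem_topFinset.2 ⟨j, by omega, rfl⟩) (hno c hc _ hw)
      · omega
      · exact absurd (Or.inr (Or.inl ⟨i, rfl⟩)) hwX
      · refine ⟨u, huX, ?_⟩
        rwa [show (1 + 1) * 2 ^ n - 1 = 2 ^ (n + 1) - 1 by rw [hn2]] at h1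
    · exfalso
      rcases hside false u w huX (fun h => hwX (Or.inr h)) huw with h | h
      · exact hno c hc w hw h
      · simp only [Bool.false_eq_true, if_false] at h
        rcases Col_pair hρ hβ (hne c d hcd _ hρQ _ hβQ) h with rfl | rfl
        · exact hwX (Or.inl (mem_compOf_self _ _))
        · exact hne c d hcd _ hw _ hβQ rfl
  obtain ⟨R, hRQ, hRW, hRc, hR1, hR2⟩ := key c₁ c₂ h10 h20 h12
  obtain ⟨B, hBQ, hBW, hBc, hB1, hB2⟩ := key c₂ c₁ h20 h10 h12.symm
  have := (coloring hasHeight_root (2 ^ n) (2 ^ (n + 1) - 1) (by omega) (by omega) R B hRW hBW hRc hBc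
    ((hfar c₁ c₂ h12).mono hRQ hBQ)).1 hR1 hB1 hR2 hB2
  rcases this with ⟨h, -⟩ | ⟨h, -⟩
  · have := (hfar c₀ c₁ h10.symm).2 0 1 hc₀ (h.mono hRQ)
    omega
  · have := (hfar c₀ c₂ h20.symm).2 0 1 hc₀ (h.mono hBQ)
    omega

/-- Siblings are joined by a path of length 2 through their parent; this is what distance 3 rules
out and distance 2 would not. -/
theorem far_of_le_setDist {L : ℕ} {X Y : Set (Node n ⊕ LongEdge n × Fin L)}
    (h : ((3 : ℕ) : ℕ∞) ≤ setDist (fatGraph n L) X Y) : Far (Sum.inl ⁻¹' X) (Sum.inl ⁻¹' Y) := by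
  have hd := disjoint_of_le_setDist (by norm_num) h
  rw [le_setDist_iff] at h
  have hpar : ∀ i j : Fin (2 ^ (n + 1)), (j : ℕ) = i / 2 →
      (fatGraph n L).edist (.inl (.t i)) (.inl (.t j)) ≤ 1 := by
    intro i j hij
    by_cases he : i = j
    · rw [he]; simp
    · have : (fatGraph n L).Adj (.inl (.t i)) (.inl (.t j)) :=
        show (tree n).Adj (.t i) (.t j) from ⟨he, Or.inr hij⟩
      exact (SimpleGraph.edist_eq_one_iff_adj.2 this).le
  refine ⟨fun u hu hu' => Set.disjoint_left.1 hd hu hu', ?_⟩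
  rintro _ _ ⟨i, rfl, hi⟩ ⟨j, rfl, hj⟩
  have h3 := h _ hi _ hj
  refine ⟨fun e => ?_, fun e => ?_, fun e => ?_⟩
  · have := h3.trans (SimpleGraph.edist_comm (G := fatGraph n L) ▸ hpar j i e)
    norm_num at this
  · have := h3.trans (hpar i j e)
    norm_num at this
  · have h1 := hpar i ⟨(i : ℕ) / 2, by omega⟩ rfl
    have h2 := hpar j ⟨(i : ℕ) / 2, by omega⟩ e
    rw [SimpleGraph.edist_comm] at h2
    have := h3.trans ((SimpleGraph.edist_triangle).trans (add_le_add h1 h2))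
    norm_num at this

theorem not_isFatMinor (n L : ℕ) : ¬ IsFatMinor 3 linkedK15 (fatGraph n L) := by
  rintro ⟨B, P, h⟩
  have hB : ∀ v, (B v).Nonempty ∧ CutConnected (fatGraph n L).Adj (B v) :=
    fun v => connected_induce_iff.1 (h.connected_branch v)
  have hP : ∀ e, (P e).Nonempty ∧ CutConnected (fatGraph n L).Adj (P e) :=
    fun e => connected_induce_iff.1 (h.connected_edge e)
  have hjoin : ∀ u v (e : linkedK15.edgeSet), (e : Sym2 _) = s(u, v) →
      CutConnected (fatGraph n L).Adj (B u ∪ P e ∪ B v) := by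
    intro u v e he
    refine ((hB u).2.union (hP e).2 (h.meet u e (by simp [he]))).union (hB v).2 ?_
    obtain ⟨z, h1, h2⟩ := h.meet v e (by simp [he])
    exact ⟨z, Or.inr h2, h1⟩
  have model : ∀ f : Fin 15 → Fin 15 ⊕ Fin 15, Function.Injective f →
      (∀ i j, i ≠ j → linkedK15.Adj (f i) (f j)) → ∃ s, ∀ j, ∃ i, .inl (Node.a s i) ∈ B (f j) := by
    intro f hf hadj
    have M : IsCliqueModel (fatGraph n L).Adj (fun i => B (f i))
        (fun i j => if hij : i = j then ∅ else P ⟨s(f i, f j), hadj i j hij⟩) := by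
      refine ⟨fun i => (hB _).1, fun i => (hB _).2, ?_, ?_, ?_, ?_⟩
      · intro i j hij
        simp only [hij, dite_false]
        exact hjoin _ _ _ rfl
      · intro i j hij
        exact disjoint_of_le_setDist (by norm_num) (h.branch_branch _ _ (hf.ne hij))
      · intro i j k hij hki hkj
        simp only [hij, dite_false]
        refine disjoint_of_le_setDist (by norm_num) (h.branch_edge _ _ ?_)
        simp [hf.eq_iff, hki, hkj]
      · intro i j k l hij hkl hne
        simp only [hij, hkl, dite_false]
        refine disjoint_of_le_setDist (by norm_num) (h.edge_edge _ _ ?_)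
        intro e
        apply hne
        simpa [hf.eq_iff] using congrArg Subtype.val e
    exact exists_clique_side M.nodes
  obtain ⟨s, hs⟩ := model Sum.inl Sum.inl_injective (fun i j hij => hij)
  obtain ⟨s', hs'⟩ := model Sum.inr Sum.inr_injective (fun i j hij => hij)
  -- Thirty disjoint branch sets cannot all contain one of the fifteen vertices `a s i`.
  have hss : s ≠ s' := by
    rintro rfl
    have : ∀ v, ∃ i, .inl (Node.a s i) ∈ B v := by
      rintro (v | v)
      exacts [hs v, hs' v]
    choose f hf using this
    have hinj : Function.Injective f := by
      intro u v huv
      by_contra hne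
      exact Set.disjoint_left.1 (disjoint_of_le_setDist (by norm_num) (h.branch_branch u v hne))
        (hf u) (huv ▸ hf v)
    have := Fintype.card_le_of_injective f hinj
    simp at this
  let emb : Fin 3 → Fin 15 := Fin.castLE (by norm_num)
  have hemb : ∀ c d, emb c = emb d → c = d := fun c d hcd => Fin.castLE_injective _ hcd
  let e : Fin 3 → linkedK15.edgeSet := fun c => ⟨s(.inl (emb c), .inr (emb c)), ⟨rfl, c.2⟩⟩
  refine no_three_connections (n := n)
    (Q := fun c => Sum.inl ⁻¹' (B (.inl (emb c)) ∪ P (e c) ∪ B (.inr (emb c)))) ?_ ?_ ?_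
  · exact fun c => (hjoin _ _ _ rfl).nodes
  · intro c d hcd
    have hne : emb c ≠ emb d := fun hh => hcd (hemb _ _ hh)
    apply far_of_le_setDist
    have e1 := h.branch_edge
    have e2 := h.edge_edge (e c) (e d) (by
      intro hh
      have := congrArg Subtype.val hh
      simp [e] at this
      exact hne this)
    have e3 := h.branch_branch
    have f1 := e3 (.inl (emb c)) (.inl (emb d)) (by simpa using hne)
    have f2 := e3 (.inl (emb c)) (.inr (emb d)) (by simp)
    have f3 := e3 (.inr (emb c)) (.inl (emb d)) (by simp)
    have f4 := e3 (.inr (emb c)) (.inr (emb d)) (by simpa using hne)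
    have g1 := e1 (.inl (emb c)) (e d) (by simpa [e] using hne)
    have g2 := e1 (.inr (emb c)) (e d) (by simpa [e] using hne)
    have g3 := e1 (.inl (emb d)) (e c) (by simpa [e] using hne.symm)
    have g4 := e1 (.inr (emb d)) (e c) (by simpa [e] using hne.symm)
    rw [le_setDist_iff] at *
    rintro x ((hx | hx) | hx) y ((hy | hy) | hy)
    · exact f1 x hx y hy
    · exact g1 x hx y hy
    · exact f2 x hx y hy
    · rw [SimpleGraph.edist_comm]; exact g3 y hy x hx
    · exact e2 x hx y hy
    · rw [SimpleGraph.edist_comm]; exact g4 y hy x hx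
    · exact f3 x hx y hy
    · exact g2 x hx y hy
    · exact f4 x hx y hy
  · intro c t
    have : t = s ∨ t = s' := by
      clear hs hs'
      revert t s s'
      decide
    rcases this with rfl | rfl
    · obtain ⟨i, hi⟩ := hs (emb c)
      exact ⟨i, Or.inl (Or.inl hi)⟩
    · obtain ⟨i, hi⟩ := hs' (emb c)
      exact ⟨i, Or.inr hi⟩

end FatMinor
-- Label-disjoint connections across the strip
namespace FatMinor

variable {n : ℕ} {K : Type*}

theorem Node.x_injective : Function.Injective (Node.x (n := n)) := by
  intro i j h
  simp only [Node.x, Node.t.injEq, Fin.mk.injEq] at h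
  exact Fin.ext (by omega)

open Classical in
/-- The label of a node: the label `κ i` for the leaf in column `i`, and the node itself for all
other nodes. -/
noncomputable def label (κ : Fin (2 ^ n) → K) (u : Node n) : Node n ⊕ K :=
  if h : ∃ i, u = .x i then .inr (κ h.choose) else .inl u

variable {κ : Fin (2 ^ n) → K}

@[simp] theorem label_x (i : Fin (2 ^ n)) : label κ (.x i) = .inr (κ i) := by
  have h : ∃ j, Node.x i = .x j := ⟨i, rfl⟩
  rw [label, dif_pos h, ← Node.x_injective h.choose_spec]

@[simp] theorem label_y (i : Fin (2 ^ n)) : label κ (.y i) = .inl (.y i) :=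
  dif_neg (by rintro ⟨j, h⟩; cases h)

@[simp] theorem label_a (s : Bool) (i : Fin 15) : label κ (.a s i) = .inl (.a s i) :=
  dif_neg (by rintro ⟨j, h⟩; cases h)

@[simp] theorem label_m (s : Bool) (i j : Fin 15) : label κ (.m s i j) = .inl (.m s i j) :=
  dif_neg (by rintro ⟨k, h⟩; cases h)

theorem label_t_zero : label κ (.t ⟨0, by positivity⟩) = .inl (.t ⟨0, by positivity⟩) := by
  refine dif_neg ?_
  rintro ⟨j, h⟩
  simp only [Node.x, Node.t.injEq, Fin.mk.injEq] at h
  have : 0 < 2 ^ n := by positivity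
  omega

/-- `ℓ` is the label of an end of the long edge `e`. -/
def IsEnd (κ : Fin (2 ^ n) → K) (e : LongEdge n) (ℓ : Node n ⊕ K) : Prop :=
  ℓ = label κ e.src ∨ ℓ = label κ e.tgt

/-- Two long edges have ends with the same label. -/
def Share (κ : Fin (2 ^ n) → K) (e f : LongEdge n) : Prop := ∃ ℓ, IsEnd κ e ℓ ∧ IsEnd κ f ℓ

theorem Share.symm ⦃e f : LongEdge n⦄ (h : Share κ e f) : Share κ f e := by
  obtain ⟨ℓ, h1, h2⟩ := h
  exact ⟨ℓ, h2, h1⟩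

/-- The labels of the ends of the long edges in `A`. -/
def labels (κ : Fin (2 ^ n) → K) (A : Set (LongEdge n)) : Set (Node n ⊕ K) :=
  {ℓ | ∃ e ∈ A, IsEnd κ e ℓ}

theorem mem_labels_insert {e : LongEdge n} {A : Set (LongEdge n)} {ℓ : Node n ⊕ K} :
    ℓ ∈ labels κ (insert e A) ↔ (ℓ = label κ e.src ∨ ℓ = label κ e.tgt) ∨ ℓ ∈ labels κ A := by
  simp [labels, IsEnd]

theorem cutConnected_insert {e : LongEdge n} {A : Set (LongEdge n)} {ℓ : Node n ⊕ K}
    (hA : CutConnected (Share κ) A) (h1 : ℓ ∈ labels κ A) (h2 : IsEnd κ e ℓ) :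
    CutConnected (Share κ) (insert e A) := by
  refine cutConnected_of_center Share.symm e ?_
  intro X heX w hw hwX
  have hwA : w ∈ A := by
    rcases hw with rfl | hw
    · exact absurd hwX heX
    · exact hw
  obtain ⟨f, hf, hfl⟩ := h1
  by_cases hfX : f ∈ X
  · exact ⟨f, Or.inr hf, hfX, e, Or.inl rfl, heX, ℓ, hfl, h2⟩
  · obtain ⟨u, hu, huX, w', hw', hwX', h⟩ := hA X w hwA hwX f hf hfX
    exact ⟨u, Or.inr hu, huX, w', Or.inr hw', hwX', h⟩

theorem cutConnected_singleton {α : Type*} {r : α → α → Prop} (a : α) :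
    CutConnected r {a} := by
  rintro X _ rfl huX _ rfl hwX
  exact absurd huX hwX

/-- State of the construction of two paths at column `i`: `A` is at a leaf with label `k` that
occurs in column `i` or later, and `B` is at `y i`. -/
structure State (κ : Fin (2 ^ n) → K) (i : Fin (2 ^ n)) (k : K) (A B : Set (LongEdge n)) : Prop where
  connA : CutConnected (Share κ) A
  connB : CutConnected (Share κ) B
  endA : .inr k ∈ labels κ A
  endB : .inl (.y i) ∈ labels κ B
  disj : ∀ ℓ ∈ labels κ A, ℓ ∉ labels κ B
  start : (.link false 0 ∈ A ∧ .link false 1 ∈ B) ∨ (.link false 1 ∈ A ∧ .link false 0 ∈ B)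
  ahead : ∃ j ≥ i, κ j = k
  used : ∀ ℓ, ℓ ∈ labels κ A ∨ ℓ ∈ labels κ B →
    ℓ = .inl (.a false 0) ∨ ℓ = .inl (.a false 1) ∨ (∃ j ≤ i, ℓ = .inl (.y j)) ∨ ℓ = .inr k ∨
      ∃ k', ℓ = .inr k' ∧ ∀ j ≥ i, κ j ≠ k'

theorem labels_singleton (e : LongEdge n) (ℓ : Node n ⊕ K) :
    ℓ ∈ labels κ {e} ↔ ℓ = label κ e.src ∨ ℓ = label κ e.tgt := by
  simp [labels, IsEnd]

theorem State.first_column : State κ (endCol false) (κ (endCol false)) {.link false 0} {.link false 1} where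
  connA := cutConnected_singleton _
  connB := cutConnected_singleton _
  endA := by simp [labels_singleton, LongEdge.src, LongEdge.tgt, terminal]
  endB := by simp [labels_singleton, LongEdge.src, LongEdge.tgt, terminal]
  disj := by
    intro ℓ
    simp only [labels_singleton, LongEdge.src, LongEdge.tgt, terminal]
    rintro (rfl | rfl) <;> simp
  start := by simp
  ahead := ⟨_, le_rfl, rfl⟩
  used := by
    intro ℓ
    simp only [labels_singleton, LongEdge.src, LongEdge.tgt, terminal]
    rintro ((rfl | rfl) | (rfl | rfl))
    · left; simp
    · simp
    · right; left; simp
    · right; right; left; exact ⟨_, le_rfl, by simp⟩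

/-- A label is abandoned only at its last occurrence, so it cannot block a later column. -/
theorem State.step {i : Fin (2 ^ n - 1)} {k : K} {A B : Set (LongEdge n)}
    (h : State κ (colL i) k A B) : ∃ k A B, State κ (colR i) k A B := by
  have hlt : colL i < colR i := by simp [colL, colR, Fin.lt_def]
  have hge : ∀ j, colL i ≤ j → j = colL i ∨ colR i ≤ j := by
    intro j hj
    simp only [colL, colR, Fin.le_def, Fin.ext_iff] at *
    omega
  have hyR : (.inl (.y (colR i)) : Node n ⊕ K) ∉ labels κ A ∧ .inl (.y (colR i)) ∉ labels κ B := by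
    rw [← not_or]
    intro hh
    rcases h.used _ hh with h | h | ⟨j, hj, h⟩ | h | ⟨k', h, -⟩ <;> try cases h
    exact absurd hlt (not_lt.2 hj)
  have hyA : (.inl (.y (colL i)) : Node n ⊕ K) ∉ labels κ A := fun hh => h.disj _ hh h.endB
  -- If the label `k` occurs again, `A` waits and `B` moves along the row `y`. Otherwise column `i`
  -- is its last occurrence: `A` moves from the leaf to the next `y`, `B` from `y` to the next leaf,
  -- and the roles are exchanged.
  by_cases hk : ∃ j ≥ colR i, κ j = k
  · refine ⟨k, A, insert (.yy i) B, h.connA, cutConnected_insert h.connB h.endB (Or.inl ?_), h.endA,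
      ?_, ?_, ?_, hk, ?_⟩
    · simp [LongEdge.src]
    · simp [mem_labels_insert, LongEdge.tgt]
    · intro ℓ hℓ hℓ'
      simp only [mem_labels_insert, LongEdge.src, LongEdge.tgt, label_y] at hℓ'
      rcases hℓ' with (rfl | rfl) | hℓ'
      · exact hyA hℓ
      · exact hyR.1 hℓ
      · exact h.disj _ hℓ hℓ'
    · rcases h.start with h | h
      · exact Or.inl ⟨h.1, Or.inr h.2⟩
      · exact Or.inr ⟨h.1, Or.inr h.2⟩
    · intro ℓ hℓ
      have : ℓ = .inl (.y (colR i)) ∨ (ℓ ∈ labels κ A ∨ ℓ ∈ labels κ B) := by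
        simp only [mem_labels_insert, LongEdge.src, LongEdge.tgt, label_y] at hℓ
        rcases hℓ with hℓ | (rfl | rfl) | hℓ
        · exact Or.inr (Or.inl hℓ)
        · exact Or.inr (Or.inr h.endB)
        · exact Or.inl rfl
        · exact Or.inr (Or.inr hℓ)
      rcases this with rfl | hℓ
      · exact Or.inr (Or.inr (Or.inl ⟨_, le_rfl, rfl⟩))
      · rcases h.used ℓ hℓ with h | h | ⟨j, hj, h⟩ | h | ⟨k', h, h'⟩
        · exact Or.inl h
        · exact Or.inr (Or.inl h)
        · exact Or.inr (Or.inr (Or.inl ⟨j, hj.trans hlt.le, h⟩))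
        · exact Or.inr (Or.inr (Or.inr (Or.inl h)))
        · exact Or.inr (Or.inr (Or.inr (Or.inr ⟨k', h, fun j hj => h' j (hlt.le.trans hj)⟩)))
  · have hkL : κ (colL i) = k := by
      obtain ⟨j, hj, hjk⟩ := h.ahead
      rcases hge j hj with rfl | hj
      · exact hjk
      · exact absurd ⟨j, hj, hjk⟩ hk
    -- A used label is `k`, which does not occur any more, or one that does not occur from column
    -- `i` on.
    have hkR : (.inr (κ (colR i)) : Node n ⊕ K) ∉ labels κ A ∧ .inr (κ (colR i)) ∉ labels κ B := by
      rw [← not_or]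
      intro hh
      rcases h.used _ hh with h | h | ⟨j, hj, h⟩ | h | ⟨k', h, h'⟩
      · cases h
      · cases h
      · cases h
      · exact hk ⟨_, le_rfl, Sum.inr_injective h⟩
      · exact h' _ hlt.le (Sum.inr_injective h)
    have hkB : (.inr k : Node n ⊕ K) ∉ labels κ B := h.disj _ h.endA
    refine ⟨κ (colR i), insert (.yx i) B, insert (.xy i) A,
      cutConnected_insert h.connB h.endB (Or.inl ?_),
      cutConnected_insert h.connA h.endA (Or.inl ?_), ?_, ?_, ?_, ?_, ⟨_, le_rfl, rfl⟩, ?_⟩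
    · simp [LongEdge.src]
    · simp [LongEdge.src, hkL]
    · simp [mem_labels_insert, LongEdge.tgt]
    · simp [mem_labels_insert, LongEdge.tgt]
    · intro ℓ hℓ hℓ'
      simp only [mem_labels_insert, LongEdge.src, LongEdge.tgt, label_y, label_x, hkL] at hℓ hℓ'
      rcases hℓ with (rfl | rfl) | hℓ <;> rcases hℓ' with (h1 | h1) | h1
      · cases h1
      · exact hlt.ne (Node.y.inj (Sum.inl_injective h1))
      · exact hyA h1
      · exact hkR.1 (h1 ▸ h.endA)
      · cases h1
      · exact hkR.1 h1
      · exact hkB (h1 ▸ hℓ)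
      · exact hyR.2 (h1 ▸ hℓ)
      · exact h.disj _ h1 hℓ
    · rcases h.start with h | h
      · exact Or.inr ⟨Or.inr h.2, Or.inr h.1⟩
      · exact Or.inl ⟨Or.inr h.2, Or.inr h.1⟩
    · intro ℓ hℓ
      have : ℓ = .inl (.y (colR i)) ∨ ℓ = .inr (κ (colR i)) ∨ (ℓ ∈ labels κ A ∨ ℓ ∈ labels κ B) := by
        simp only [mem_labels_insert, LongEdge.src, LongEdge.tgt, label_y, label_x, hkL] at hℓ
        rcases hℓ with ((rfl | rfl) | hℓ) | ((rfl | rfl) | hℓ)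
        · exact Or.inr (Or.inr (Or.inr h.endB))
        · exact Or.inr (Or.inl rfl)
        · exact Or.inr (Or.inr (Or.inr hℓ))
        · exact Or.inr (Or.inr (Or.inl h.endA))
        · exact Or.inl rfl
        · exact Or.inr (Or.inr (Or.inl hℓ))
      rcases this with rfl | rfl | hℓ
      · exact Or.inr (Or.inr (Or.inl ⟨_, le_rfl, rfl⟩))
      · exact Or.inr (Or.inr (Or.inr (Or.inl rfl)))
      · rcases h.used ℓ hℓ with h | h | ⟨j, hj, h⟩ | h | ⟨k', h, h'⟩
        · exact Or.inl h
        · exact Or.inr (Or.inl h)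
        · exact Or.inr (Or.inr (Or.inl ⟨j, hj.trans hlt.le, h⟩))
        · exact Or.inr (Or.inr (Or.inr (Or.inr ⟨k, h, fun j hj e => hk ⟨j, hj, e⟩⟩)))
        · exact Or.inr (Or.inr (Or.inr (Or.inr ⟨k', h, fun j hj => h' j (hlt.le.trans hj)⟩)))

theorem exists_state (κ : Fin (2 ^ n) → K) : ∃ k A B, State κ (endCol true) k A B := by
  have : ∀ m (hm : m < 2 ^ n), ∃ k A B, State κ ⟨m, hm⟩ k A B := by
    intro m
    induction m with
    | zero => exact fun _ => ⟨_, _, _, State.first_column⟩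
    | succ m ih =>
      intro hm
      obtain ⟨k, A, B, h⟩ := ih (by omega)
      exact State.step (i := ⟨m, by omega⟩) h
  exact this _ _

/-- The position of the vertices `0, 1, 2` among the vertices of `K₁₅`. -/
def emb (c : Fin 3) : Fin 15 := Fin.castLE (by norm_num) c

/-- A label that does not belong to one of the cliques. -/
def IsMiddle (ℓ : Node n ⊕ K) : Prop := (∀ s i, ℓ ≠ .inl (.a s i)) ∧ ∀ s i j, ℓ ≠ .inl (.m s i j)

/-- Three label-disjoint connections between the two cliques, up to a permutation of the second. -/
theorem exists_three_connections (κ : Fin (2 ^ n) → K) :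
    ∃ (τ : Equiv.Perm (Fin 15)) (A : Fin 3 → Set (LongEdge n)),
      (∀ c, CutConnected (Share κ) (A c)) ∧ (∀ c, .link false c ∈ A c) ∧
      (∀ c, ∃ d, emb d = τ (emb c) ∧ .link true d ∈ A c) ∧
      (∀ c d, c ≠ d → ∀ ℓ ∈ labels κ (A c), ℓ ∉ labels κ (A d)) ∧
      (∀ c, ∀ ℓ ∈ labels κ (A c), ℓ = .inl (.a false (emb c)) ∨ ℓ = .inl (.a true (τ (emb c))) ∨
        IsMiddle ℓ) := by
  obtain ⟨k, A, B, h⟩ := exists_state κ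
  have hk : k = κ (endCol true) := by
    obtain ⟨j, hj, rfl⟩ := h.ahead
    congr 1
    simp only [endCol, if_true, Fin.le_def, ge_iff_le, Fin.ext_iff] at *
    omega
  have hused : ∀ ℓ, ℓ ∈ labels κ A ∨ ℓ ∈ labels κ B →
      ℓ = .inl (.a false 0) ∨ ℓ = .inl (.a false 1) ∨ (IsMiddle ℓ ∧ ∀ j, ℓ ≠ .inl (.t j)) := by
    intro ℓ hℓ
    rcases h.used ℓ hℓ with h | h | ⟨j, -, rfl⟩ | rfl | ⟨k', rfl, -⟩
    · exact Or.inl h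
    · exact Or.inr (Or.inl h)
    · exact Or.inr (Or.inr ⟨⟨by simp, by simp⟩, by simp⟩)
    · exact Or.inr (Or.inr ⟨⟨by simp, by simp⟩, by simp⟩)
    · exact Or.inr (Or.inr ⟨⟨by simp, by simp⟩, by simp⟩)
  have e0 : (Fin.castLE (by norm_num) (0 : Fin 3) : Fin 15) = 0 := rfl
  have e1 : (Fin.castLE (by norm_num) (1 : Fin 3) : Fin 15) = 1 := rfl
  have e2 : (Fin.castLE (by norm_num) (2 : Fin 3) : Fin 15) = 2 := rfl
  set A' := insert (LongEdge.link true 0) A with hA'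
  set B' := insert (LongEdge.link true 1) B with hB'
  set C : Set (LongEdge n) := {LongEdge.link false 2, LongEdge.link true 2} with hC
  have lA : ∀ ℓ, ℓ ∈ labels κ A' ↔ ℓ = .inl (.a true 0) ∨ ℓ ∈ labels κ A := by
    intro ℓ
    simp only [hA', mem_labels_insert, LongEdge.src, LongEdge.tgt, terminal, label_a, if_true,
      label_x, ← hk, e0]
    constructor
    · rintro ((h1 | rfl) | h1)
      exacts [Or.inl h1, Or.inr h.endA, Or.inr h1]
    · rintro (h1 | h1)
      exacts [Or.inl (Or.inl h1), Or.inr h1]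
  have lB : ∀ ℓ, ℓ ∈ labels κ B' ↔ ℓ = .inl (.a true 1) ∨ ℓ ∈ labels κ B := by
    intro ℓ
    simp only [hB', mem_labels_insert, LongEdge.src, LongEdge.tgt, terminal, label_a, one_ne_zero,
      if_false, if_true, label_y, e1]
    constructor
    · rintro ((h1 | rfl) | h1)
      exacts [Or.inl h1, Or.inr h.endB, Or.inr h1]
    · rintro (h1 | h1)
      exacts [Or.inl (Or.inl h1), Or.inr h1]
  have lC : ∀ ℓ, ℓ ∈ labels κ C ↔ ℓ = .inl (.a false 2) ∨ ℓ = .inl (.a true 2) ∨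
      ℓ = .inl (.t ⟨0, by positivity⟩) := by
    intro ℓ
    have t2 : ∀ s, (terminal s 2 : Node n) = .t ⟨0, by positivity⟩ := fun s => rfl
    simp only [hC, mem_labels_insert, labels_singleton, LongEdge.src, LongEdge.tgt, label_a, e2, t2,
      label_t_zero]
    tauto
  have cA : CutConnected (Share κ) A' := cutConnected_insert h.connA h.endA (Or.inr (by
    simp [LongEdge.tgt, terminal, hk]))
  have cB : CutConnected (Share κ) B' := cutConnected_insert h.connB h.endB (Or.inr (by
    simp [LongEdge.tgt, terminal]))
  have cC : CutConnected (Share κ) C := by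
    refine cutConnected_insert (cutConnected_singleton _)
      (ℓ := label κ (.t ⟨0, by positivity⟩)) ?_ (Or.inr rfl)
    rw [labels_singleton]
    exact Or.inr rfl
  have notR : ∀ ℓ, ℓ ∈ labels κ A ∨ ℓ ∈ labels κ B → ∀ i, ℓ ≠ .inl (.a true i) := by
    intro ℓ hℓ i
    rcases hused ℓ hℓ with rfl | rfl | h
    · simp
    · simp
    · exact h.1.1 _ _
  have dAB : ∀ ℓ ∈ labels κ A', ℓ ∉ labels κ B' := by
    intro ℓ h1 h2
    rw [lA] at h1
    rw [lB] at h2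
    rcases h1 with rfl | h1 <;> rcases h2 with h2 | h2
    · simp at h2
    · exact notR _ (Or.inr h2) _ rfl
    · exact notR _ (Or.inl h1) _ h2
    · exact h.disj _ h1 h2
  have notC : ∀ ℓ, ℓ ∈ labels κ A ∨ ℓ ∈ labels κ B → ℓ ∉ labels κ C := by
    intro ℓ hℓ
    rw [lC]
    rcases hused ℓ hℓ with rfl | rfl | h
    · simp
    · simp
    · rintro (h' | h' | h')
      exacts [h.1.1 _ _ h', h.1.1 _ _ h', h.2 _ h']
  have dAC : ∀ ℓ ∈ labels κ A', ℓ ∉ labels κ C := by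
    intro ℓ h1
    rcases (lA ℓ).1 h1 with rfl | h1
    · rw [lC]; simp
    · exact notC ℓ (Or.inl h1)
  have dBC : ∀ ℓ ∈ labels κ B', ℓ ∉ labels κ C := by
    intro ℓ h1
    rcases (lB ℓ).1 h1 with rfl | h1
    · rw [lC]; simp
    · exact notC ℓ (Or.inr h1)
  have mid : ∀ ℓ, ℓ ∈ labels κ A ∨ ℓ ∈ labels κ B → ℓ ≠ .inl (.a false 0) →
      ℓ ≠ .inl (.a false 1) → IsMiddle ℓ := by
    intro ℓ hℓ h0 h1
    rcases hused ℓ hℓ with h | h | h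
    exacts [absurd h h0, absurd h h1, h.1]
  have uC : ∀ ℓ ∈ labels κ C, ℓ = .inl (.a false 2) ∨ ℓ = .inl (.a true 2) ∨ IsMiddle ℓ := by
    intro ℓ hℓ
    rcases (lC ℓ).1 hℓ with h | h | rfl
    · exact Or.inl h
    · exact Or.inr (Or.inl h)
    · exact Or.inr (Or.inr ⟨by simp, by simp⟩)
  have start : ∀ (D : Set (LongEdge n)) c, LongEdge.link false c ∈ D →
      .inl (.a false (emb c)) ∈ labels κ D := fun D c hD => ⟨_, hD, Or.inl (by simp [LongEdge.src, emb])⟩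
  have f0 : emb 0 = 0 := rfl
  have f1 : emb 1 = 1 := rfl
  have f2 : emb 2 = 2 := rfl
  have dBA : ∀ ℓ ∈ labels κ B', ℓ ∉ labels κ A' := fun ℓ h1 h2 => dAB ℓ h2 h1
  have dCA : ∀ ℓ ∈ labels κ C, ℓ ∉ labels κ A' := fun ℓ h1 h2 => dAC ℓ h2 h1
  have dCB : ∀ ℓ ∈ labels κ C, ℓ ∉ labels κ B' := fun ℓ h1 h2 => dBC ℓ h2 h1
  -- The parity of the number of exchanges decides whether the connections arrive in the original
  -- order or with the vertices 0 and 1 of the second clique interchanged.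
  rcases h.start with ⟨hs1, hs2⟩ | ⟨hs1, hs2⟩
  · have a0 := start A 0 hs1
    have b1 := start B 1 hs2
    rw [f0] at a0
    rw [f1] at b1
    refine ⟨1, ![A', B', C], ?_, ?_, ?_, ?_, ?_⟩
    · intro c; fin_cases c
      exacts [cA, cB, cC]
    · intro c; fin_cases c
      exacts [Or.inr hs1, Or.inr hs2, Or.inl rfl]
    · intro c; fin_cases c
      exacts [⟨0, rfl, Or.inl rfl⟩, ⟨1, rfl, Or.inl rfl⟩, ⟨2, rfl, Or.inr rfl⟩]
    · intro c d; fin_cases c <;> fin_cases d <;> intro hcd <;> first | exact absurd rfl hcd | skip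
      exacts [dAB, dAC, dBA, dBC, dCA, dCB]
    · intro c ℓ; fin_cases c <;> intro hℓ
      · rcases (lA ℓ).1 hℓ with h1 | h1
        · exact Or.inr (Or.inl h1)
        · by_cases h0 : ℓ = .inl (.a false 0)
          · exact Or.inl h0
          · exact Or.inr (Or.inr (mid ℓ (Or.inl h1) h0 (fun e => h.disj _ h1 (e ▸ b1))))
      · rcases (lB ℓ).1 hℓ with h1 | h1
        · exact Or.inr (Or.inl h1)
        · by_cases h0 : ℓ = .inl (.a false 1)
          · exact Or.inl h0
          · exact Or.inr (Or.inr (mid ℓ (Or.inr h1) (fun e => h.disj _ (e ▸ a0) h1) h0))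
      · exact uC ℓ hℓ
  · have a1 := start A 1 hs1
    have b0 := start B 0 hs2
    rw [f0] at b0
    rw [f1] at a1
    have s0 : Equiv.swap (0 : Fin 15) 1 (emb 0) = 1 := by decide
    have s1 : Equiv.swap (0 : Fin 15) 1 (emb 1) = 0 := by decide
    have s2 : Equiv.swap (0 : Fin 15) 1 (emb 2) = 2 := by decide
    refine ⟨Equiv.swap 0 1, ![B', A', C], ?_, ?_, ?_, ?_, ?_⟩
    · intro c; fin_cases c
      exacts [cB, cA, cC]
    · intro c; fin_cases c
      exacts [Or.inr hs2, Or.inr hs1, Or.inl rfl]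
    · intro c; fin_cases c
      exacts [⟨1, s0.symm, Or.inl rfl⟩, ⟨0, s1.symm, Or.inl rfl⟩, ⟨2, s2.symm, Or.inr rfl⟩]
    · intro c d; fin_cases c <;> fin_cases d <;> intro hcd <;> first | exact absurd rfl hcd | skip
      exacts [dBA, dBC, dAB, dAC, dCB, dCA]
    · intro c ℓ; fin_cases c <;> intro hℓ
      · rcases (lB ℓ).1 hℓ with h1 | h1
        · exact Or.inr (Or.inl (h1.trans (by rw [← s0]; rfl)))
        · by_cases h0 : ℓ = .inl (.a false 0)
          · exact Or.inl h0
          · exact Or.inr (Or.inr (mid ℓ (Or.inr h1) h0 (fun e => h.disj _ (e ▸ a1) h1)))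
      · rcases (lA ℓ).1 hℓ with h1 | h1
        · exact Or.inr (Or.inl (h1.trans (by rw [← s1]; rfl)))
        · by_cases h0 : ℓ = .inl (.a false 1)
          · exact Or.inl h0
          · exact Or.inr (Or.inr (mid ℓ (Or.inl h1) (fun e => h.disj _ h1 (e ▸ b0)) h0))
      · rcases uC ℓ hℓ with h1 | h1 | h1
        · exact Or.inl h1
        · exact Or.inr (Or.inl (h1.trans (by rw [← s2]; rfl)))
        · exact Or.inr (Or.inr h1)

end FatMinor
-- The model in terms of long edges
namespace FatMinor

section LabelModel

variable {n : ℕ} {K : Type*}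

/-- Sets of long edges that model `linkedK15` with respect to `Share κ`. -/
structure IsLabelModel (κ : Fin (2 ^ n) → K) (B : Fin 15 ⊕ Fin 15 → Set (LongEdge n))
    (P : linkedK15.edgeSet → Set (LongEdge n)) : Prop where
  branch_nonempty : ∀ v, (B v).Nonempty
  edge_nonempty : ∀ e, (P e).Nonempty
  branch_conn : ∀ v, CutConnected (Share κ) (B v)
  edge_conn : ∀ e, CutConnected (Share κ) (P e)
  meet : ∀ v (e : linkedK15.edgeSet), v ∈ (e : Sym2 (Fin 15 ⊕ Fin 15)) →
    ∃ a ∈ B v, ∃ b ∈ P e, Share κ a b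
  branch_branch : ∀ u v, u ≠ v → ∀ a ∈ B u, ∀ b ∈ B v, ¬ Share κ a b
  edge_edge : ∀ e f, e ≠ f → ∀ a ∈ P e, ∀ b ∈ P f, ¬ Share κ a b
  branch_edge : ∀ v (e : linkedK15.edgeSet), v ∉ (e : Sym2 (Fin 15 ⊕ Fin 15)) →
    ∀ a ∈ B v, ∀ b ∈ P e, ¬ Share κ a b

/-- Branch sets are the stars of long edges at the clique vertices, edge sets inside a clique are
the middle segments, and the cross edges are the three connections. The permutation `τ` is absorbed
by renaming the vertices of the second clique. Two nodes on each clique edge keep the stars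
label-disjoint. -/
theorem exists_isLabelModel (κ : Fin (2 ^ n) → K) : ∃ B P, IsLabelModel κ B P := by
  obtain ⟨τ, A, hconn, hl, hr, hdisj, hlab⟩ := exists_three_connections κ
  let sd : Fin 15 ⊕ Fin 15 → Bool := Sum.elim (fun _ => false) (fun _ => true)
  let ps : Fin 15 ⊕ Fin 15 → Fin 15 := Sum.elim id τ
  have hinj : ∀ u v, sd u = sd v → ps u = ps v → u = v := by
    rintro (u | u) (v | v) h1 h2 <;> simp [sd, ps] at h1 h2 ⊢ <;> exact h2
  let cross : Fin 3 → Sym2 (Fin 15 ⊕ Fin 15) := fun c => s(.inl (emb c), .inr (emb c))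
  let B : Fin 15 ⊕ Fin 15 → Set (LongEdge n) := fun v => {x | ∃ j, x = .star (sd v) (ps v) j}
  let P : linkedK15.edgeSet → Set (LongEdge n) := fun e => {x |
    (∃ u v, e.1 = s(u, v) ∧ sd u = sd v ∧ x = .mid (sd u) (ps u) (ps v)) ∨
      ∃ c, e.1 = cross c ∧ x ∈ A c}
  have hBl : ∀ v ℓ, (∃ x ∈ B v, IsEnd κ x ℓ) →
      ℓ = .inl (.a (sd v) (ps v)) ∨ ∃ j, ℓ = .inl (.m (sd v) (ps v) j) := by
    rintro v ℓ ⟨_, ⟨j, rfl⟩, rfl | rfl⟩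
    · left; simp [LongEdge.src]
    · right; exact ⟨j, by simp [LongEdge.tgt]⟩
  have hPl : ∀ e ℓ, (∃ x ∈ P e, IsEnd κ x ℓ) →
      (∃ u v, e.1 = s(u, v) ∧ sd u = sd v ∧ ℓ = .inl (.m (sd u) (ps u) (ps v))) ∨
        ∃ c, e.1 = cross c ∧ ℓ ∈ labels κ (A c) := by
    rintro e ℓ ⟨x, ⟨u, v, he, huv, rfl⟩ | ⟨c, he, hx⟩, hℓ⟩
    · left
      rcases hℓ with rfl | rfl
      · exact ⟨u, v, he, huv, by simp [LongEdge.src]⟩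
      · exact ⟨v, u, by rw [he, Sym2.eq_swap], huv.symm, by simp [LongEdge.tgt, huv]⟩
    · right; exact ⟨c, he, x, hx, hℓ⟩
  have hedge : ∀ e : linkedK15.edgeSet, (∃ u v, e.1 = s(u, v) ∧ sd u = sd v) ∨
      ∃ c, e.1 = cross c := by
    rintro ⟨e, he⟩
    induction e with
    | _ u v =>
      have he' : linkedK15.Adj u v := he
      rcases u with u | u <;> rcases v with v | v
      · exact Or.inl ⟨_, _, rfl, rfl⟩
      · obtain ⟨rfl, h⟩ := he'
        exact Or.inr ⟨⟨u, h⟩, rfl⟩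
      · obtain ⟨rfl, h⟩ := he'
        exact Or.inr ⟨⟨u, h⟩, Sym2.eq_swap⟩
      · exact Or.inl ⟨_, _, rfl, rfl⟩
  refine ⟨B, P, ?_, ?_, ?_, ?_, ?_, ?_, ?_, ?_⟩
  · exact fun v => ⟨_, 0, rfl⟩
  · intro e
    rcases hedge e with ⟨u, v, he, huv⟩ | ⟨c, he⟩
    · exact ⟨_, Or.inl ⟨u, v, he, huv, rfl⟩⟩
    · exact ⟨_, Or.inr ⟨c, he, hl c⟩⟩
  · rintro v X _ ⟨i, rfl⟩ hX _ ⟨j, rfl⟩ hX'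
    exact ⟨_, ⟨i, rfl⟩, hX, _, ⟨j, rfl⟩, hX', _, Or.inl rfl, Or.inl rfl⟩
  · intro e X x hx hxX y hy hyX
    rcases hx with ⟨u, v, he, huv, rfl⟩ | ⟨c, he, hx⟩ <;>
      rcases hy with ⟨u', v', he', huv', rfl⟩ | ⟨d, he', hy⟩
    · refine ⟨_, Or.inl ⟨u, v, he, huv, rfl⟩, hxX, _, Or.inl ⟨u', v', he', huv', rfl⟩, hyX, ?_⟩
      rw [he, Sym2.eq_iff] at he'
      rcases he' with ⟨rfl, rfl⟩ | ⟨rfl, rfl⟩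
      · exact ⟨_, Or.inl rfl, Or.inl rfl⟩
      · exact ⟨_, Or.inl rfl, Or.inr (by simp [LongEdge.src, LongEdge.tgt, huv])⟩
    · rw [he, Sym2.eq_iff] at he'
      rcases he' with ⟨rfl, rfl⟩ | ⟨rfl, rfl⟩ <;> simp [sd] at huv
    · rw [he', Sym2.eq_iff] at he
      rcases he with ⟨rfl, rfl⟩ | ⟨rfl, rfl⟩ <;> simp [sd] at huv'
    · have hcd : c = d := by
        rw [he, Sym2.eq_iff] at he'
        simpa [emb] using he'
      subst hcd
      obtain ⟨a, ha, haX, b, hb, hbX, hab⟩ := hconn c X x hx hxX y hy hyX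
      exact ⟨a, Or.inr ⟨c, he, ha⟩, haX, b, Or.inr ⟨c, he, hb⟩, hbX, hab⟩
  · intro w e hw
    rcases hedge e with ⟨u, v, he, huv⟩ | ⟨c, he⟩
    · rw [he, Sym2.mem_iff] at hw
      rcases hw with rfl | rfl
      · exact ⟨_, ⟨ps v, rfl⟩, _, Or.inl ⟨w, v, he, huv, rfl⟩, _, Or.inr rfl, Or.inl rfl⟩
      · exact ⟨_, ⟨ps u, rfl⟩, _, Or.inl ⟨w, u, he.trans Sym2.eq_swap, huv.symm, rfl⟩, _,
          Or.inr rfl, Or.inl rfl⟩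
    · have hw' := hw
      rw [he, Sym2.mem_iff] at hw'
      rcases hw' with rfl | rfl
      · exact ⟨_, ⟨0, rfl⟩, _, Or.inr ⟨c, he, hl c⟩, _, Or.inl rfl, Or.inl rfl⟩
      · obtain ⟨d, hd, hdA⟩ := hr c
        refine ⟨_, ⟨0, rfl⟩, _, Or.inr ⟨c, he, hdA⟩, _, Or.inl rfl, Or.inl ?_⟩
        simp only [LongEdge.src, sd, ps, Sum.elim_inr, ← hd]
        rfl
  · rintro u v huv a ha b hb ⟨ℓ, h1, h2⟩
    apply huv
    rcases hBl u ℓ ⟨a, ha, h1⟩ with rfl | ⟨i, rfl⟩ <;>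
      rcases hBl v _ ⟨b, hb, h2⟩ with h | ⟨j, h⟩ <;> simp at h
    · exact hinj u v h.1 h.2
    · exact hinj u v h.1 h.2.1
  · rintro e f hef a ha b hb ⟨ℓ, h1, h2⟩
    apply hef
    apply Subtype.ext
    rcases hPl e ℓ ⟨a, ha, h1⟩ with ⟨u, v, he, huv, h⟩ | ⟨c, he, hc⟩ <;>
      rcases hPl f ℓ ⟨b, hb, h2⟩ with ⟨u', v', he', huv', h'⟩ | ⟨d, he', hd⟩
    · rw [h] at h'
      simp at h'
      rw [he, he', hinj u u' h'.1 h'.2.1, hinj v v' (by rw [← huv, ← huv', h'.1]) h'.2.2]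
    · rcases hlab d ℓ hd with h' | h' | h'
      · rw [h] at h'; simp at h'
      · rw [h] at h'; simp at h'
      · exact absurd h (h'.2 _ _ _)
    · rcases hlab c ℓ hc with h | h | h
      · rw [h] at h'; simp at h'
      · rw [h] at h'; simp at h'
      · exact absurd h' (h.2 _ _ _)
    · have hcd : c = d := by
        by_contra hcd
        exact hdisj c d hcd ℓ hc hd
      rw [he, he', hcd]
  · rintro w e hw a ha b hb ⟨ℓ, h1, h2⟩
    apply hw
    rcases hBl w ℓ ⟨a, ha, h1⟩ with h | ⟨i, h⟩ <;>
      rcases hPl e ℓ ⟨b, hb, h2⟩ with ⟨u', v', he', huv', h'⟩ | ⟨d, he', hd⟩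
    · rw [h] at h'; simp at h'
    · rw [he', Sym2.mem_iff]
      rcases hlab d ℓ hd with h' | h' | h'
      · rw [h] at h'
        simp at h'
        exact Or.inl (hinj _ _ h'.1 h'.2)
      · rw [h] at h'
        simp at h'
        exact Or.inr (hinj _ _ h'.1 h'.2)
      · exact absurd h (h'.1 _ _)
    · rw [h] at h'
      simp at h'
      rw [he', hinj w u' h'.1 h'.2.1]
      simp
    · rcases hlab d ℓ hd with h' | h' | h'
      · rw [h] at h'; simp at h'
      · rw [h] at h'; simp at h'
      · exact absurd h (h'.2 _ _ _)

end LabelModel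

end FatMinor
namespace FatMinor

/-! ### Distances between long edges -/

section CapDist

variable {N E : Type*} {T : SimpleGraph N}

/-- The distance to the set `S`, capped at `m`. -/
noncomputable def capDist (T : SimpleGraph N) (m : ℕ) (S : Set N) (s : N) : ℕ :=
  (min (m : ℕ∞) (⨅ v ∈ S, T.edist s v)).toNat

theorem coe_capDist (m : ℕ) (S : Set N) (s : N) :
    (capDist T m S s : ℕ∞) = min (m : ℕ∞) (⨅ v ∈ S, T.edist s v) :=
  ENat.natCast_toNat (ne_top_of_le_ne_top (ENat.natCast_ne_top m) (min_le_left _ _))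

theorem capDist_le (m : ℕ) (S : Set N) (s : N) : capDist T m S s ≤ m := by
  have : (capDist T m S s : ℕ∞) ≤ m := by
    rw [coe_capDist]
    exact min_le_left _ _
  exact_mod_cast this

theorem capDist_of_mem {m : ℕ} {S : Set N} {s : N} (hs : s ∈ S) : capDist T m S s = 0 := by
  have : (capDist T m S s : ℕ∞) ≤ 0 := by
    rw [coe_capDist]
    refine (min_le_right _ _).trans ((iInf₂_le s hs).trans ?_)
    simp
  exact Nat.le_zero.1 (by exact_mod_cast this)

theorem capDist_lipschitz (m : ℕ) (S : Set N) (u v : N) (h : T.Adj u v) :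
    capDist T m S u ≤ capDist T m S v + 1 := by
  have : (capDist T m S u : ℕ∞) ≤ capDist T m S v + 1 := by
    rw [coe_capDist, coe_capDist, min_add]
    refine le_min ((min_le_left _ _).trans le_self_add) ((min_le_right _ _).trans ?_)
    simp only [ENat.iInf_add]
    refine le_iInf₂ fun w hw => (iInf₂_le w hw).trans ?_
    rw [add_comm]
    exact SimpleGraph.edist_triangle.trans (by rw [SimpleGraph.edist_eq_one_iff_adj.2 h])
  exact_mod_cast this

theorem exists_of_capDist_le {m d : ℕ} (hd : d < m) {S : Set N} {s : N}
    (h : capDist T m S s ≤ d) : ∃ v ∈ S, T.edist s v ≤ d := by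
  by_contra! hn
  have h1 : ((d + 1 : ℕ) : ℕ∞) ≤ capDist T m S s := by
    rw [coe_capDist]
    refine le_min (by exact_mod_cast hd) (le_iInf₂ fun v hv => ?_)
    push_cast
    exact Order.add_one_le_of_lt (hn v hv)
  have h2 : d + 1 ≤ capDist T m S s := by exact_mod_cast h1
  omega

variable {src tgt : E → N} {L : ℕ}

/-- A point of an added path that is close to a point where the extension of `capDist` vanishes
has an end close to `S`. -/
theorem exists_end_near {d : ℕ} (hd : d < L) {I : Set E} {S : Set N}
    (hI : ∀ e ∈ I, src e ∈ S ∧ tgt e ∈ S) {f : E} (hf : f ∉ I) {z z' : N ⊕ E × Fin L}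
    (hz : z ∈ closedPath src tgt L f)
    (hz' : extend src tgt L I (capDist T (d + 1) S) z' = 0)
    (h : (addPaths T src tgt L).edist z z' ≤ d) :
    ∃ u, (u = src f ∨ u = tgt f) ∧ ∃ v ∈ S, T.edist u v ≤ d := by
  -- The cap `d + 1` is at most `L`, as the extension requires, and still detects every distance up
  -- to `d`.
  have h1 := lipschitz_le_edist (G := addPaths T src tgt L)
    (extend_lipschitz (L := L) (S := I) (g := capDist T (d + 1) S)
      (fun u => (capDist_le _ _ _).trans hd) (capDist_lipschitz _ _)
      (fun e he => ⟨capDist_of_mem (hI e he).1, capDist_of_mem (hI e he).2⟩)) z z'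
  rw [hz', Nat.cast_zero, zero_add] at h1
  have h2 : extend src tgt L I (capDist T (d + 1) S) z ≤ d := by exact_mod_cast h1.trans h
  suffices h3 : capDist T (d + 1) S (src f) ≤ d ∨ capDist T (d + 1) S (tgt f) ≤ d by
    rcases h3 with h3 | h3
    · exact ⟨_, Or.inl rfl, exists_of_capDist_le (Nat.lt_succ_self d) h3⟩
    · exact ⟨_, Or.inr rfl, exists_of_capDist_le (Nat.lt_succ_self d) h3⟩
  rcases hz with rfl | rfl | ⟨i, rfl⟩
  · exact Or.inl h2
  · exact Or.inr h2
  · simp only [extend, if_neg hf] at h2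
    omega

theorem exists_end_near_node {d : ℕ} (hd : d < L) {e : E} {u : N} {z : N ⊕ E × Fin L}
    (hz : z ∈ closedPath src tgt L e) (h : (addPaths T src tgt L).edist z (.inl u) ≤ d) :
    ∃ v, (v = src e ∨ v = tgt e) ∧ T.edist v u ≤ d := by
  obtain ⟨v, hv, _, rfl, h'⟩ := exists_end_near (S := {u}) hd (I := ∅) (by simp)
    (Set.notMem_empty e) hz (by exact capDist_of_mem rfl) h
  exact ⟨v, hv, h'⟩

/-- The potential is the distance to the ends of `f`, set to zero on all of `f`; distinct long edges
can be close only near their ends, through `T`. -/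
theorem exists_ends_near {d : ℕ} (hd : d < L) {e f : E} (hef : e ≠ f) {z z' : N ⊕ E × Fin L}
    (hz : z ∈ closedPath src tgt L e) (hz' : z' ∈ closedPath src tgt L f)
    (h : (addPaths T src tgt L).edist z z' ≤ d) :
    ∃ u, (u = src e ∨ u = tgt e) ∧ ∃ v, (v = src f ∨ v = tgt f) ∧ T.edist u v ≤ d := by
  have h0 : extend src tgt L {f} (capDist T (d + 1) {src f, tgt f}) z' = 0 := by
    rcases hz' with rfl | rfl | ⟨i, rfl⟩
    · exact capDist_of_mem (by simp)
    · exact capDist_of_mem (by simp)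
    · simp [extend]
  obtain ⟨u, hu, v, hv, h'⟩ := exists_end_near hd (by simp) (by simpa using hef) hz h0 h
  exact ⟨u, hu, v, by simpa using hv, h'⟩

theorem edist_inl_le (u v : N) : (addPaths T src tgt L).edist (.inl u) (.inl v) ≤ T.edist u v := by
  by_cases h : T.Reachable u v
  · obtain ⟨p, hp⟩ := h.exists_walk_length_eq_edist
    let F : T →g addPaths T src tgt L := ⟨Sum.inl, fun h => h⟩
    rw [← hp, ← SimpleGraph.Walk.length_map F p]
    exact (p.map F).edist_le
  · rw [SimpleGraph.edist_eq_top_of_not_reachable h]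
    exact le_top

theorem CutConnected.image_inl {S : Set N} (hS : CutConnected T.Adj S) :
    CutConnected (addPaths T src tgt L).Adj (Sum.inl '' S) := by
  rintro X _ ⟨u, hu, rfl⟩ huX _ ⟨w, hw, rfl⟩ hwX
  obtain ⟨u', hu', h1, w', hw', h2, h3⟩ := hS (Sum.inl ⁻¹' X) u hu huX w hw hwX
  exact ⟨_, ⟨u', hu', rfl⟩, h1, _, ⟨w', hw', rfl⟩, h2, h3⟩

end CapDist

/-! ### Thickened images under a quasi-isometry -/

section Thick

variable {V W : Type*} {G : SimpleGraph V} {G' : SimpleGraph W} {φ : V → W} {q : ℕ}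

theorem IsQuasiIsometry.edist_map_le (h : IsQuasiIsometry q G G' φ) {x y : V} {m : ℕ}
    (hm : G.edist x y ≤ m) : G'.edist (φ x) (φ y) ≤ (q * m + q : ℕ) := by
  have h1 : (G.edist x y : ℝ≥0∞) ≤ (m : ℕ∞) := ENat.toENNReal_le.2 hm
  have h2 : (G'.edist (φ x) (φ y) : ℝ≥0∞) ≤ ((q * m + q : ℕ) : ℕ∞) := by
    refine (h.upper x y).trans ?_
    push_cast
    push_cast at h1
    gcongr
  exact ENat.toENNReal_le.1 h2

theorem IsQuasiIsometry.edist_le (h : IsQuasiIsometry q G G' φ) (hq : 1 ≤ q) {x y : V} {m : ℕ}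
    (hm : G'.edist (φ x) (φ y) ≤ m) : G.edist x y ≤ (q * (m + q) : ℕ) := by
  have h1 : (G'.edist (φ x) (φ y) : ℝ≥0∞) ≤ (m : ℕ∞) := ENat.toENNReal_le.2 hm
  have h2 := tsub_le_iff_right.1 ((h.lower x y).trans h1)
  rw [ENNReal.inv_mul_le_iff (by simpa using (by omega : q ≠ 0)) (by simp)] at h2
  refine ENat.toENNReal_le.1 (h2.trans (le_of_eq ?_))
  push_cast
  rfl

/-- The vertices of `G'` at distance at most `2 * q` from the image of `Z`. -/
def thick (G' : SimpleGraph W) (φ : V → W) (q : ℕ) (Z : Set V) : Set W :=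
  ⋃ z ∈ Z, {w | G'.edist w (φ z) ≤ (2 * q : ℕ)}

theorem mem_thick {Z : Set V} {w : W} :
    w ∈ thick G' φ q Z ↔ ∃ z ∈ Z, G'.edist w (φ z) ≤ (2 * q : ℕ) := by
  simp [thick]

theorem map_mem_thick {Z : Set V} {z : V} (hz : z ∈ Z) : φ z ∈ thick G' φ q Z :=
  mem_thick.2 ⟨z, hz, by simp⟩

/-- Images of adjacent vertices are at distance at most `q * 1 + q`, so balls of radius `2 * q`
around them overlap. -/
theorem cutConnected_thick (h : IsQuasiIsometry q G G' φ) {Z : Set V}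
    (hZ : CutConnected G.Adj Z) : CutConnected G'.Adj (thick G' φ q Z) := by
  refine hZ.iUnion (fun z _ => cutConnected_ball _ _) fun z _ z' _ hzz' => ⟨φ z', ?_, ?_⟩
  · have := h.edist_map_le (x := z') (y := z) (m := 1)
      (by rw [SimpleGraph.edist_eq_one_iff_adj.2 hzz'.symm]; simp)
    rw [mul_one, ← two_mul] at this
    exact this
  · simp

/-- The images are at distance at most `2q + 1 + 2q`, and the lower bound of the quasi-isometry
turns `m` into `q * (m + q)`. -/
theorem edist_le_of_thick (h : IsQuasiIsometry q G G' φ) (hq : 1 ≤ q) {w w' : W} {z z' : V}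
    (hw : G'.edist w (φ z) ≤ (2 * q : ℕ)) (hw' : G'.edist w' (φ z') ≤ (2 * q : ℕ))
    (hww : G'.edist w w' ≤ 1) : G.edist z z' ≤ (q * (5 * q + 1) : ℕ) := by
  have h1 : G'.edist (φ z) (φ z') ≤ (4 * q + 1 : ℕ) := by
    calc G'.edist (φ z) (φ z') ≤ G'.edist (φ z) w + (G'.edist w w' + G'.edist w' (φ z')) :=
          SimpleGraph.edist_triangle.trans (add_le_add le_rfl SimpleGraph.edist_triangle)
      _ ≤ (2 * q : ℕ) + (1 + (2 * q : ℕ)) := by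
          rw [SimpleGraph.edist_comm] at hw
          gcongr
      _ = (4 * q + 1 : ℕ) := by norm_cast; omega
  refine (h.edist_le hq h1).trans (le_of_eq ?_)
  congr 2
  omega

end Thick

end FatMinor
namespace FatMinor

/-! ### Depth in the tree -/

section Depth

variable {n L : ℕ}

/-- The node above the root of the binary tree. -/
def Node.top (n : ℕ) : Node n := .t ⟨0, by positivity⟩

/-- The distance to `t 0` in the tree, and `0` for the nodes outside the tree. -/
def Node.depth : Node n → ℕ
  | .t k => Nat.size k
  | _ => 0

theorem Node.depth_le (u : Node n) : u.depth ≤ n + 1 := by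
  rcases u with k | _ | _ | _
  · exact Nat.size_le.2 k.2
  all_goals exact Nat.zero_le _

theorem Node.le_depth_x (i : Fin (2 ^ n)) : n + 1 ≤ (Node.x i).depth :=
  Nat.lt_size.2 (Nat.le_add_right _ _)

theorem size_le_size_half_add_one (k : ℕ) : Nat.size k ≤ Nat.size (k / 2) + 1 := by
  rw [Nat.size_le, pow_succ]
  have := Nat.lt_size_self (k / 2)
  omega

theorem depth_lipschitz (u v : Node n) (h : (tree n).Adj u v) : u.depth ≤ v.depth + 1 := by
  rcases u with u | _ | _ | _ <;> rcases v with v | _ | _ | _ <;> try exact h.elim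
  have h' : u ≠ v ∧ ((u : ℕ) = v / 2 ∨ (v : ℕ) = u / 2) := h
  simp only [Node.depth]
  rcases h'.2 with h | h
  · rw [h]
    exact (Nat.size_le_size (Nat.div_le_self _ _)).trans (Nat.le_succ _)
  · rw [h]
    exact size_le_size_half_add_one _

/-- Depths are at most `n + 1 ≤ L`, so the long edges offer no shortcut to `t 0`. -/
theorem depth_le_edist_top (hL : n + 1 ≤ L) (u : Node n) :
    (u.depth : ℕ∞) ≤ (fatGraph n L).edist (.inl u) (.inl (.top n)) := by
  have := lipschitz_le_edist (G := fatGraph n L)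
    (extend_lipschitz (L := L) (S := ∅) (g := Node.depth) (fun u => u.depth_le.trans hL)
      depth_lipschitz (by simp)) (.inl u) (.inl (.top n))
  simpa [extend, Node.top, Node.depth] using this

theorem le_depth_of_edist_le {d : ℕ} {u : Node n} {i : Fin (2 ^ n)}
    (h : (tree n).edist u (.x i) ≤ d) : n + 1 ≤ u.depth + d := by
  have h1 := lipschitz_le_edist depth_lipschitz (.x i) u
  rw [SimpleGraph.edist_comm] at h1
  have h2 : (Node.x i).depth ≤ u.depth + d := by
    exact_mod_cast h1.trans (add_le_add le_rfl h)
  exact (Node.le_depth_x i).trans h2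

theorem eq_of_edist_le_of_forall_ne {d : ℕ} {u v : Node n} (hu : ∀ k, u ≠ .t k)
    (h : (tree n).edist u v ≤ d) : u = v := by
  have hr : (tree n).Reachable u v := by
    by_contra hn
    rw [SimpleGraph.edist_eq_top_of_not_reachable hn] at h
    simp at h
  obtain ⟨p⟩ := hr
  cases p with
  | nil => rfl
  | @cons _ w _ h _ =>
    rcases u with k | _ | _ | _
    · exact absurd rfl (hu k)
    all_goals exact h.elim

/-- `u` is an end of the long edge `e`. -/
def LongEdge.HasEnd (e : LongEdge n) (u : Node n) : Prop := u = e.src ∨ u = e.tgt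

theorem LongEdge.HasEnd.cases {e : LongEdge n} {u : Node n} (h : e.HasEnd u) :
    u = .top n ∨ (∃ i, u = .x i) ∨ ∀ k, u ≠ .t k := by
  rcases h with rfl | rfl
  · cases e <;> simp [LongEdge.src, Node.x]
  · rcases e with i | i | i | ⟨s, i, j⟩ | ⟨s, i, j⟩ | ⟨s, c⟩
    · simp [LongEdge.tgt]
    · simp [LongEdge.tgt]
    · exact Or.inr (Or.inl ⟨_, rfl⟩)
    · simp [LongEdge.tgt]
    · simp [LongEdge.tgt]
    · simp only [LongEdge.tgt, terminal]
      split_ifs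
      · exact Or.inr (Or.inl ⟨_, rfl⟩)
      · simp
      · exact Or.inl rfl

theorem eq_or_of_label_eq {K : Type*} {κ : Fin (2 ^ n) → K} {u v : Node n}
    (h : label κ u = label κ v) : u = v ∨ ∃ i j, u = .x i ∧ v = .x j ∧ κ i = κ j := by
  by_cases hu : ∃ i, u = .x i
  · obtain ⟨i, rfl⟩ := hu
    by_cases hv : ∃ j, v = .x j
    · obtain ⟨j, rfl⟩ := hv
      simp only [label_x, Sum.inr.injEq] at h
      exact Or.inr ⟨i, j, rfl, rfl, h⟩
    · rw [label_x, label, dif_neg hv] at h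
      cases h
  · by_cases hv : ∃ j, v = .x j
    · obtain ⟨j, rfl⟩ := hv
      rw [label_x, label, dif_neg hu] at h
      cases h
    · rw [label, dif_neg hu, label, dif_neg hv] at h
      exact Or.inl (Sum.inl_injective h)

end Depth

/-! ### The 2-fat model in the quasi-isometric graph -/

section Hat

theorem cutConnected_union_iUnion {α ι : Type*} {r : α → α → Prop} (hr : ∀ ⦃a b⦄, r a b → r b a)
    {R : Set α} (hR : CutConnected r R) {c : α} (hc : c ∈ R) {I : Set ι} {F : ι → Set α}
    (hF : ∀ i ∈ I, CutConnected r (F i)) (hRF : ∀ i ∈ I, (R ∩ F i).Nonempty) :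
    CutConnected r (R ∪ ⋃ i ∈ I, F i) := by
  refine cutConnected_of_center hr c fun X hcX w hw hwX => ?_
  have key : ∀ S ⊆ R ∪ ⋃ i ∈ I, F i, CutConnected r S → c ∈ S → w ∈ S →
      ∃ u' ∈ R ∪ ⋃ i ∈ I, F i, u' ∈ X ∧ ∃ w' ∈ R ∪ ⋃ i ∈ I, F i, w' ∉ X ∧ r u' w' := by
    intro S hS hSc hcS hwS
    obtain ⟨u', h1, h2, w', h3, h4, h5⟩ := hSc X w hwS hwX c hcS hcX
    exact ⟨u', hS h1, h2, w', hS h3, h4, h5⟩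
  rcases hw with hw | hw
  · exact key R Set.subset_union_left hR hc hw
  · simp only [Set.mem_iUnion, exists_prop] at hw
    obtain ⟨i, hi, hw⟩ := hw
    exact key (R ∪ F i) (Set.union_subset_union_right _ (Set.subset_biUnion_of_mem hi))
      (hR.union (hF i hi) (hRF i hi)) (Or.inl hc) (Or.inr hw)

variable {W : Type*} {G' : SimpleGraph W} {n L q : ℕ} {φ : Node n ⊕ LongEdge n × Fin L → W}

/-- The bound for the distance in `G` of points whose images have thickenings at distance at
most `1`. -/
def reach (q : ℕ) : ℕ := q * (5 * q + 1)

/-- The radius around the image of `t 0` that is removed from the thickened tree. -/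
def radius (q : ℕ) : ℕ := q * reach q + 3 * q

/-- The thickened image of the tree outside a ball around the image of `t 0`. -/
def lowerTree (G' : SimpleGraph W) (q : ℕ) (φ : Node n ⊕ LongEdge n × Fin L → W) : Set W :=
  {w | (∃ k, G'.edist w (φ (.inl (.t k))) ≤ (2 * q : ℕ)) ∧
    ¬ G'.edist w (φ (.inl (.top n))) ≤ (radius q : ℕ)}

/-- The component of the lower part of the tree at the leaf in column `i`. -/
def leafComp (G' : SimpleGraph W) (q : ℕ) (φ : Node n ⊕ LongEdge n × Fin L → W)
    (i : Fin (2 ^ n)) : Set W :=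
  compOf G'.Adj (lowerTree G' q φ) (φ (.inl (.x i)))

/-- The thickened image of a long edge, together with the components at its leaf ends. -/
def hat (G' : SimpleGraph W) (q : ℕ) (φ : Node n ⊕ LongEdge n × Fin L → W) (e : LongEdge n) :
    Set W :=
  thick G' φ q (closedPath LongEdge.src LongEdge.tgt L e) ∪
    ⋃ i ∈ {i | e.HasEnd (.x i)}, leafComp G' q φ i

theorem mem_hat {e : LongEdge n} {w : W} :
    w ∈ hat G' q φ e ↔ w ∈ thick G' φ q (closedPath LongEdge.src LongEdge.tgt L e) ∨
      ∃ i, e.HasEnd (.x i) ∧ w ∈ leafComp G' q φ i := by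
  simp [hat]

theorem LongEdge.HasEnd.mem_closedPath {e : LongEdge n} {u : Node n} (h : e.HasEnd u) :
    .inl u ∈ closedPath LongEdge.src LongEdge.tgt L e := by
  rcases h with rfl | rfl
  exacts [Or.inl rfl, Or.inr (Or.inl rfl)]

theorem share_of_label_eq {K : Type*} {κ : Fin (2 ^ n) → K} {e f : LongEdge n} {u v : Node n}
    (hu : e.HasEnd u) (hv : f.HasEnd v) (h : label κ u = label κ v) : Share κ e f := by
  refine ⟨label κ u, ?_, ?_⟩
  · rcases hu with rfl | rfl
    exacts [Or.inl rfl, Or.inr rfl]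
  · rw [h]
    rcases hv with rfl | rfl
    exacts [Or.inl rfl, Or.inr rfl]

theorem symmAdj ⦃a b : W⦄ (h : G'.Adj a b) : G'.Adj b a := h.symm

/-- A node near a leaf is deep. If its thickened image met the removed ball, its depth would be at
most `q * (radius q + 3 * q)`, which the size of `n` forbids. -/
theorem mem_lowerTree
    (h : IsQuasiIsometry q (fatGraph n L) G' φ) (hq : 1 ≤ q)
    (hn : q * (radius q + 3 * q) + reach q ≤ n) (hL : n + 1 ≤ L)
    {u : Node n} {i : Fin (2 ^ n)} (hu : (tree n).edist u (.x i) ≤ reach q)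
    {w : W} (hw : G'.edist w (φ (.inl u)) ≤ (2 * q : ℕ)) : w ∈ lowerTree G' q φ := by
  have h1 := le_depth_of_edist_le hu
  constructor
  · rcases u with k | _ | _ | _
    · exact ⟨k, hw⟩
    all_goals
      simp only [Node.depth] at h1
      omega
  · intro h2
    have h3 : G'.edist (φ (.inl u)) (φ (.inl (.top n))) ≤ (2 * q + radius q : ℕ) := by
      rw [SimpleGraph.edist_comm] at hw
      push_cast
      push_cast at hw
      exact SimpleGraph.edist_triangle.trans (add_le_add hw h2)
    have h4 : u.depth ≤ q * (2 * q + radius q + q) := by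
      exact_mod_cast (depth_le_edist_top hL u).trans (h.edist_le hq h3)
    have h5 : q * (2 * q + radius q + q) = q * (radius q + 3 * q) := by ring
    omega

/-- The ball of radius `reach q` around the leaf in the tree is connected, and its thickened image
avoids the removed ball; hence it lies in a single component. -/
theorem mem_leafComp
    (h : IsQuasiIsometry q (fatGraph n L) G' φ) (hq : 1 ≤ q)
    (hn : q * (radius q + 3 * q) + reach q ≤ n) (hL : n + 1 ≤ L)
    {u : Node n} {i : Fin (2 ^ n)} (hu : (tree n).edist u (.x i) ≤ reach q)
    {w : W} (hw : G'.edist w (φ (.inl u)) ≤ (2 * q : ℕ)) : w ∈ leafComp G' q φ i := by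
  have hc : CutConnected G'.Adj (thick G' φ q (Sum.inl '' {u | (tree n).edist u (.x i) ≤ reach q})) :=
    cutConnected_thick h (cutConnected_ball _ _).image_inl
  refine hc.subset_compOf ?_ (map_mem_thick ⟨.x i, by simp, rfl⟩) (mem_compOf_self _ _)
    (mem_thick.2 ⟨_, ⟨u, hu, rfl⟩, hw⟩)
  intro w hw
  obtain ⟨_, ⟨v, hv, rfl⟩, hw⟩ := mem_thick.1 hw
  exact mem_lowerTree h hq hn hL hv hw

theorem map_x_mem_lowerTree
    (h : IsQuasiIsometry q (fatGraph n L) G' φ) (hq : 1 ≤ q)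
    (hn : q * (radius q + 3 * q) + reach q ≤ n) (hL : n + 1 ≤ L)
    (i : Fin (2 ^ n)) : φ (.inl (.x i)) ∈ lowerTree G' q φ :=
  mem_lowerTree h hq hn hL (u := .x i) (i := i) (by simp) (by simp)

theorem leafComp_eq
    (h : IsQuasiIsometry q (fatGraph n L) G' φ) (hq : 1 ≤ q)
    (hn : q * (radius q + 3 * q) + reach q ≤ n) (hL : n + 1 ≤ L)
    {i j : Fin (2 ^ n)} {w : W} (hi : w ∈ leafComp G' q φ i)
    (hj : w ∈ leafComp G' q φ j) : leafComp G' q φ i = leafComp G' q φ j :=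
  (compOf_eq symmAdj (map_x_mem_lowerTree h hq hn hL i) hi).symm.trans
    (compOf_eq symmAdj (map_x_mem_lowerTree h hq hn hL j) hj)

/-- An end of a long edge is `t 0`, a leaf, or a node isolated in the tree. The leaves are too far
from `t 0`, isolated nodes are close only to themselves, and two close leaves have the same
component. -/
theorem label_eq_of_edist_le
    (h : IsQuasiIsometry q (fatGraph n L) G' φ) (hq : 1 ≤ q)
    (hn : q * (radius q + 3 * q) + reach q ≤ n) (hL : n + 1 ≤ L)
    {e f : LongEdge n} {u v : Node n} (hu : e.HasEnd u)
    (hv : f.HasEnd v) (huv : (tree n).edist u v ≤ reach q) :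
    label (leafComp G' q φ) u = label (leafComp G' q φ) v := by
  have htop : ∀ i, ¬ (tree n).edist (.top n) (.x i) ≤ reach q := by
    intro i hi
    have := le_depth_of_edist_le hi
    simp only [Node.top, Node.depth, Nat.size_zero] at this
    omega
  have hvu : (tree n).edist v u ≤ reach q := by rwa [SimpleGraph.edist_comm]
  rcases hu.cases with rfl | ⟨i, rfl⟩ | hu
  · rcases hv.cases with rfl | ⟨j, rfl⟩ | hv
    · rfl
    · exact absurd huv (htop j)
    · rw [eq_of_edist_le_of_forall_ne hv hvu]
  · rcases hv.cases with rfl | ⟨j, rfl⟩ | hv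
    · exact absurd hvu (htop i)
    · rw [label_x, label_x]
      congr 1
      exact leafComp_eq h hq hn hL (w := φ (.inl (.x i))) (mem_compOf_self _ _)
        (mem_leafComp h hq hn hL huv (by simp))
    · rw [eq_of_edist_le_of_forall_ne hv hvu]
  · rw [eq_of_edist_le_of_forall_ne hu huv]

/-- The long edge must have an end near the given tree node. If this end were `t 0`, the point would
be within `2q + (q * reach q + q)` of its image, which is `radius q`, and would have been removed.
-/
theorem exists_leaf_end
    (h : IsQuasiIsometry q (fatGraph n L) G' φ) (hq : 1 ≤ q)
    (hn : q * (radius q + 3 * q) + reach q ≤ n) (hL : n + 1 ≤ L)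
    {w w' : W} {e : LongEdge n} (hw : w ∈ lowerTree G' q φ)
    (hw' : w' ∈ thick G' φ q (closedPath LongEdge.src LongEdge.tgt L e))
    (hww : G'.edist w' w ≤ 1) : ∃ i, e.HasEnd (.x i) ∧ w ∈ leafComp G' q φ i := by
  obtain ⟨⟨k, hk⟩, hρ⟩ := hw
  obtain ⟨z, hz, hwz⟩ := mem_thick.1 hw'
  obtain ⟨v, hv, hvk⟩ := exists_end_near_node (d := reach q) (by omega) hz
    (edist_le_of_thick h hq hwz hk hww)
  have hv' : e.HasEnd v := hv
  rw [SimpleGraph.edist_comm] at hvk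
  rcases hv'.cases with rfl | ⟨i, rfl⟩ | hne
  · refine absurd ?_ hρ
    have h1 := h.edist_map_le ((edist_inl_le _ _).trans hvk)
    have h2 := SimpleGraph.edist_triangle.trans (add_le_add hk h1)
    refine h2.trans (le_of_eq ?_)
    norm_cast
    simp only [radius]
    omega
  · exact ⟨i, hv', mem_leafComp h hq hn hL hvk hk⟩
  · rw [SimpleGraph.edist_comm] at hvk
    exact absurd (eq_of_edist_le_of_forall_ne hne hvk) (hne k)

theorem cutConnected_hat (h : IsQuasiIsometry q (fatGraph n L) G' φ) (hL : 0 < L) (e : LongEdge n) :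
    CutConnected G'.Adj (hat G' q φ e) :=
  cutConnected_union_iUnion symmAdj (cutConnected_thick h (cutConnected_closedPath hL e))
    (map_mem_thick (Or.inl rfl)) (fun _ _ => cutConnected_compOf symmAdj _ _)
    fun _ hi => ⟨_, map_mem_thick hi.mem_closedPath, mem_compOf_self _ _⟩

/-- Leaves with equal labels may be different nodes; the components included in the hats supply the
common point. -/
theorem hat_inter_hat {e f : LongEdge n} (hef : Share (leafComp G' q φ) e f) :
    (hat G' q φ e ∩ hat G' q φ f).Nonempty := by
  obtain ⟨ℓ, h1, h2⟩ := hef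
  obtain ⟨u, hu, rfl⟩ : ∃ u, e.HasEnd u ∧ label (leafComp G' q φ) u = ℓ := by
    rcases h1 with rfl | rfl
    exacts [⟨_, Or.inl rfl, rfl⟩, ⟨_, Or.inr rfl, rfl⟩]
  obtain ⟨v, hv, huv⟩ : ∃ v, f.HasEnd v ∧ label (leafComp G' q φ) u = label (leafComp G' q φ) v := by
    rcases h2 with h2 | h2
    exacts [⟨_, Or.inl rfl, h2⟩, ⟨_, Or.inr rfl, h2⟩]
  rcases eq_or_of_label_eq huv with rfl | ⟨i, j, rfl, rfl, hij⟩
  · exact ⟨_, Or.inl (map_mem_thick hu.mem_closedPath), Or.inl (map_mem_thick hv.mem_closedPath)⟩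
  · refine ⟨φ (.inl (.x i)), mem_hat.2 (Or.inr ⟨i, hu, mem_compOf_self _ _⟩),
      mem_hat.2 (Or.inr ⟨j, hv, ?_⟩)⟩
    rw [← hij]
    exact mem_compOf_self _ _

theorem share_of_edist_le_one
    (h : IsQuasiIsometry q (fatGraph n L) G' φ) (hq : 1 ≤ q)
    (hn : q * (radius q + 3 * q) + reach q ≤ n) (hL : n + 1 ≤ L)
    {e f : LongEdge n} {w w' : W} (hw : w ∈ hat G' q φ e)
    (hw' : w' ∈ hat G' q φ f) (hww : G'.edist w w' ≤ 1) : Share (leafComp G' q φ) e f := by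
  have hwX : ∀ i, leafComp G' q φ i ⊆ lowerTree G' q φ :=
    fun i => compOf_subset (map_x_mem_lowerTree h hq hn hL i)
  have key : ∀ {e f i j w}, LongEdge.HasEnd e (.x i) → LongEdge.HasEnd f (.x j) →
      w ∈ leafComp G' q φ i → w ∈ leafComp G' q φ j → Share (leafComp G' q φ) e f := by
    intro e f i j w hi hj hwi hwj
    exact share_of_label_eq hi hj (by rw [label_x, label_x, leafComp_eq h hq hn hL hwi hwj])
  rcases mem_hat.1 hw with hw | ⟨i, hi, hw⟩ <;> rcases mem_hat.1 hw' with hw' | ⟨j, hj, hw'⟩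
  · by_cases hef : e = f
    · subst hef
      exact ⟨_, Or.inl rfl, Or.inl rfl⟩
    · obtain ⟨z, hz, hwz⟩ := mem_thick.1 hw
      obtain ⟨z', hz', hwz'⟩ := mem_thick.1 hw'
      obtain ⟨u, hu, v, hv, huv⟩ := exists_ends_near (d := reach q) (by omega) hef hz hz'
        (edist_le_of_thick h hq hwz hwz' hww)
      exact share_of_label_eq hu hv (label_eq_of_edist_le h hq hn hL hu hv huv)
  · obtain ⟨i, hi, hw⟩ := exists_leaf_end h hq hn hL (hwX j hw') hw hww
    exact key hi hj hw hw'
  · rw [SimpleGraph.edist_comm] at hww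
    obtain ⟨j, hj, hw'⟩ := exists_leaf_end h hq hn hL (hwX i hw) hw' hww
    exact key hi hj hw hw'
  -- Adjacent points of the lower tree lie in the same component. Distinct components are merely
  -- non-adjacent, which is why the model is 2-fat.
  · refine key hi hj (w := w') ?_ hw'
    by_cases hne : w = w'
    · exact hne ▸ hw
    · by_cases hadj : G'.Adj w w'
      · exact compOf_closed hw hadj (hwX j hw')
      · exact absurd (hww.trans_lt (by norm_num)) (two_le_edist hne hadj).not_gt

theorem isFatMinor_of_isQuasiIsometry
    (h : IsQuasiIsometry q (fatGraph n L) G' φ) (hq : 1 ≤ q)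
    (hn : q * (radius q + 3 * q) + reach q ≤ n) (hL : n + 1 ≤ L) :
    IsFatMinor 2 linkedK15 G' := by
  obtain ⟨B, P, M⟩ := exists_isLabelModel (leafComp G' q φ)
  have hconn : ∀ S : Set (LongEdge n), S.Nonempty → CutConnected (Share (leafComp G' q φ)) S →
      (G'.induce (⋃ e ∈ S, hat G' q φ e)).Connected := by
    rintro S ⟨e, he⟩ hS
    rw [connected_induce_iff]
    exact ⟨⟨_, Set.mem_biUnion he (Or.inl (map_mem_thick (Or.inl rfl)))⟩,
      hS.iUnion (fun e _ => cutConnected_hat h (by omega) e) fun _ _ _ _ => hat_inter_hat⟩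
  have hdist : ∀ S S' : Set (LongEdge n),
      (∀ e ∈ S, ∀ f ∈ S', ¬ Share (leafComp G' q φ) e f) →
      ((2 : ℕ) : ℕ∞) ≤ setDist G' (⋃ e ∈ S, hat G' q φ e) (⋃ e ∈ S', hat G' q φ e) := by
    intro S S' hSS
    rw [le_setDist_iff]
    intro w hw w' hw'
    simp only [Set.mem_iUnion, exists_prop] at hw hw'
    obtain ⟨e, he, hw⟩ := hw
    obtain ⟨f, hf, hw'⟩ := hw'
    have h1 : ¬ G'.edist w w' ≤ 1 :=
      fun hww => hSS e he f hf (share_of_edist_le_one h hq hn hL hw hw' hww)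
    refine two_le_edist ?_ ?_
    · rintro rfl
      exact h1 (by simp)
    · intro hadj
      exact h1 (SimpleGraph.edist_eq_one_iff_adj.2 hadj).le
  refine ⟨fun v => ⋃ e ∈ B v, hat G' q φ e, fun e => ⋃ f ∈ P e, hat G' q φ f, ?_⟩
  exact {
    connected_branch := fun v => hconn _ (M.branch_nonempty v) (M.branch_conn v)
    connected_edge := fun e => hconn _ (M.edge_nonempty e) (M.edge_conn e)
    meet := by
      intro v e hve
      obtain ⟨a, ha, b, hb, hab⟩ := M.meet v e hve
      obtain ⟨w, hwa, hwb⟩ := hat_inter_hat hab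
      exact ⟨w, Set.mem_biUnion ha hwa, Set.mem_biUnion hb hwb⟩
    branch_branch := fun u v huv => hdist _ _ (M.branch_branch u v huv)
    edge_edge := fun e f hef => hdist _ _ (M.edge_edge e f hef)
    branch_edge := fun v e hve => hdist _ _ (M.branch_edge v e hve) }

end Hat

end FatMinor

theorem theorem1 (q : ℕ) (hq : 1 ≤ q) :
    ∃ (V : Type) (_ : Finite V) (G : SimpleGraph V),
      ¬ FatMinor.IsFatMinor 3 FatMinor.linkedK15 G ∧
      ∀ (W : Type*) (G' : SimpleGraph W), FatMinor.IsQuasiIsometric q G G' →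
        FatMinor.IsFatMinor 2 FatMinor.linkedK15 G' ∧ FatMinor.IsMinor FatMinor.linkedK15 G' := by
  -- The least depth allowed by the estimates; paths with `n + 1` interior vertices are then long
  -- enough.
  let n := q * (FatMinor.radius q + 3 * q) + FatMinor.reach q
  refine ⟨FatMinor.Node n ⊕ FatMinor.LongEdge n × Fin (n + 1), inferInstance,
    FatMinor.fatGraph n (n + 1), FatMinor.not_isFatMinor n (n + 1), ?_⟩
  rintro W G' ⟨φ, hφ⟩
  have h := FatMinor.isFatMinor_of_isQuasiIsometry hφ hq le_rfl le_rfl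
  exact ⟨h, h.isMinor one_le_two⟩
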